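/- **Setting.** Let $n\ge 2$ and let $M$ be a smooth $n$-manifold (without boundary). Fields are $\phi=(A,\varphi)$, where $A=(A^a)$ is a finite family of smooth $1$-forms (the components of connections) and $\varphi=(\varphi^b)$ a finite family of smooth functions on $M$; variations $\delta\phi$ are of the same type. Let $L(\phi)=\tilde L(A,\varphi,dA,d\varphi)\in\Omega^n(M)$ be a first-order Lagrangian: $\tilde L$ is a smooth function, defined on an open $GL_n(\mathbb R)$-invariant set of pointwise values of $(A,\varphi,dA,d\varphi)$, with values in $n$-forms, that commutes with linear changes of frame of the tangent space (so that $L$ is $\mathrm{Diff}(M)$-covariant, without background structure). Field space $\Phi$ consists of the smooth $\phi$ with values in this set. Write $\boldsymbol d$ for the differential on $\Phi$ (so $\boldsymbol dF|_\phi(\delta\phi)=\frac{d}{dt}|_{0}F(\phi+t\,\delta\phi)$, and for a $1$-form, $(\boldsymbol d\alpha)(\delta_1\phi,\delta_2\phi)=\delta_1(\alpha(\delta_2\phi))-\delta_2(\alpha(\delta_1\phi))$ for constant $\delta_i\phi$), and $d,\iota_X,\mathfrak L_X$ for the differential, interior product and Lie derivative on $M$. Define the momenta by $\delta\tilde L=\delta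 A^a\wedge\frac{\partial L}{\partial A^a}+\delta\varphi^b\frac{\partial L}{\partial\varphi^b}+\delta(dA^a)\wedge\frac{\partial L}{\partial(dA^a)}+\delta(d\varphi^b)\wedge\frac{\partial L}{\partial(d\varphi^b)}$ and put $$\theta(\delta\phi;\phi)=\delta A^a\wedge\tfrac{\partial L}{\partial(dA^a)}+\delta\varphi^b\tfrac{\partial L}{\partial(d\varphi^b)},\qquad E(\delta\phi;\phi)=\delta A^a\wedge\Big(\tfrac{\partial L}{\partial A^a}+d\tfrac{\partial L}{\partial(dA^a)}\Big)+\delta\varphi^b\Big(\tfrac{\partial L}{\partial\varphi^b}-d\tfrac{\partial L}{\partial(d\varphi^b)}\Big).$$ The same formulas define $\theta(\iota_X\phi;\phi)$ and $E(\iota_X\phi;\phi)$, where $\delta A^a,\delta\varphi^b$ are replaced by $\iota_XA^a$ and $0$. "On shell" means $\phi\in\mathcal S=\{\phi\in\Phi: E(\,\cdot\,;\phi)=0\}$. Let $\boldsymbol\Theta=\boldsymbol d\theta$. Let $\mathfrak{diff}(M)$ be the smooth vector fields with bracket $[X,Y]=-[X,Y]_{\Gamma(TM)}$; $X$ acts on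 $\Phi$ by the vector field $X^v|_\phi=\mathfrak L_X\phi$. Let $\gamma(X;\phi)\in\Omega^{n-2}(M)$ be linear in $X$ and a smooth local functional of $\phi$. Let $\Sigma$ be a smooth cubical $(n-1)$-chain in $M$ with boundary $\partial\Sigma$. Put $$J(X;\phi)=\iota_{X^v}\theta-\iota_XL-d\gamma(X;\phi),\quad Q_\Sigma(X;\phi)=\int_\Sigma J(X;\phi),\quad \boldsymbol\Theta_\Sigma=\int_\Sigma\boldsymbol\Theta,\quad \{Q_\Sigma(X;\phi),Q_\Sigma(Y;\phi)\}:=\boldsymbol\Theta_\Sigma(X^v,Y^v),$$ $$\mathscr C(X,Y;\phi)=\int_{\partial\Sigma}\mathfrak L_X\theta(\iota_Y\phi;\phi)-\mathfrak L_Y\theta(\iota_X\phi;\phi)+\iota_X\iota_YL+\gamma([X,Y];\phi)+\iota_YE(\iota_X\phi;\phi)-\iota_XE(\iota_Y\phi;\phi).$$ **Theorem.** 0. $\boldsymbol dL|_\phi(\delta\phi)=E(\delta\phi;\phi)+d\theta(\delta\phi;\phi)$ for all $\phi\in\Phi$ and all smooth $\delta\phi$. 1. For all $\phi\in\Phi$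 and $X,Y\in\mathfrak{diff}(M)$: $$\{Q_\Sigma(X;\phi),Q_\Sigma(Y;\phi)\}=Q_\Sigma([X,Y];\phi)+\mathscr C(X,Y;\phi)+\int_\Sigma \iota_YE(\mathfrak L_X\phi;\phi)-\iota_XE(\mathfrak L_Y\phi;\phi).$$ 2. On shell, $\{Q_\Sigma(X;\phi),Q_\Sigma(Y;\phi)\}=Q_\Sigma([X,Y];\phi)+\mathscr C(X,Y;\phi)$, and $\mathscr C(X,Y;\phi)=\int_{\partial\Sigma}\mathfrak L_X\theta(\iota_Y\phi;\phi)-\mathfrak L_Y\theta(\iota_X\phi;\phi)+\iota_X\iota_YL+\gamma([X,Y];\phi)$. 3. On shell, $\mathscr C(X,[Y,Z];\phi)+\text{c.p.}=\int_\Sigma(\boldsymbol d\iota_{X^v}\boldsymbol\Theta)(Y^v,Z^v)+\text{c.p.}$, where c.p. denotes the cyclic permutations of $X,Y,Z$. 4. On shell, $\iota_{X^v}\boldsymbol\Theta_\Sigma=-\boldsymbol dQ_\Sigma(X;\phi)+\int_{\partial\Sigma}\big(\iota_X\theta-\boldsymbol d\gamma(X;\phi)\big)$ on smooth variations. 5.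 Let $P\subseteq\mathcal S$ be a space of solutions (e.g. cut out by boundary conditions) to which all $X^v$ are tangent near $\Sigma$; here $\delta\phi$ is tangent at $\phi\in P$ near $\Sigma$ if some smooth curve in $P$ through $\phi$ has a velocity equal to $\delta\phi$ on a neighbourhood of $\Sigma$. Suppose that the charges are moment maps on $P$, i.e. $\iota_{X^v}\boldsymbol\Theta_\Sigma=-\boldsymbol dQ_\Sigma(X)$ on vectors tangent to $P$ near $\Sigma$, for all $X$; or that the action is symplectic, i.e. $\boldsymbol d\iota_{X^v}\boldsymbol\Theta_\Sigma=0$ on pairs of such vectors, for all $X$. Then on $P$ one has $\mathscr C(X,[Y,Z];\phi)+\text{c.p.}=0$, and the charge algebra is a central extension of $\mathfrak{diff}(M)$: $\mathscr C$ is a bilinear map $\mathfrak{diff}(M)\times\mathfrak{diff}(M)\to C^\infty(P)$ (functions smooth along smooth finite-dimensional families in $P$), and there is a short exact sequence of real Lie algebras $$0\to C^\infty(P)\xrightarrow{\ \iota\ }\mathrm{PAlg}[Q_\Sigma]\xrightarrow{\ \pi\ }\mathfrak{diff}(M)\to0$$ with $C^\infty(P)$ abelian and $\operatorname{im}\iota$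 central, a linear section $q$ of $\pi$ and a linear evaluation map $\mathrm{ev}:\mathrm{PAlg}[Q_\Sigma]\to C^\infty(P)$ such that $\mathrm{ev}\circ\iota=\mathrm{id}$, $\mathrm{ev}(q(X))=Q_\Sigma(X;\,\cdot\,)$, $[q(X),q(Y)]=q([X,Y])+\iota(\mathscr C(X,Y))$ and $\mathrm{ev}([q(X),q(Y)])=\{Q_\Sigma(X),Q_\Sigma(Y)\}$. -/

import Mathlib

open scoped Manifold ContDiff

noncomputable section

namespace CovPhase

/-! ### Differential forms on a manifold

`M` is a smooth `n`-manifold modelled on `Vec n`; in Mathlib every tangent space `T_x M` is a copy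
of `Vec n` (identified with `T_x M` through the preferred chart at `x`). -/

/-- The model vector space `ℝⁿ`. -/
abbrev Vec (n : ℕ) : Type := EuclideanSpace ℝ (Fin n)

/-- Real alternating `k`-forms on `ℝⁿ`. -/
abbrev Alt (n k : ℕ) : Type := Vec n [⋀^Fin k]→L[ℝ] ℝ

/-- (Not necessarily smooth) differential `k`-forms on `M`: an alternating `k`-form on each
tangent space `T_x M`. -/
abbrev Form (n : ℕ) (M : Type*) (k : ℕ) : Type _ := M → Alt n k

section Forms

variable {n k : ℕ} {M : Type*} [TopologicalSpace M] [ChartedSpace (Vec n) M]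

/-- The expression of a form in the preferred chart at `p`, i.e. its pullback by the inverse
chart. -/
def chartRep (w : Form n M k) (p : M) : Vec n → Alt n k := fun y =>
  (w ((extChartAt (𝓡 n) p).symm y)).compContinuousLinearMap
    (mfderiv 𝓘(ℝ, Vec n) (𝓡 n) (extChartAt (𝓡 n) p).symm y : Vec n →L[ℝ] Vec n)

/-- Smooth forms: all chart expressions are smooth. -/
def IsSmooth (w : Form n M k) : Prop :=
  ∀ p : M, ContDiffOn ℝ ∞ (chartRep w p) (extChartAt (𝓡 n) p).target

/-- The de Rham differential `d` of `M`, computed at `x` in the preferred chart at `x`. -/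
def extD (w : Form n M k) : Form n M (k + 1) := fun x =>
  (extDeriv (chartRep w x) (extChartAt (𝓡 n) x x)).compContinuousLinearMap
    (mfderiv (𝓡 n) 𝓘(ℝ, Vec n) (extChartAt (𝓡 n) x) x : Vec n →L[ℝ] Vec n)

/-- The interior product `ι_X w`. -/
def iprod (X : ∀ x : M, TangentSpace (𝓡 n) x) (w : Form n M (k + 1)) : Form n M k := fun x =>
  (w x).curryLeft (X x)

/-- The Lie derivative `𝔏_X = ι_X d + d ι_X` of forms on `M` (with `ι_X = 0` on functions). -/
def lieD (X : ∀ x : M, TangentSpace (𝓡 n) x) : {k : ℕ} → Form n M k → Form n M k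
  | 0, w => iprod X (extD w)
  | _ + 1, w => iprod X (extD w) + extD (iprod X w)

end Forms

/-! ### Exterior algebra of `ℝⁿ`: wedge with forms of degree `0` and `1` -/

/-- The real number represented by an alternating `0`-form. -/
def scalar {n : ℕ} (f : Alt n 0) : ℝ := f ![]

/-- The wedge product `α ∧ w` of a `1`-form and a `k`-form,
`(α ∧ w)(v₀, …, v_k) = ∑ i, (-1)^i α(v_i) w(v₀, …, v̂_i, …, v_k)`. -/
def wedge {n k : ℕ} (α : Alt n 1) (w : Alt n k) : Alt n (k + 1) :=
  ContinuousAlternatingMap.alternatizeUncurryFin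
    (((ContinuousAlternatingMap.ofSubsingleton ℝ (Vec n) ℝ (0 : Fin 1)).symm α).smulRight w)

/-- The `i`-th vector of the standard basis of `ℝⁿ`. -/
def stdVec {n : ℕ} (i : Fin n) : Vec n := EuclideanSpace.single i 1

/-- The `i`-th element of the dual basis, as a `1`-form. -/
def stdCov {n : ℕ} (i : Fin n) : Alt n 1 :=
  ContinuousAlternatingMap.ofSubsingleton ℝ (Vec n) ℝ (0 : Fin 1) (EuclideanSpace.proj i)

/-! ### The Lie algebra `𝔡𝔦𝔣𝔣(M)` -/

section Diff

variable (n : ℕ) (M : Type*) [TopologicalSpace M] [ChartedSpace (Vec n) M]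
  [IsManifold (𝓡 n) ∞ M]

/-- The Lie algebra of `Diff(M)`: its elements are the smooth vector fields on `M`. -/
def DiffAlg : Type _ := Cₛ^∞⟮𝓡 n; Vec n, (TangentSpace (𝓡 n) : M → Type _)⟯

instance : AddCommGroup (DiffAlg n M) :=
  inferInstanceAs (AddCommGroup Cₛ^∞⟮𝓡 n; Vec n, (TangentSpace (𝓡 n) : M → Type _)⟯)

instance : Module ℝ (DiffAlg n M) :=
  inferInstanceAs (Module ℝ Cₛ^∞⟮𝓡 n; Vec n, (TangentSpace (𝓡 n) : M → Type _)⟯)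

variable {n M}

/-- The underlying vector field of an element of `𝔡𝔦𝔣𝔣(M)`. -/
def DiffAlg.field (X : DiffAlg n M) : ∀ x : M, TangentSpace (𝓡 n) x :=
  ContMDiffSection.toFun X

theorem isManifold_of_le_nat (j : ℕ) : IsManifold (𝓡 n) (minSmoothness ℝ (j : WithTop ℕ∞)) M :=
  IsManifold.of_le (n := ∞) (by
    rw [minSmoothness_of_isRCLikeNormedField]
    exact_mod_cast le_top)

instance : IsManifold (𝓡 n) (minSmoothness ℝ 2) M := isManifold_of_le_nat 2

instance : IsManifold (𝓡 n) (minSmoothness ℝ 3) M := isManifold_of_le_nat 3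

theorem DiffAlg.ext' {X Y : DiffAlg n M} (h : X.field = Y.field) : X = Y :=
  ContMDiffSection.coe_injective h

theorem DiffAlg.smooth (X : DiffAlg n M) :
    ContMDiff (𝓡 n) ((𝓡 n).prod 𝓘(ℝ, Vec n)) ∞
      (fun x => (⟨x, X.field x⟩ : TangentBundle (𝓡 n) M)) :=
  ContMDiffSection.contMDiff_toFun X

theorem DiffAlg.mdiff (X : DiffAlg n M) (x : M) :
    MDifferentiableAt (𝓡 n) ((𝓡 n).prod 𝓘(ℝ, Vec n))
      (fun x => (⟨x, X.field x⟩ : TangentBundle (𝓡 n) M)) x :=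
  (X.smooth x).mdifferentiableAt (by simp)

theorem DiffAlg.add_field (X Y : DiffAlg n M) : (X + Y).field = X.field + Y.field := rfl

theorem DiffAlg.smul_field (r : ℝ) (X : DiffAlg n M) : (r • X).field = r • X.field := rfl

theorem DiffAlg.neg_field (X : DiffAlg n M) : (-X).field = -X.field := rfl

theorem DiffAlg.zero_field : (0 : DiffAlg n M).field = 0 := rfl

/-- The Lie bracket of `𝔡𝔦𝔣𝔣(M)` is *minus* the bracket of vector fields. -/
instance : Bracket (DiffAlg n M) (DiffAlg n M) where
  bracket X Y := -(⟨VectorField.mlieBracket (𝓡 n) X.field Y.field, by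
    have : IsManifold (𝓡 n) (((⊤ : ℕ∞) : WithTop ℕ∞) + 1) M := by
      simpa using (inferInstance : IsManifold (𝓡 n) ∞ M)
    exact ContDiff.mlieBracket_vectorField (m := ⊤) (n := ⊤) X.smooth Y.smooth (by simp)⟩ :
      Cₛ^∞⟮𝓡 n; Vec n, (TangentSpace (𝓡 n) : M → Type _)⟯)

theorem DiffAlg.bracket_field (X Y : DiffAlg n M) :
    ⁅X, Y⁆.field = -VectorField.mlieBracket (𝓡 n) X.field Y.field := rfl

instance : LieRing (DiffAlg n M) where
  add_lie X Y Z := by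
    apply DiffAlg.ext'
    funext x
    simp only [DiffAlg.add_field, DiffAlg.bracket_field, Pi.neg_apply, Pi.add_apply]
    rw [VectorField.mlieBracket_add_left (X.mdiff x) (Y.mdiff x)]
    abel
  lie_add X Y Z := by
    apply DiffAlg.ext'
    funext x
    simp only [DiffAlg.add_field, DiffAlg.bracket_field, Pi.neg_apply, Pi.add_apply]
    rw [VectorField.mlieBracket_add_right (Y.mdiff x) (Z.mdiff x)]
    abel
  lie_self X := by
    apply DiffAlg.ext'
    simp [DiffAlg.bracket_field, DiffAlg.zero_field]
  leibniz_lie X Y Z := by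
    have hs : ∀ W : DiffAlg n M, ContMDiff (𝓡 n) ((𝓡 n).prod 𝓘(ℝ, Vec n)) (minSmoothness ℝ 2)
        (fun x => (⟨x, W.field x⟩ : TangentBundle (𝓡 n) M)) := fun W =>
      W.smooth.of_le (by
        rw [minSmoothness_of_isRCLikeNormedField]
        exact WithTop.coe_le_coe.2 (le_top : (2 : ℕ∞) ≤ ⊤))
    have hn : ∀ (U V : DiffAlg n M), VectorField.mlieBracket (𝓡 n) (-U.field) V.field =
        -VectorField.mlieBracket (𝓡 n) U.field V.field := by
      intro U V
      funext x
      have := VectorField.mlieBracket_const_smul_left (I := 𝓡 n) (c := (-1 : ℝ))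
        (V := U.field) (W := V.field) (U.mdiff x)
      simpa using this
    have hb : ∀ (U V W : DiffAlg n M), ⁅⁅U, V⁆, W⁆.field =
        VectorField.mlieBracket (𝓡 n) (VectorField.mlieBracket (𝓡 n) U.field V.field)
          W.field := by
      intro U V W
      rw [DiffAlg.bracket_field ⁅U, V⁆ W, DiffAlg.bracket_field U V]
      have h := hn ⁅U, V⁆ W
      rw [DiffAlg.bracket_field U V, neg_neg] at h
      rw [← h]
    have hb' : ∀ (U V W : DiffAlg n M), ⁅W, ⁅U, V⁆⁆.field =
        VectorField.mlieBracket (𝓡 n) W.field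
          (VectorField.mlieBracket (𝓡 n) U.field V.field) := by
      intro U V W
      have : ⁅W, ⁅U, V⁆⁆.field = -⁅⁅U, V⁆, W⁆.field := by
        rw [DiffAlg.bracket_field, DiffAlg.bracket_field ⁅U, V⁆ W, VectorField.mlieBracket_swap]
      rw [this, hb, VectorField.mlieBracket_swap, neg_neg]
    apply DiffAlg.ext'
    rw [DiffAlg.add_field, hb, hb', hb']
    exact VectorField.leibniz_identity_mlieBracket (hs X) (hs Y) (hs Z)

instance : LieAlgebra ℝ (DiffAlg n M) where
  lie_smul r X Y := by
    apply DiffAlg.ext'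
    funext x
    simp only [DiffAlg.smul_field, DiffAlg.bracket_field, Pi.neg_apply, Pi.smul_apply]
    rw [VectorField.mlieBracket_const_smul_right (Y.mdiff x), smul_neg]

end Diff

/-! ### Smooth cubical chains, their boundary, and integration of forms -/

section Chains

variable (n k : ℕ) (M : Type*) [TopologicalSpace M] [ChartedSpace (Vec n) M]

/-- A smooth singular `k`-cube in `M` (only its restriction to `[0,1]^k` matters). -/
structure Cube where
  /-- the parametrisation -/
  map : (Fin k → ℝ) → M
  smooth : ContMDiff 𝓘(ℝ, Fin k → ℝ) (𝓡 n) ∞ map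

/-- Smooth cubical `k`-chains. -/
abbrev Chain : Type _ := Cube n k M →₀ ℤ

variable {n k M}

theorem contDiff_insertNth (i : Fin (k + 1)) (c : ℝ) :
    ContDiff ℝ ∞ (fun t : Fin k → ℝ => (i.insertNth c t : Fin (k + 1) → ℝ)) := by
  rw [contDiff_pi]
  intro j
  rcases Fin.eq_self_or_eq_succAbove i j with h | ⟨l, h⟩
  · subst h
    simpa using contDiff_const
  · subst h
    simpa using contDiff_apply ℝ ℝ l

/-- The face of a cube on which the `i`-th coordinate is equal to `c`. -/
def Cube.face (σ : Cube n (k + 1) M) (i : Fin (k + 1)) (c : ℝ) : Cube n k M where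
  map t := σ.map (i.insertNth c t : Fin (k + 1) → ℝ)
  smooth := σ.smooth.comp (contDiff_insertNth i c).contMDiff

/-- The boundary of a cube, `∂σ = ∑ i, (-1)^i (σ|_{t_i = 1} - σ|_{t_i = 0})`, where `i` is counted
from `0`. -/
def Cube.boundary (σ : Cube n (k + 1) M) : Chain n k M :=
  ∑ i : Fin (k + 1), (-1 : ℤ) ^ (i : ℕ) •
    (Finsupp.single (σ.face i 1) 1 - Finsupp.single (σ.face i 0) 1)

/-- The boundary `∂Σ` of a chain. -/
def Chain.boundary (c : Chain n (k + 1) M) : Chain n k M :=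
  c.sum fun σ a => a • σ.boundary

/-- The integral of a `k`-form over a `k`-cube: the pullback is integrated over `[0,1]^k`. -/
def Cube.integral (σ : Cube n k M) (w : Form n M k) : ℝ :=
  ∫ t in Set.Icc (0 : Fin k → ℝ) 1, w (σ.map t)
    (fun j => (mfderiv 𝓘(ℝ, Fin k → ℝ) (𝓡 n) σ.map t : (Fin k → ℝ) →L[ℝ] Vec n) (Pi.single j 1))

/-- The support `|Σ|` of a chain: the union of the images of its cubes. -/
def Chain.carrier (c : Chain n k M) : Set M :=
  {x | ∃ σ ∈ c.support, ∃ t ∈ Set.Icc (0 : Fin k → ℝ) 1, σ.map t = x}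

/-- The integral of a `k`-form over a `k`-chain. -/
def Chain.integral (c : Chain n k M) (w : Form n M k) : ℝ :=
  c.sum fun σ a => (a : ℝ) * σ.integral w

end Chains

/-! ### Field space and first-order Lagrangians

The elementary fields of a gauge theory are connection `1`-forms and tensorial `0`-forms: in
components, a finite family `A = (A^a)` of real `1`-forms and a finite family `ϕ = (ϕ^b)` of real
`0`-forms on `M`.  From now on `dim M = m + 2`, so that forms of codimension one and two make
sense. -/

section Theory

variable (m : ℕ) (ι κ : Type*)

/-- Values at a point of `(A, ϕ, dA, dϕ)`. -/
abbrev Jet : Type _ :=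
  (ι → Alt (m + 2) 1) × (κ → Alt (m + 2) 0) × (ι → Alt (m + 2) 2) × (κ → Alt (m + 2) 1)

/-- Field configurations `φ = (A, ϕ)`, not necessarily smooth. -/
abbrev Fields (M : Type*) : Type _ := (ι → Form (m + 2) M 1) × (κ → Form (m + 2) M 0)

variable {m ι κ}

/-- Pullback of point values by a linear automorphism of the tangent space. -/
def Jet.pull (g : Vec (m + 2) ≃L[ℝ] Vec (m + 2)) (j : Jet m ι κ) : Jet m ι κ :=
  (fun a => (j.1 a).compContinuousLinearMap g, fun b => (j.2.1 b).compContinuousLinearMap g,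
    fun a => (j.2.2.1 a).compContinuousLinearMap g,
    fun b => (j.2.2.2 b).compContinuousLinearMap g)

variable (m ι κ) in
/-- A first-order `Diff(M)`-covariant Lagrangian: a smooth function `(A, ϕ, dA, dϕ) ↦ L` with values
in top forms, without any background structure, i.e. commuting with all linear changes of frame of
the tangent space.  It is defined on an open invariant set `dom` of field values (this allows for
non-degeneracy conditions, e.g. an invertible soldering form). -/
structure Lagrangian [Fintype ι] [Fintype κ] where
  /-- the admissible values of `(A, ϕ, dA, dϕ)` -/
  dom : Set (Jet m ι κ)
  /-- the functional expression of the Lagrangian -/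
  toFun : Jet m ι κ → Alt (m + 2) (m + 2)
  isOpen_dom : IsOpen dom
  smooth : ContDiffOn ℝ ∞ toFun dom
  pull_mem : ∀ (g : Vec (m + 2) ≃L[ℝ] Vec (m + 2)), ∀ j ∈ dom, j.pull g ∈ dom
  natural : ∀ (g : Vec (m + 2) ≃L[ℝ] Vec (m + 2)), ∀ j ∈ dom,
    toFun (j.pull g) = (toFun j).compContinuousLinearMap g

section Momenta

variable [Fintype ι] [Fintype κ] [DecidableEq ι] [DecidableEq κ] (L : Lagrangian m ι κ)

/-- `∂L/∂A^a`: the `(n-1)`-form `λ` with `δL = δA^a ∧ λ` for variations of the value of `A^a`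
only. -/
def Lagrangian.lamA (a : ι) (j : Jet m ι κ) : Alt (m + 2) (m + 1) :=
  ∑ i, (fderiv ℝ L.toFun j (Pi.single a (stdCov i), 0, 0, 0)).curryLeft (stdVec i)

/-- `∂L/∂ϕ^b`: the `n`-form `λ` with `δL = δϕ^b λ` for variations of the value of `ϕ^b` only. -/
def Lagrangian.lamP (b : κ) (j : Jet m ι κ) : Alt (m + 2) (m + 2) :=
  fderiv ℝ L.toFun j (0,
    Pi.single b (ContinuousAlternatingMap.constOfIsEmpty ℝ (Vec (m + 2)) (Fin 0) (1 : ℝ)), 0, 0)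

/-- `∂L/∂(dA^a)`: the `(n-2)`-form `π` with `δL = δ(dA^a) ∧ π` for variations of the value of `dA^a`
only. -/
def Lagrangian.piA (a : ι) (j : Jet m ι κ) : Alt (m + 2) m :=
  (2⁻¹ : ℝ) • ∑ i, ∑ l,
    ((fderiv ℝ L.toFun j (0, 0, Pi.single a (wedge (stdCov i) (stdCov l)), 0)).curryLeft
      (stdVec i)).curryLeft (stdVec l)

/-- `∂L/∂(dϕ^b)`: the `(n-1)`-form `π` with `δL = δ(dϕ^b) ∧ π` for variations of the value of `dϕ^b`
only. -/
def Lagrangian.piP (b : κ) (j : Jet m ι κ) : Alt (m + 2) (m + 1) :=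
  ∑ i, (fderiv ℝ L.toFun j (0, 0, 0, Pi.single b (stdCov i))).curryLeft (stdVec i)

end Momenta

variable {M : Type*} [TopologicalSpace M] [ChartedSpace (Vec (m + 2)) M]

/-- The value of `(A, ϕ, dA, dϕ)` at `x`. -/
def jet (φ : Fields m ι κ M) (x : M) : Jet m ι κ :=
  (fun a => φ.1 a x, fun b => φ.2 b x, fun a => extD (φ.1 a) x, fun b => extD (φ.2 b) x)

/-- All components of the field configuration are smooth. -/
def SmoothFields (φ : Fields m ι κ M) : Prop := (∀ a, IsSmooth (φ.1 a)) ∧ ∀ b, IsSmooth (φ.2 b)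

/-- `φ ↦ 𝔏_X φ`: the fundamental vertical vector field `X^v` on field space. -/
def vert (X : ∀ x : M, TangentSpace (𝓡 (m + 2)) x) (φ : Fields m ι κ M) : Fields m ι κ M :=
  (fun a => lieD X (φ.1 a), fun b => lieD X (φ.2 b))

/-- `ι_X φ`, i.e. the functions `ι_X A^a` (and `ι_X ϕ = 0`). -/
def innerField (X : ∀ x : M, TangentSpace (𝓡 (m + 2)) x) (φ : Fields m ι κ M) :
    ι → Form (m + 2) M 0 := fun a => iprod X (φ.1 a)

/-! ### Calculus on field space

Field space is an open piece of a vector space of sections, so that its tangent vectors are again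
(smooth) elements `δφ` of `Fields`; form-valued objects are differentiated pointwise on `M`. -/

/-- The derivative `𝐝F|_φ(δφ)` of a form-valued functional `F`. -/
def dFormFun {k : ℕ} (F : Fields m ι κ M → Form (m + 2) M k) (φ δφ : Fields m ι κ M) :
    Form (m + 2) M k := fun x => deriv (fun t : ℝ => F (φ + t • δφ) x) 0

/-- The derivative `𝐝F|_φ(δφ)` of a real-valued functional `F`. -/
def dFun (F : Fields m ι κ M → ℝ) (φ δφ : Fields m ι κ M) : ℝ :=
  deriv (fun t : ℝ => F (φ + t • δφ)) 0

/-- The exterior derivative on field space of a `1`-form `α = α(δφ; φ)` on field space with values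
in forms on `M`: `(𝐝α)|_φ(δ₁φ, δ₂φ) = δ₁(α(δ₂φ)) - δ₂(α(δ₁φ))` for constant `δ₁φ`, `δ₂φ`. -/
def dOneForm {k : ℕ} (α : Fields m ι κ M → Fields m ι κ M → Form (m + 2) M k)
    (φ δ₁ δ₂ : Fields m ι κ M) : Form (m + 2) M k :=
  dFormFun (fun ψ => α ψ δ₂) φ δ₁ - dFormFun (fun ψ => α ψ δ₁) φ δ₂

/-- Joint smoothness, near `(s, p)`, of a family of forms depending on parameters in `P`. -/
def SmoothFamilyAt {n k : ℕ} {N : Type*} [TopologicalSpace N] [ChartedSpace (Vec n) N]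
    {P : Type*} [NormedAddCommGroup P] [NormedSpace ℝ P] (u : P → Form n N k) (s : P) (p : N) :
    Prop :=
  ContDiffAt ℝ ∞ (fun z : P × Vec n => chartRep (u z.1) p z.2) (s, extChartAt (𝓡 n) p p)

/-- Smoothly parametrised families of field configurations. -/
def SmoothFamily {P : Type*} [NormedAddCommGroup P] [NormedSpace ℝ P] (u : P → Fields m ι κ M) :
    Prop :=
  (∀ a s p, SmoothFamilyAt (fun r => (u r).1 a) s p) ∧
    ∀ b s p, SmoothFamilyAt (fun r => (u r).2 b) s p

/-- `δφ` is tangent at `φ` to the set `P` of field configurations, near the set `K ⊆ M`: there is a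
smooth curve in `P` through `φ` whose velocity is equal to `δφ` on a neighbourhood of `K`. -/
def IsTangent (K : Set M) (P : Set (Fields m ι κ M)) (φ δφ : Fields m ι κ M) : Prop :=
  ∃ (U : Set M) (c : ℝ → Fields m ι κ M), IsOpen U ∧ K ⊆ U ∧ SmoothFamily c ∧ (∀ t, c t ∈ P) ∧
    c 0 = φ ∧ ∀ x ∈ U, (∀ a, HasDerivAt (fun t => (c t).1 a x) (δφ.1 a x) 0) ∧
      ∀ b, HasDerivAt (fun t => (c t).2 b x) (δφ.2 b x) 0

/-- The algebra `C^∞(S)` of smooth real functions on a set `S` of field configurations: those that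
are smooth along all smooth finite-dimensional families in `S`. -/
def smoothFunctions (S : Set (Fields m ι κ M)) : Subalgebra ℝ (S → ℝ) where
  carrier := {f | ∀ (q : ℕ) (u : (Fin q → ℝ) → Fields m ι κ M) (h : ∀ s, u s ∈ S),
    SmoothFamily u → ContDiff ℝ ∞ (fun s => f ⟨u s, h s⟩)}
  mul_mem' hf hg q u h hu := (hf q u h hu).mul (hg q u h hu)
  add_mem' hf hg q u h hu := (hf q u h hu).add (hg q u h hu)
  algebraMap_mem' _ _ _ _ _ := contDiff_const

/-- `C^∞(S)` is regarded as an abelian Lie algebra. -/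
instance (S : Set (Fields m ι κ M)) : LieRing (smoothFunctions S) where
  bracket _ _ := 0
  add_lie _ _ _ := (add_zero 0).symm
  lie_add _ _ _ := (add_zero 0).symm
  lie_self _ := rfl
  leibniz_lie _ _ _ := (add_zero 0).symm

instance (S : Set (Fields m ι κ M)) : LieAlgebra ℝ (smoothFunctions S) where
  lie_smul r _ _ := (smul_zero r).symm

/-! ### The covariant phase space of a Lagrangian -/

variable [Fintype ι] [Fintype κ]

/-- Field space `Φ`: smooth configurations with admissible values. -/
def Lagrangian.fieldSpace (L : Lagrangian m ι κ) (M : Type*) [TopologicalSpace M]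
    [ChartedSpace (Vec (m + 2)) M] : Set (Fields m ι κ M) :=
  {φ | SmoothFields φ ∧ ∀ x, jet φ x ∈ L.dom}

/-- The Lagrangian `n`-form `L(φ)` on `M`. -/
def Lagrangian.form (L : Lagrangian m ι κ) (φ : Fields m ι κ M) : Form (m + 2) M (m + 2) :=
  fun x => L.toFun (jet φ x)

/-- Smooth local functionals `F(φ)` with values in forms on `M`: the value `F(φ)(x)` depends only on
the germ of `φ` at `x`, and smooth families of fields are mapped to smooth families of forms,
wherever the fields are admissible. -/
def Lagrangian.IsLocalFunctional (L : Lagrangian m ι κ) {k : ℕ}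
    (F : Fields m ι κ M → Form (m + 2) M k) : Prop :=
  (∀ (x : M) (φ ψ : Fields m ι κ M),
    (∀ᶠ y in nhds x, (∀ a, φ.1 a y = ψ.1 a y) ∧ ∀ b, φ.2 b y = ψ.2 b y) → F φ x = F ψ x) ∧
  ∀ (q : ℕ) (u : (Fin q → ℝ) → Fields m ι κ M), SmoothFamily u →
    ∀ (s : Fin q → ℝ) (p : M), jet (u s) p ∈ L.dom → SmoothFamilyAt (fun r => F (u r)) s p

variable [DecidableEq ι] [DecidableEq κ] (L : Lagrangian m ι κ)

/-- The presymplectic potential current `θ(δφ; φ) = δA^a ∧ ∂L/∂(dA^a) + δϕ^b ∂L/∂(dϕ^b)`. -/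
def Lagrangian.theta (φ δφ : Fields m ι κ M) : Form (m + 2) M (m + 1) := fun x =>
  ∑ a, wedge (δφ.1 a x) (L.piA a (jet φ x)) + ∑ b, scalar (δφ.2 b x) • L.piP b (jet φ x)

/-- The functional expression `θ(χ; φ) = χ^a ∂L/∂(dA^a)` evaluated on functions `χ^a` in place of the
`1`-forms `δA^a` (and `0` in place of `δϕ`), as needed for `θ(ι_X φ; φ)`. -/
def Lagrangian.thetaLow (φ : Fields m ι κ M) (χ : ι → Form (m + 2) M 0) : Form (m + 2) M m :=
  fun x => ∑ a, scalar (χ a x) • L.piA a (jet φ x)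

/-- Euler–Lagrange form of `A^a`: `∂L/∂A^a + d(∂L/∂(dA^a))`. -/
def Lagrangian.eulerA (φ : Fields m ι κ M) (a : ι) : Form (m + 2) M (m + 1) :=
  (fun x => L.lamA a (jet φ x)) + extD (fun x => L.piA a (jet φ x))

/-- Euler–Lagrange form of `ϕ^b`: `∂L/∂ϕ^b - d(∂L/∂(dϕ^b))`. -/
def Lagrangian.eulerP (φ : Fields m ι κ M) (b : κ) : Form (m + 2) M (m + 2) :=
  (fun x => L.lamP b (jet φ x)) - extD (fun x => L.piP b (jet φ x))

/-- The field equations `1`-form `E(δφ; φ)`. -/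
def Lagrangian.euler (φ δφ : Fields m ι κ M) : Form (m + 2) M (m + 2) := fun x =>
  ∑ a, wedge (δφ.1 a x) (L.eulerA φ a x) + ∑ b, scalar (δφ.2 b x) • L.eulerP φ b x

/-- The functional expression `E(χ; φ)` evaluated on functions `χ^a` in place of the `1`-forms `δA^a`
(and `0` in place of `δϕ`), as needed for `E(ι_X φ; φ)`. -/
def Lagrangian.eulerLow (φ : Fields m ι κ M) (χ : ι → Form (m + 2) M 0) :
    Form (m + 2) M (m + 1) :=
  fun x => ∑ a, scalar (χ a x) • L.eulerA φ a x

/-- The space of solutions (`E|_φ = 0`). -/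
def Lagrangian.solutions (M : Type*) [TopologicalSpace M] [ChartedSpace (Vec (m + 2)) M] :
    Set (Fields m ι κ M) :=
  {φ | φ ∈ L.fieldSpace M ∧ ∀ δφ, L.euler φ δφ = 0}

/-- The presymplectic `2`-form current `Θ = 𝐝θ`. -/
def Lagrangian.presymp (φ δ₁ δ₂ : Fields m ι κ M) : Form (m + 2) M (m + 1) :=
  dOneForm L.theta φ δ₁ δ₂

variable [IsManifold (𝓡 (m + 2)) ∞ M]

/-- The Noether current `J(X; φ) = ι_{X^v} θ - ι_X L - dγ(X; φ)`. -/
def Lagrangian.current (γ : DiffAlg (m + 2) M →ₗ[ℝ] (Fields m ι κ M → Form (m + 2) M m))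
    (X : DiffAlg (m + 2) M) (φ : Fields m ι κ M) : Form (m + 2) M (m + 1) :=
  L.theta φ (vert X.field φ) - iprod X.field (L.form φ) - extD (γ X φ)

/-- The Noether charge `Q_Σ(X; φ) = ∫_Σ J(X; φ)`. -/
def Lagrangian.charge (γ : DiffAlg (m + 2) M →ₗ[ℝ] (Fields m ι κ M → Form (m + 2) M m))
    (S : Chain (m + 2) (m + 1) M) (X : DiffAlg (m + 2) M) (φ : Fields m ι κ M) : ℝ :=
  S.integral (L.current γ X φ)

/-- The presymplectic `2`-form `Θ_Σ = ∫_Σ Θ`. -/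
def Lagrangian.presympInt (S : Chain (m + 2) (m + 1) M) (φ δ₁ δ₂ : Fields m ι κ M) : ℝ :=
  S.integral (L.presymp φ δ₁ δ₂)

/-- The bracket of charges `{Q_Σ(X; φ), Q_Σ(Y; φ)} := Θ_Σ(X^v, Y^v)`. -/
def Lagrangian.chargeBracket (S : Chain (m + 2) (m + 1) M) (X Y : DiffAlg (m + 2) M)
    (φ : Fields m ι κ M) : ℝ :=
  L.presympInt S φ (vert X.field φ) (vert Y.field φ)

/-- The `(n-2)`-form
`𝔏_X θ(ι_Y φ; φ) - 𝔏_Y θ(ι_X φ; φ) + ι_X ι_Y L + γ([X, Y]_𝔡𝔦𝔣𝔣; φ) + ι_Y E(ι_X φ; φ) - ι_X E(ι_Y φ; φ)`. -/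
def Lagrangian.cocycleForm (γ : DiffAlg (m + 2) M →ₗ[ℝ] (Fields m ι κ M → Form (m + 2) M m))
    (X Y : DiffAlg (m + 2) M) (φ : Fields m ι κ M) : Form (m + 2) M m :=
  lieD X.field (L.thetaLow φ (innerField Y.field φ))
    - lieD Y.field (L.thetaLow φ (innerField X.field φ))
    + iprod X.field (iprod Y.field (L.form φ)) + γ ⁅X, Y⁆ φ
    + iprod Y.field (L.eulerLow φ (innerField X.field φ))
    - iprod X.field (L.eulerLow φ (innerField Y.field φ))

/-- The boundary term `𝒞(X, Y; φ)`, the integral of `cocycleForm` over `∂Σ`. -/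
def Lagrangian.cocycle (γ : DiffAlg (m + 2) M →ₗ[ℝ] (Fields m ι κ M → Form (m + 2) M m))
    (S : Chain (m + 2) (m + 1) M) (X Y : DiffAlg (m + 2) M) (φ : Fields m ι κ M) : ℝ :=
  S.boundary.integral (L.cocycleForm γ X Y φ)

/-- `(𝐝 ι_{X^v} Θ)(Y^v, Z^v)` at `φ`. -/
def Lagrangian.dInnerPresymp (X Y Z : DiffAlg (m + 2) M) (φ : Fields m ι κ M) :
    Form (m + 2) M (m + 1) :=
  dOneForm (fun ψ δφ => L.presymp ψ (vert X.field ψ) δφ) φ (vert Y.field φ) (vert Z.field φ)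

/-- `P` is a space of solutions (typically cut out by boundary conditions) to which all the
fundamental vector fields `X^v` are tangent near `Σ`. -/
def Lagrangian.IsPhaseSpace (S : Chain (m + 2) (m + 1) M) (P : Set (Fields m ι κ M)) : Prop :=
  P ⊆ L.solutions M ∧
    ∀ φ ∈ P, ∀ X : DiffAlg (m + 2) M, IsTangent S.carrier P φ (vert X.field φ)

/-- The charges are moment maps on `P`: `ι_{X^v} Θ_Σ = -𝐝 Q_Σ(X)` on all vectors tangent to `P`. -/
def Lagrangian.IsMomentMap (γ : DiffAlg (m + 2) M →ₗ[ℝ] (Fields m ι κ M → Form (m + 2) M m))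
    (S : Chain (m + 2) (m + 1) M) (P : Set (Fields m ι κ M)) : Prop :=
  ∀ φ ∈ P, ∀ (X : DiffAlg (m + 2) M) (δφ : Fields m ι κ M), IsTangent S.carrier P φ δφ →
    L.presympInt S φ (vert X.field φ) δφ = -dFun (L.charge γ S X) φ δφ

/-- The fundamental vector fields are symplectic on `P`: `𝐋_{X^v} Θ_Σ = 𝐝 ι_{X^v} Θ_Σ = 0` on all
vectors tangent to `P`. -/
def Lagrangian.IsSymplecticAction (S : Chain (m + 2) (m + 1) M) (P : Set (Fields m ι κ M)) : Prop :=
  ∀ φ ∈ P, ∀ (X : DiffAlg (m + 2) M) (δ₁ δ₂ : Fields m ι κ M),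
    IsTangent S.carrier P φ δ₁ → IsTangent S.carrier P φ δ₂ →
      S.integral (dOneForm (fun ψ δφ => L.presymp ψ (vert X.field ψ) δφ) φ δ₁ δ₂) = 0

end Theory

end CovPhase

end

open CovPhase

universe u v w

/-! Everything follows from covariance, used in two infinitesimal forms. The momenta are
characterised by wedge identities (`wedge_lamA`, `wedge_piP`, `wedge_wedge_piA`), and a form of
degree below `n` is determined by its wedge products with `1`-forms (`eq_zero_of_wedge_eq_zero`). So
the momenta inherit from `L` the compatibility with changes of frame; they are natural functions of
the jet. For a natural `F`, the Lie derivative `𝔏_X` of `F(φ)` on `M` equals the derivative of `F`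
on field space along `X^v` (`IsNatural.lieD_apply`). For `L` itself, the infinitesimal change of
frame by a rank-one endomorphism `β ⊗ v` expresses `ι_v L` through the momenta (`curryLeft_toFun`).
Inserting `𝔏_X A = ι_X dA + d ι_X A` gives Noether's identity `θ(X^v) = dθ(ι_X φ) + ι_X L - E(ι_X
φ)` (`theta_vert`).

For the bracket, covariance of `θ` gives `Θ(X^v, Y^v) = 𝔏_X θ(Y^v) - 𝔏_Y θ(X^v) + θ([X, Y]^v)`.
Noether's identity is substituted in the first two terms. By Cartan calculus everything apart from
`J([X, Y])` and the contracted field equations is exact (`presymp_vert_vert_eq`); Stokes' theorem on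
cubical chains moves it to `∂Σ`. The flux formula is the same computation with one general variation
in place of `Y^v`; on shell `𝐝L = dθ` cancels the bulk term.

For the Jacobiator, `Θ = 𝐝θ` is closed. At each point of `M` this is the symmetry of a second
derivative of a `1`-form on the finite-dimensional space of jets (`ddForm_cyclic`). Closedness turns
the cyclic sum of `(𝐝 ι_{X^v} Θ)(Y^v, Z^v)` into that of `Θ(X^v, [Y, Z]^v)`. By the on-shell
bracket, the latter is the cyclic sum of `𝒞(X, [Y, Z])` plus charges of a sum that vanishes by the
Jacobi identity.

On a phase space `P` with symplectic action, the Jacobiator vanishes at once. If the charges are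
moment maps, `Θ_Σ(X^v, W^v) = -𝐝Q_X(W^v)` holds only on `P`, whereas field-space derivatives are
taken along straight lines, which leave `P`. The bridge is a chain rule along curves in `P`
(`SmoothLocal.hasDerivAt_curve`): by Hadamard's lemma a smooth curve is `c 0 + t • fieldSlope c t`
with a smooth slope. Differentiating the moment map identity then identifies `(𝐝 ι_{X^v} Θ_Σ)(Y^v,
Z^v)` with `-𝐝²Q_X(Y^v, Z^v) = 0` (`integral_dInnerPresymp_eq_zero`). Hence `𝒞` is a `2`-cocycle
with values in the trivial module `C^∞(P)`, and it defines the usual extension on `C^∞(P) ×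
𝔡𝔦𝔣𝔣(M)`. -/

noncomputable section

open scoped Manifold ContDiff Topology
open Filter Set

set_option linter.unusedSectionVars false
set_option maxSynthPendingDepth 3

namespace CovPhase

/-! ### Exterior algebra of `ℝⁿ` -/

section Exterior

open ContinuousAlternatingMap (alternatizeUncurryFin alternatizeUncurryFinCLM
  alternatizeUncurryFin_apply alternatizeUncurryFinCLM_apply curryLeft_apply_apply curryLeftLI
  curryLeft_same curryLeft_add alternatizeUncurryFin_curryLeft alternatizeUncurryFin_add
  alternatizeUncurryFin_alternatizeUncurryFinCLM_comp_of_symmetric constOfIsEmpty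
  compContinuousLinearMap_apply)

variable {n k : ℕ}

/-- A `1`-form as a linear functional. -/
def covL : Alt n 1 →L[ℝ] Vec n →L[ℝ] ℝ :=
  ((ContinuousAlternatingMap.ofSubsingletonLIE (𝕜 := ℝ) (E := Vec n) (F := ℝ)
    (0 : Fin 1)).symm :
    Alt n 1 →L[ℝ] Vec n →L[ℝ] ℝ)

theorem covL_apply (α : Alt n 1) (v : Vec n) : covL α v = α ![v] := by
  simp [covL]
  congr 1
  ext i; fin_cases i; rfl

theorem wedge_eq (α : Alt n 1) (w : Alt n k) :
    wedge α w = alternatizeUncurryFin ((covL α).smulRight w) := rfl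

/-- The wedge product with a `1`-form as a continuous bilinear map. -/
def wedgeL : Alt n 1 →L[ℝ] Alt n k →L[ℝ] Alt n (k + 1) :=
  (ContinuousLinearMap.compL ℝ (Alt n k) (Vec n →L[ℝ] Alt n k) (Alt n (k + 1))
    (alternatizeUncurryFinCLM ℝ (Vec n) ℝ)) ∘L
    (ContinuousLinearMap.smulRightL ℝ (Vec n) (Alt n k)) ∘L covL

@[simp] theorem wedgeL_apply (α : Alt n 1) (w : Alt n k) : wedgeL α w = wedge α w := rfl

@[simp] theorem zero_wedge (w : Alt n k) : wedge (0 : Alt n 1) w = 0 := by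
  rw [← wedgeL_apply, map_zero]; rfl

theorem wedge_add (α : Alt n 1) (w w' : Alt n k) :
    wedge α (w + w') = wedge α w + wedge α w' := by
  simp only [← wedgeL_apply, map_add]

theorem wedge_sub (α : Alt n 1) (w w' : Alt n k) :
    wedge α (w - w') = wedge α w - wedge α w' := by
  simp only [← wedgeL_apply, map_sub]

theorem wedge_smul (α : Alt n 1) (r : ℝ) (w : Alt n k) :
    wedge α (r • w) = r • wedge α w := by
  simp only [← wedgeL_apply, map_smul]

theorem wedge_sum {s : Type*} (t : Finset s) (α : Alt n 1) (w : s → Alt n k) :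
    wedge α (∑ i ∈ t, w i) = ∑ i ∈ t, wedge α (w i) := by
  simp only [← wedgeL_apply, map_sum]

theorem add_wedge (α β : Alt n 1) (w : Alt n k) :
    wedge (α + β) w = wedge α w + wedge β w := by
  simp only [← wedgeL_apply, map_add, add_apply]

theorem smul_wedge (r : ℝ) (α : Alt n 1) (w : Alt n k) :
    wedge (r • α) w = r • wedge α w := by
  simp only [← wedgeL_apply, map_smul, smul_apply]

theorem sum_wedge {s : Type*} (t : Finset s) (α : s → Alt n 1) (w : Alt n k) :
    wedge (∑ i ∈ t, α i) w = ∑ i ∈ t, wedge (α i) w := by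
  simp only [← wedgeL_apply, map_sum, sum_apply]

/-- Interior product with `v` as a continuous linear map. -/
def innerL (v : Vec n) : Alt n (k + 1) →L[ℝ] Alt n k :=
  (ContinuousLinearMap.apply ℝ (Alt n k) v) ∘L
    (curryLeftLI (𝕜 := ℝ) (E := Vec n) (F := ℝ) (n := k)).toContinuousLinearMap

@[simp] theorem innerL_apply (v : Vec n) (w : Alt n (k + 1)) : innerL v w = w.curryLeft v := rfl

/-- Polarisation: contracting twice with `u + v` gives zero. -/
theorem curryLeft_swap (w : Alt n (k + 2)) (u v : Vec n) :
    (w.curryLeft u).curryLeft v = -(w.curryLeft v).curryLeft u := by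
  have h := curryLeft_same w (u + v)
  simp only [map_add, curryLeft_add, add_apply, curryLeft_same,
    zero_add, add_zero] at h
  rw [eq_neg_iff_add_eq_zero, add_comm]
  exact h

/-- The summand of the alternation with index `0` puts `v` into `f`; in all others `v` stays in the
first slot of the form and the sign shifts by one. This is the common source of the antiderivation
rule for `wedge` and of Cartan's formula. -/
theorem curryLeft_alternatizeUncurryFin (f : Vec n →L[ℝ] Alt n (k + 1)) (v : Vec n) :
    (alternatizeUncurryFin f).curryLeft v = f v - alternatizeUncurryFin (innerL v ∘L f) := by
  ext w
  rw [curryLeft_apply_apply, alternatizeUncurryFin_apply, Fin.sum_univ_succ]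
  change _ = f v w - alternatizeUncurryFin (innerL v ∘L f) w
  rw [alternatizeUncurryFin_apply, sub_eq_add_neg, ← Finset.sum_neg_distrib]
  congr 1
  · simp
  · refine Finset.sum_congr rfl fun i _ => ?_
    have : (i.succ.removeNth (Matrix.vecCons v w : Fin (k + 2) → Vec n) : Fin (k + 1) → Vec n) =
        Matrix.vecCons v (i.removeNth w) := by
      funext j
      refine Fin.cases ?_ (fun l => ?_) j <;> simp [Fin.removeNth]
    simp [this, pow_succ]

theorem curryLeft_alternatizeUncurryFin_zero (f : Vec n →L[ℝ] Alt n 0) (v : Vec n) :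
    (alternatizeUncurryFin f).curryLeft v = f v := by
  ext w
  rw [curryLeft_apply_apply, alternatizeUncurryFin_apply, Fin.sum_univ_succ]
  simp [Subsingleton.elim w ![]]

theorem curryLeft_wedge (α : Alt n 1) (w : Alt n (k + 1)) (v : Vec n) :
    (wedge α w).curryLeft v = covL α v • w - wedge α (w.curryLeft v) := by
  rw [wedge_eq, curryLeft_alternatizeUncurryFin]
  rfl

theorem curryLeft_wedge_zero (α : Alt n 1) (w : Alt n 0) (v : Vec n) :
    (wedge α w).curryLeft v = covL α v • w := by
  rw [wedge_eq, curryLeft_alternatizeUncurryFin_zero]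
  rfl

theorem scalar_curryLeft (α : Alt n 1) (v : Vec n) : scalar (α.curryLeft v) = covL α v := by
  rw [covL_apply]; rfl

theorem alt_eq_zero_of_lt (h : n < k) (w : Alt n k) : w = 0 := by
  ext v
  apply w.toAlternatingMap.map_linearDependent
  intro hv
  have := hv.fintype_card_le_finrank
  simp at this
  omega

/-- Contract `α ∧ w = 0`, a form of degree larger than the dimension. -/
theorem wedge_curryLeft_top (α : Alt n 1) {m : ℕ} (hm : n = m + 1) (w : Alt n (m + 1))
    (v : Vec n) : wedge α (w.curryLeft v) = covL α v • w := by
  have h : (wedge α w).curryLeft v = 0 := by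
    rw [alt_eq_zero_of_lt (by omega) (wedge α w)]; rfl
  rw [curryLeft_wedge] at h
  exact (sub_eq_zero.1 h).symm

theorem covL_stdCov (i : Fin n) (v : Vec n) : covL (stdCov i) v = v i := by
  simp [covL, stdCov]

theorem sum_coord (v : Vec n) : ∑ i, v i • (stdVec i : Vec n) = v := by
  ext j
  simp [stdVec, Finset.sum_apply, Pi.single_apply]

theorem sum_covL_smul_stdCov (α : Alt n 1) : ∑ i, covL α (stdVec i) • stdCov i = α := by
  have : Function.Injective (covL (n := n)) :=
    (ContinuousAlternatingMap.ofSubsingletonLIE (𝕜 := ℝ) (E := Vec n) (F := ℝ)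
    (0 : Fin 1)).symm.injective
  apply this
  ext v
  simp only [map_sum, map_smul, sum_apply, smul_apply,
    covL_stdCov, smul_eq_mul]
  conv_rhs => rw [← sum_coord v, map_sum]
  simp [mul_comm]

theorem alternatizeUncurryFin_eq_sum (f : Vec n →L[ℝ] Alt n k) :
    alternatizeUncurryFin f = ∑ i, wedge (stdCov i) (f (stdVec i)) := by
  have hf : f = ∑ i, (covL (stdCov i)).smulRight (f (stdVec i)) := by
    ext1 v
    conv_lhs => rw [← sum_coord v, map_sum]
    simp [covL_stdCov]
  conv_lhs => rw [hf]
  rw [← alternatizeUncurryFinCLM_apply, map_sum]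
  rfl

/-- Contracting `eⁱ ∧ w = 0` with `eᵢ` and summing over `i` leaves `(n - deg w) • w = 0`. This is
the device by which identities for the momenta are proved: they are tested after wedging with
`1`-forms. -/
theorem eq_zero_of_wedge_eq_zero (hk : k < n) (w : Alt n k)
    (h : ∀ α : Alt n 1, wedge α w = 0) : w = 0 := by
  have hi : ∀ i : Fin n, (wedge (stdCov i) w).curryLeft (stdVec i) = 0 := fun i => by
    rw [h]; rfl
  have hs : ∀ i : Fin n, covL (stdCov i) (stdVec i) = 1 := fun i => by
    rw [covL_stdCov]; simp [stdVec]
  cases k with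
  | zero =>
    have := hi ⟨0, hk⟩
    rwa [curryLeft_wedge_zero, hs, one_smul] at this
  | succ k =>
    have h1 : ∑ i : Fin n, (w - wedge (stdCov i) (w.curryLeft (stdVec i))) = 0 :=
      Finset.sum_eq_zero fun i _ => by
        have := hi i
        rwa [curryLeft_wedge, hs, one_smul] at this
    rw [Finset.sum_sub_distrib, ← alternatizeUncurryFin_eq_sum, alternatizeUncurryFin_curryLeft,
      Finset.sum_const, Finset.card_univ, Fintype.card_fin, sub_eq_zero] at h1
    -- The sum `∑ eⁱ ∧ ι_{eᵢ} w` counts the degree, here `k + 1`; the other term contributes `n`.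
    have h2 : ((n : ℝ) - ((k + 1 : ℕ) : ℝ)) • w = 0 := by
      have h3 := sub_smul (n : ℝ) ((k + 1 : ℕ) : ℝ) w
      rw [h3, Nat.cast_smul_eq_nsmul, Nat.cast_smul_eq_nsmul, h1, sub_self]
    rcases smul_eq_zero.1 h2 with h3 | h3
    · exfalso
      have : ((k + 1 : ℕ) : ℝ) < n := by exact_mod_cast hk
      linarith
    · exact h3

/-- Alternating twice kills the symmetric map `f + f.flip`. This produces the sign in the Leibniz
rule for `d(α ∧ π)`. -/
theorem alternatizeUncurryFin_comp_swap (f : Vec n →L[ℝ] Vec n →L[ℝ] Alt n k) :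
    alternatizeUncurryFin (alternatizeUncurryFinCLM ℝ (Vec n) ℝ ∘L f) =
      -alternatizeUncurryFin (alternatizeUncurryFinCLM ℝ (Vec n) ℝ ∘L f.flip) := by
  rw [eq_neg_iff_add_eq_zero, ← alternatizeUncurryFin_add, ← ContinuousLinearMap.comp_add]
  apply alternatizeUncurryFin_alternatizeUncurryFinCLM_comp_of_symmetric
  intro x y
  simp [add_comm]

theorem wedge_compContinuousLinearMap (α : Alt n 1) (w : Alt n k) (g : Vec n →L[ℝ] Vec n) :
    (wedge α w).compContinuousLinearMap g =
      wedge (α.compContinuousLinearMap g) (w.compContinuousLinearMap g) := by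
  ext v
  simp only [compContinuousLinearMap_apply, wedge_eq, alternatizeUncurryFin_apply,
    ContinuousLinearMap.smulRight_apply, covL_apply, ContinuousAlternatingMap.smul_apply]
  refine Finset.sum_congr rfl fun i _ => ?_
  have : (g ∘ ![v i] : Fin 1 → Vec n) = ![g (v i)] := by
    ext j; fin_cases j; rfl
  rw [this]
  rfl

theorem scalar_compContinuousLinearMap (f : Alt n 0) (g : Vec n →L[ℝ] Vec n) :
    scalar (f.compContinuousLinearMap g) = scalar f := by
  unfold scalar
  rw [compContinuousLinearMap_apply]
  congr 1
  exact Subsingleton.elim _ _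

/-- `scalar` as a continuous linear map. -/
def scalarL : Alt n 0 →L[ℝ] ℝ :=
  ContinuousAlternatingMap.apply ℝ (Vec n) ℝ ![]

@[simp] theorem scalarL_apply (f : Alt n 0) : scalarL f = scalar f := rfl

theorem eq_scalar_smul (f : Alt n 0) :
    f = scalar f • constOfIsEmpty ℝ (Vec n) (Fin 0) (1 : ℝ) := by
  ext v
  simp [scalar, Subsingleton.elim v ![]]

end Exterior

/-! ### Momenta of a Lagrangian -/

section MomentaLemmas

open ContinuousAlternatingMap (alternatizeUncurryFin constOfIsEmpty)

variable {m : ℕ} {ι κ : Type*}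

/-- Pullback of forms along `g` as a continuous linear map. -/
abbrev altPull {n k : ℕ} (g : Vec n →L[ℝ] Vec n) : Alt n k →L[ℝ] Alt n k :=
  ContinuousAlternatingMap.compContinuousLinearMapCLM g

/-- Pullback of jets along an endomorphism of the tangent space. -/
def Jet.pullL (g : Vec (m + 2) →L[ℝ] Vec (m + 2)) (j : Jet m ι κ) : Jet m ι κ :=
  (fun a => (j.1 a).compContinuousLinearMap g, fun b => (j.2.1 b).compContinuousLinearMap g,
    fun a => (j.2.2.1 a).compContinuousLinearMap g,
    fun b => (j.2.2.2 b).compContinuousLinearMap g)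

theorem Jet.pull_symm_pull (g : Vec (m + 2) ≃L[ℝ] Vec (m + 2)) (j : Jet m ι κ) :
    (j.pull g.symm).pull g = j := by
  refine Prod.ext ?_ (Prod.ext ?_ (Prod.ext ?_ ?_)) <;>
  · funext a
    ext v
    simp only [Jet.pull, ContinuousAlternatingMap.compContinuousLinearMap_apply]
    congr 1
    funext i
    simp

theorem Jet.pull_pull_symm (g : Vec (m + 2) ≃L[ℝ] Vec (m + 2)) (j : Jet m ι κ) :
    (j.pull g).pull g.symm = j := by
  simpa using Jet.pull_symm_pull g.symm j

variable [Fintype ι] [Fintype κ]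

/-- `Jet.pullL` as a continuous linear map of jets. -/
def Jet.pullCLM (g : Vec (m + 2) →L[ℝ] Vec (m + 2)) : Jet m ι κ →L[ℝ] Jet m ι κ :=
  (ContinuousLinearMap.piMap fun _ => altPull g).prodMap
    ((ContinuousLinearMap.piMap fun _ => altPull g).prodMap
      ((ContinuousLinearMap.piMap fun _ => altPull g).prodMap
        (ContinuousLinearMap.piMap fun _ => altPull g)))

namespace Lagrangian

variable (L : Lagrangian m ι κ)

theorem pull_mem_iff (g : Vec (m + 2) ≃L[ℝ] Vec (m + 2)) (j : Jet m ι κ) :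
    j.pull g ∈ L.dom ↔ j ∈ L.dom := by
  refine ⟨fun h => ?_, L.pull_mem g j⟩
  have := L.pull_mem g.symm _ h
  rwa [Jet.pull_pull_symm] at this

theorem contDiffAt {j : Jet m ι κ} (hj : j ∈ L.dom) : ContDiffAt ℝ ∞ L.toFun j :=
  L.smooth.contDiffAt (L.isOpen_dom.mem_nhds hj)

theorem differentiableAt {j : Jet m ι κ} (hj : j ∈ L.dom) : DifferentiableAt ℝ L.toFun j :=
  (L.contDiffAt hj).differentiableAt (by simp)

/-- Naturality of `L` holds on a neighbourhood of `j`, so it can be differentiated in `j`; pullback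
by a fixed `g` is linear on both sides. -/
theorem fderiv_pull (g : Vec (m + 2) ≃L[ℝ] Vec (m + 2)) {j : Jet m ι κ} (hj : j ∈ L.dom)
    (δ : Jet m ι κ) : fderiv ℝ L.toFun (j.pull g) (δ.pull g) =
      (fderiv ℝ L.toFun j δ).compContinuousLinearMap (g : Vec (m + 2) →L[ℝ] Vec (m + 2)) := by
  have h1 : (fun i => L.toFun (Jet.pullCLM (g : Vec (m + 2) →L[ℝ] Vec (m + 2)) i)) =ᶠ[𝓝 j]
      fun i => altPull (g : Vec (m + 2) →L[ℝ] Vec (m + 2)) (L.toFun i) := by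
    filter_upwards [L.isOpen_dom.mem_nhds hj] with i hi
    exact L.natural g i hi
  have h2 : HasFDerivAt L.toFun (fderiv ℝ L.toFun (j.pull g))
      (Jet.pullCLM (g : Vec (m + 2) →L[ℝ] Vec (m + 2)) j) :=
    (L.differentiableAt (L.pull_mem g j hj)).hasFDerivAt
  have h3 := h2.comp j (Jet.pullCLM (g : Vec (m + 2) →L[ℝ] Vec (m + 2))).hasFDerivAt
  have h4 := (altPull (g : Vec (m + 2) →L[ℝ] Vec (m + 2))).hasFDerivAt.comp j
    (L.differentiableAt hj).hasFDerivAt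
  have h5 := (h3.congr_of_eventuallyEq h1.symm).unique h4
  exact DFunLike.congr_fun h5 δ

theorem contDiffAt_fderiv_apply (δ : Jet m ι κ) {j : Jet m ι κ} (hj : j ∈ L.dom) :
    ContDiffAt ℝ ∞ (fun i => fderiv ℝ L.toFun i δ) j :=
  ((L.contDiffAt hj).fderiv_right (m := ∞) (by simp)).clm_apply contDiffAt_const

variable [DecidableEq ι] [DecidableEq κ]

/-- `δL` for a variation of the value of `A^a` only. -/
def dA (a : ι) (j : Jet m ι κ) : Alt (m + 2) 1 →L[ℝ] Alt (m + 2) (m + 2) :=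
  fderiv ℝ L.toFun j ∘L ContinuousLinearMap.inl ℝ _ _ ∘L
    ContinuousLinearMap.single ℝ (fun _ : ι => Alt (m + 2) 1) a

/-- `δL` for a variation of the value of `ϕ^b` only. -/
def dP (b : κ) (j : Jet m ι κ) : Alt (m + 2) 0 →L[ℝ] Alt (m + 2) (m + 2) :=
  fderiv ℝ L.toFun j ∘L ContinuousLinearMap.inr ℝ _ _ ∘L ContinuousLinearMap.inl ℝ _ _ ∘L
    ContinuousLinearMap.single ℝ (fun _ : κ => Alt (m + 2) 0) b

/-- `δL` for a variation of the value of `dA^a` only. -/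
def dF (a : ι) (j : Jet m ι κ) : Alt (m + 2) 2 →L[ℝ] Alt (m + 2) (m + 2) :=
  fderiv ℝ L.toFun j ∘L ContinuousLinearMap.inr ℝ _ _ ∘L ContinuousLinearMap.inr ℝ _ _ ∘L
    ContinuousLinearMap.inl ℝ _ _ ∘L ContinuousLinearMap.single ℝ (fun _ : ι => Alt (m + 2) 2) a

/-- `δL` for a variation of the value of `dϕ^b` only. -/
def dDP (b : κ) (j : Jet m ι κ) : Alt (m + 2) 1 →L[ℝ] Alt (m + 2) (m + 2) :=
  fderiv ℝ L.toFun j ∘L ContinuousLinearMap.inr ℝ _ _ ∘L ContinuousLinearMap.inr ℝ _ _ ∘L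
    ContinuousLinearMap.inr ℝ _ _ ∘L ContinuousLinearMap.single ℝ (fun _ : κ => Alt (m + 2) 1) b

theorem dA_apply (a : ι) (j : Jet m ι κ) (β : Alt (m + 2) 1) :
    L.dA a j β = fderiv ℝ L.toFun j (Pi.single a β, 0, 0, 0) := rfl

theorem dP_apply (b : κ) (j : Jet m ι κ) (f : Alt (m + 2) 0) :
    L.dP b j f = fderiv ℝ L.toFun j (0, Pi.single b f, 0, 0) := rfl

theorem dF_apply (a : ι) (j : Jet m ι κ) (F : Alt (m + 2) 2) :
    L.dF a j F = fderiv ℝ L.toFun j (0, 0, Pi.single a F, 0) := rfl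

theorem dDP_apply (b : κ) (j : Jet m ι κ) (β : Alt (m + 2) 1) :
    L.dDP b j β = fderiv ℝ L.toFun j (0, 0, 0, Pi.single b β) := rfl

theorem fderiv_eq_sum (j δ : Jet m ι κ) :
    fderiv ℝ L.toFun j δ = ∑ a, L.dA a j (δ.1 a) + ∑ b, L.dP b j (δ.2.1 b) +
      ∑ a, L.dF a j (δ.2.2.1 a) + ∑ b, L.dDP b j (δ.2.2.2 b) := by
  have h : δ = ∑ a, ((Pi.single a (δ.1 a), 0, 0, 0) : Jet m ι κ) +
      ∑ b, ((0, Pi.single b (δ.2.1 b), 0, 0) : Jet m ι κ) +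
      ∑ a, ((0, 0, Pi.single a (δ.2.2.1 a), 0) : Jet m ι κ) +
      ∑ b, ((0, 0, 0, Pi.single b (δ.2.2.2 b)) : Jet m ι κ) := by
    refine Prod.ext ?_ (Prod.ext ?_ (Prod.ext ?_ ?_)) <;>
    simp [Prod.fst_sum, Prod.snd_sum, Finset.univ_sum_single]
  conv_lhs => rw [h]
  simp only [map_add, map_sum]
  rfl

/-- In top degree `β ∧ ι_{eᵢ} w = β(eᵢ) w`, so the sum reassembles `G` on the expansion of `β` in
the dual basis. This shows that the explicit formulas for `lamA` and `piP` have the defining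
property of the momenta. -/
theorem sum_wedge_curryLeft {n : ℕ} (G : Alt (n + 1) 1 →L[ℝ] Alt (n + 1) (n + 1))
    (β : Alt (n + 1) 1) :
    wedge β (∑ i, (G (stdCov i)).curryLeft (stdVec i)) = G β := by
  rw [wedge_sum]
  conv_rhs => rw [← sum_covL_smul_stdCov β, map_sum]
  refine Finset.sum_congr rfl fun i _ => ?_
  rw [wedge_curryLeft_top β rfl, map_smul]

theorem wedge_lamA (a : ι) (j : Jet m ι κ) (β : Alt (m + 2) 1) :
    wedge β (L.lamA a j) = L.dA a j β :=
  sum_wedge_curryLeft (L.dA a j) β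

theorem wedge_piP (b : κ) (j : Jet m ι κ) (β : Alt (m + 2) 1) :
    wedge β (L.piP b j) = L.dDP b j β :=
  sum_wedge_curryLeft (L.dDP b j) β

theorem scalar_smul_lamP (b : κ) (j : Jet m ι κ) (f : Alt (m + 2) 0) :
    scalar f • L.lamP b j = L.dP b j f := by
  conv_rhs => rw [eq_scalar_smul f, map_smul]
  rfl

/-- The analogue for variations of a `2`-form, tested on decomposable ones. Two applications of the
top-degree identity turn each summand of `piA` into an antisymmetric coefficient times the variation
along `eⁱ ∧ eˡ`. -/
theorem wedge_wedge_piA (a : ι) (j : Jet m ι κ) (β η : Alt (m + 2) 1) :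
    wedge β (wedge η (L.piA a j)) = L.dF a j (wedge β η) := by
  have key : ∀ (p q : Alt (m + 2) 1) (u v : Vec (m + 2)) (w : Alt (m + 2) (m + 2)),
      wedge p (wedge q ((w.curryLeft u).curryLeft v)) =
        (covL q v * covL p u) • w - (covL q u * covL p v) • w := by
    intro p q u v w
    have h1 := curryLeft_wedge q (w.curryLeft u) v
    rw [wedge_curryLeft_top q rfl w u] at h1
    have h2 : wedge q ((w.curryLeft u).curryLeft v) =
        covL q v • w.curryLeft u - covL q u • w.curryLeft v := by
      have h3 : (covL q u • w).curryLeft v = covL q u • w.curryLeft v := rfl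
      rw [← h3, h1, sub_sub_cancel]
    rw [h2, wedge_sub, wedge_smul, wedge_smul, wedge_curryLeft_top p rfl,
      wedge_curryLeft_top p rfl, smul_smul, smul_smul]
  have h0 : L.piA a j = (2⁻¹ : ℝ) • ∑ i, ∑ l,
      ((L.dF a j (wedge (stdCov i) (stdCov l))).curryLeft (stdVec i)).curryLeft (stdVec l) := rfl
  have hexp : ∀ p q : Alt (m + 2) 1, L.dF a j (wedge p q) = ∑ i, ∑ l,
      (covL q (stdVec l) * covL p (stdVec i)) • L.dF a j (wedge (stdCov i) (stdCov l)) := by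
    intro p q
    conv_lhs => rw [← sum_covL_smul_stdCov p, ← sum_covL_smul_stdCov q]
    rw [sum_wedge, map_sum]
    refine Finset.sum_congr rfl fun i _ => ?_
    rw [wedge_sum, map_sum]
    refine Finset.sum_congr rfl fun l _ => ?_
    rw [smul_wedge, wedge_smul, map_smul, map_smul, smul_smul, mul_comm]
  have hanti : L.dF a j (wedge η β) = -L.dF a j (wedge β η) := by
    have h : wedge η β = -wedge β η := by
      have hs : ∀ α : Alt (m + 2) 1, wedge α α = 0 := by
        intro α
        ext v
        rw [wedge_eq, ContinuousAlternatingMap.alternatizeUncurryFin_apply, Fin.sum_univ_two]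
        have e0 : ((0 : Fin 2).removeNth v : Fin 1 → Vec (m + 2)) = ![v 1] := by
          ext i; fin_cases i; rfl
        have e1 : ((1 : Fin 2).removeNth v : Fin 1 → Vec (m + 2)) = ![v 0] := by
          ext i; fin_cases i; rfl
        simp only [e0, e1, covL_apply, ContinuousLinearMap.smulRight_apply]
        simp [mul_comm (α ![v 1])]
      have h := hs (β + η)
      rw [add_wedge, wedge_add, wedge_add, hs, hs, zero_add, add_zero] at h
      exact eq_neg_of_add_eq_zero_right h
    rw [h, map_neg]
  rw [h0, wedge_smul, wedge_smul, wedge_sum, wedge_sum]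
  have h3 : ∑ i, wedge β (wedge η (∑ l, ((L.dF a j (wedge (stdCov i) (stdCov l))).curryLeft
      (stdVec i)).curryLeft (stdVec l))) = L.dF a j (wedge β η) - L.dF a j (wedge η β) := by
    rw [hexp β η, hexp η β, ← Finset.sum_sub_distrib]
    refine Finset.sum_congr rfl fun i _ => ?_
    rw [wedge_sum, wedge_sum, ← Finset.sum_sub_distrib]
    refine Finset.sum_congr rfl fun l _ => ?_
    rw [key, mul_comm (covL β (stdVec l))]
  -- The sum over ordered pairs counts `β ∧ η` twice, which cancels the factor `2⁻¹` in `piA`.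
  rw [h3, hanti, sub_neg_eq_add, ← two_smul ℝ, smul_smul]
  norm_num

/-- The differential of the Lagrangian in terms of the momenta. -/
theorem fderiv_eq_momenta (j δ : Jet m ι κ) :
    fderiv ℝ L.toFun j δ = ∑ a, wedge (δ.1 a) (L.lamA a j) + ∑ b, scalar (δ.2.1 b) • L.lamP b j +
      ∑ a, L.dF a j (δ.2.2.1 a) + ∑ b, wedge (δ.2.2.2 b) (L.piP b j) := by
  rw [fderiv_eq_sum]
  simp only [wedge_lamA, scalar_smul_lamP, wedge_piP]

theorem pull_symm_alt {n k : ℕ} (g : Vec n ≃L[ℝ] Vec n) (w : Alt n k) :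
    (w.compContinuousLinearMap (g.symm : Vec n →L[ℝ] Vec n)).compContinuousLinearMap
      (g : Vec n →L[ℝ] Vec n) = w := by
  ext v
  simp only [ContinuousAlternatingMap.compContinuousLinearMap_apply]
  congr 1
  funext i
  simp

theorem pull_single {s : Type*} [DecidableEq s] {n k : ℕ} (g : Vec n ≃L[ℝ] Vec n) (a : s)
    (β : Alt n k) :
    (fun c => ((Pi.single a β : s → Alt n k) c).compContinuousLinearMap
      (g : Vec n →L[ℝ] Vec n)) =
      Pi.single a (β.compContinuousLinearMap (g : Vec n →L[ℝ] Vec n)) := by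
  funext c
  by_cases h : c = a
  · subst h; simp
  · rw [Pi.single_eq_of_ne h, Pi.single_eq_of_ne h]; rfl

theorem dA_pull (g : Vec (m + 2) ≃L[ℝ] Vec (m + 2)) {j : Jet m ι κ} (hj : j ∈ L.dom) (a : ι)
    (β : Alt (m + 2) 1) : L.dA a (j.pull g) (β.compContinuousLinearMap (g : _ →L[ℝ] _)) =
      (L.dA a j β).compContinuousLinearMap (g : _ →L[ℝ] _) := by
  rw [dA_apply, dA_apply, ← L.fderiv_pull g hj]
  congr 1
  exact Prod.ext (pull_single g a β).symm rfl

theorem dP_pull (g : Vec (m + 2) ≃L[ℝ] Vec (m + 2)) {j : Jet m ι κ} (hj : j ∈ L.dom) (b : κ)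
    (f : Alt (m + 2) 0) : L.dP b (j.pull g) (f.compContinuousLinearMap (g : _ →L[ℝ] _)) =
      (L.dP b j f).compContinuousLinearMap (g : _ →L[ℝ] _) := by
  rw [dP_apply, dP_apply, ← L.fderiv_pull g hj]
  congr 1
  exact Prod.ext rfl (Prod.ext (pull_single g b f).symm rfl)

theorem dF_pull (g : Vec (m + 2) ≃L[ℝ] Vec (m + 2)) {j : Jet m ι κ} (hj : j ∈ L.dom) (a : ι)
    (F : Alt (m + 2) 2) : L.dF a (j.pull g) (F.compContinuousLinearMap (g : _ →L[ℝ] _)) =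
      (L.dF a j F).compContinuousLinearMap (g : _ →L[ℝ] _) := by
  rw [dF_apply, dF_apply, ← L.fderiv_pull g hj]
  congr 1
  exact Prod.ext rfl (Prod.ext rfl (Prod.ext (pull_single g a F).symm rfl))

theorem dDP_pull (g : Vec (m + 2) ≃L[ℝ] Vec (m + 2)) {j : Jet m ι κ} (hj : j ∈ L.dom) (b : κ)
    (β : Alt (m + 2) 1) : L.dDP b (j.pull g) (β.compContinuousLinearMap (g : _ →L[ℝ] _)) =
      (L.dDP b j β).compContinuousLinearMap (g : _ →L[ℝ] _) := by
  rw [dDP_apply, dDP_apply, ← L.fderiv_pull g hj]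
  congr 1
  exact Prod.ext rfl (Prod.ext rfl (Prod.ext rfl (pull_single g b β).symm))

/-- Both sides are wedged with a `1`-form, which may be assumed to be a pullback by the invertible
`g`. The claim then reduces to equivariance of `δL`. The other momenta of degree below `n` are
treated alike, with two wedges for `piA`. -/
theorem lamA_pull (g : Vec (m + 2) ≃L[ℝ] Vec (m + 2)) {j : Jet m ι κ} (hj : j ∈ L.dom) (a : ι) :
    L.lamA a (j.pull g) = (L.lamA a j).compContinuousLinearMap (g : _ →L[ℝ] _) := by
  rw [← sub_eq_zero]
  refine eq_zero_of_wedge_eq_zero (by omega) _ fun α => ?_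
  rw [← pull_symm_alt g α, wedge_sub, wedge_lamA, dA_pull L g hj,
    ← wedge_compContinuousLinearMap, wedge_lamA, sub_self]

theorem piP_pull (g : Vec (m + 2) ≃L[ℝ] Vec (m + 2)) {j : Jet m ι κ} (hj : j ∈ L.dom) (b : κ) :
    L.piP b (j.pull g) = (L.piP b j).compContinuousLinearMap (g : _ →L[ℝ] _) := by
  rw [← sub_eq_zero]
  refine eq_zero_of_wedge_eq_zero (by omega) _ fun α => ?_
  rw [← pull_symm_alt g α, wedge_sub, wedge_piP, dDP_pull L g hj,
    ← wedge_compContinuousLinearMap, wedge_piP, sub_self]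

theorem lamP_pull (g : Vec (m + 2) ≃L[ℝ] Vec (m + 2)) {j : Jet m ι κ} (hj : j ∈ L.dom) (b : κ) :
    L.lamP b (j.pull g) = (L.lamP b j).compContinuousLinearMap (g : _ →L[ℝ] _) := by
  have h : (constOfIsEmpty ℝ (Vec (m + 2)) (Fin 0) (1 : ℝ)).compContinuousLinearMap
      (g : Vec (m + 2) →L[ℝ] Vec (m + 2)) = constOfIsEmpty ℝ (Vec (m + 2)) (Fin 0) (1 : ℝ) := rfl
  have := L.dP_pull g hj b (constOfIsEmpty ℝ (Vec (m + 2)) (Fin 0) (1 : ℝ))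
  rwa [h] at this

theorem piA_pull (g : Vec (m + 2) ≃L[ℝ] Vec (m + 2)) {j : Jet m ι κ} (hj : j ∈ L.dom) (a : ι) :
    L.piA a (j.pull g) = (L.piA a j).compContinuousLinearMap (g : _ →L[ℝ] _) := by
  rw [← sub_eq_zero]
  refine eq_zero_of_wedge_eq_zero (by omega) _ fun β => ?_
  refine eq_zero_of_wedge_eq_zero (by omega) _ fun α => ?_
  rw [← pull_symm_alt g α, ← pull_symm_alt g β]
  generalize α.compContinuousLinearMap (g.symm : Vec (m + 2) →L[ℝ] Vec (m + 2)) = α'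
  generalize β.compContinuousLinearMap (g.symm : Vec (m + 2) →L[ℝ] Vec (m + 2)) = β'
  rw [wedge_sub, wedge_sub, wedge_wedge_piA, ← wedge_compContinuousLinearMap, dF_pull L g hj,
    ← wedge_compContinuousLinearMap, ← wedge_compContinuousLinearMap, wedge_wedge_piA, sub_self]

theorem contDiffAt_lamA (a : ι) {j : Jet m ι κ} (hj : j ∈ L.dom) :
    ContDiffAt ℝ ∞ (L.lamA a) j :=
  ContDiffAt.sum fun i _ =>
    (innerL (stdVec i)).contDiff.contDiffAt.comp j (L.contDiffAt_fderiv_apply _ hj)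

theorem contDiffAt_lamP (b : κ) {j : Jet m ι κ} (hj : j ∈ L.dom) :
    ContDiffAt ℝ ∞ (L.lamP b) j :=
  L.contDiffAt_fderiv_apply _ hj

theorem contDiffAt_piP (b : κ) {j : Jet m ι κ} (hj : j ∈ L.dom) :
    ContDiffAt ℝ ∞ (L.piP b) j :=
  ContDiffAt.sum fun i _ =>
    (innerL (stdVec i)).contDiff.contDiffAt.comp j (L.contDiffAt_fderiv_apply _ hj)

theorem contDiffAt_piA (a : ι) {j : Jet m ι κ} (hj : j ∈ L.dom) :
    ContDiffAt ℝ ∞ (L.piA a) j :=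
  ContDiffAt.const_smul (2⁻¹ : ℝ) (ContDiffAt.sum fun i _ => ContDiffAt.sum fun l _ =>
    (innerL (stdVec l)).contDiff.contDiffAt.comp j ((innerL (stdVec i)).contDiff.contDiffAt.comp j
      (L.contDiffAt_fderiv_apply _ hj)))

end Lagrangian

end MomentaLemmas

/-! ### Chart representatives -/

section Pullback

variable {k : ℕ} {V W : Type*} [NormedAddCommGroup V] [NormedSpace ℝ V] [NormedAddCommGroup W]
  [NormedSpace ℝ W]

-- Pullback is polynomial in the linear map. The induction on the degree uses that `(k + 1) • g^*f`
-- is the alternation of `v ↦ g^*(ι_{g v} f)`; in degree `0` the pullback does not depend on `g`.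
open ContinuousAlternatingMap in
theorem contDiff_compContinuousLinearMapCLM (k : ℕ) : ContDiff ℝ ∞ (fun g : V →L[ℝ] W =>
    (compContinuousLinearMapCLM g : (W [⋀^Fin k]→L[ℝ] ℝ) →L[ℝ] V [⋀^Fin k]→L[ℝ] ℝ)) := by
  induction k with
  | zero =>
    have h : ∀ g : V →L[ℝ] W, (compContinuousLinearMapCLM g :
        (W [⋀^Fin 0]→L[ℝ] ℝ) →L[ℝ] V [⋀^Fin 0]→L[ℝ] ℝ) = compContinuousLinearMapCLM 0 := by
      intro g
      ext f v
      simp only [compContinuousLinearMapCLM_apply, compContinuousLinearMap_apply]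
      congr 1
      exact Subsingleton.elim _ _
    rw [funext h]
    exact contDiff_const
  | succ k ih =>
    have h : ∀ g : V →L[ℝ] W, (compContinuousLinearMapCLM g :
        (W [⋀^Fin (k + 1)]→L[ℝ] ℝ) →L[ℝ] V [⋀^Fin (k + 1)]→L[ℝ] ℝ) = ((k + 1 : ℕ) : ℝ)⁻¹ •
        (alternatizeUncurryFinCLM ℝ V ℝ ∘L
          (ContinuousLinearMap.compL ℝ V (W [⋀^Fin k]→L[ℝ] ℝ) (V [⋀^Fin k]→L[ℝ] ℝ)
            (compContinuousLinearMapCLM g)) ∘L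
          ((ContinuousLinearMap.compL ℝ V W (W [⋀^Fin k]→L[ℝ] ℝ)).flip g) ∘L
            (curryLeftLI (𝕜 := ℝ) (E := W) (F := ℝ) (n := k)).toContinuousLinearMap) := by
      intro g
      ext1 f
      have h1 : (alternatizeUncurryFinCLM ℝ V ℝ ∘L
          (ContinuousLinearMap.compL ℝ V (W [⋀^Fin k]→L[ℝ] ℝ) (V [⋀^Fin k]→L[ℝ] ℝ)
            (compContinuousLinearMapCLM g)) ∘L
          ((ContinuousLinearMap.compL ℝ V W (W [⋀^Fin k]→L[ℝ] ℝ)).flip g) ∘L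
            (curryLeftLI (𝕜 := ℝ) (E := W) (F := ℝ) (n := k)).toContinuousLinearMap) f =
          alternatizeUncurryFin (f.compContinuousLinearMap g).curryLeft := by
        change alternatizeUncurryFin (compContinuousLinearMapCLM g ∘L f.curryLeft ∘L g) = _
        congr 1
        ext1 v
        rw [curryLeft_compContinuousLinearMap]
        rfl
      rw [_root_.smul_apply, h1, alternatizeUncurryFin_curryLeft, ← Nat.cast_smul_eq_nsmul ℝ, smul_smul,
        inv_mul_cancel₀ (by positivity), one_smul]
      rfl
    rw [funext h]
    have h0 := ContinuousLinearMap.contDiff (𝕜 := ℝ) (n := ∞)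
      (E := (W [⋀^Fin k]→L[ℝ] ℝ) →L[ℝ] V [⋀^Fin k]→L[ℝ] ℝ)
      (F := (V →L[ℝ] W [⋀^Fin k]→L[ℝ] ℝ) →L[ℝ] V →L[ℝ] V [⋀^Fin k]→L[ℝ] ℝ)
      (ContinuousLinearMap.compL ℝ V (W [⋀^Fin k]→L[ℝ] ℝ) (V [⋀^Fin k]→L[ℝ] ℝ))
    have h1 := h0.comp ih
    have h2 : ContDiff ℝ ∞ fun g : V →L[ℝ] W =>
        (ContinuousLinearMap.compL ℝ V W (W [⋀^Fin k]→L[ℝ] ℝ)).flip g :=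
      ContinuousLinearMap.contDiff (𝕜 := ℝ) (n := ∞) (E := V →L[ℝ] W)
        (F := (W →L[ℝ] W [⋀^Fin k]→L[ℝ] ℝ) →L[ℝ] V →L[ℝ] W [⋀^Fin k]→L[ℝ] ℝ)
        (ContinuousLinearMap.compL ℝ V W (W [⋀^Fin k]→L[ℝ] ℝ)).flip
    have h3 := h1.clm_comp (h2.clm_comp (contDiff_const
      (c := (curryLeftLI (𝕜 := ℝ) (E := W) (F := ℝ) (n := k)).toContinuousLinearMap)))
    exact ContDiff.const_smul _ ((contDiff_const (c := alternatizeUncurryFinCLM ℝ V ℝ)).clm_comp h3)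

theorem contDiffAt_compContinuousLinearMap {P : Type*} [NormedAddCommGroup P] [NormedSpace ℝ P]
    {f : P → W [⋀^Fin k]→L[ℝ] ℝ} {g : P → V →L[ℝ] W} {s : P}
    (hf : ContDiffAt ℝ ∞ f s) (hg : ContDiffAt ℝ ∞ g s) :
    ContDiffAt ℝ ∞ (fun z => (f z).compContinuousLinearMap (g z)) s :=
  ((contDiff_compContinuousLinearMapCLM k).contDiffAt.comp s hg).clm_apply hf

end Pullback

/-! ### Transition maps and chart expressions of forms and vector fields. -/

section Charts

open ContinuousAlternatingMap (alternatizeUncurryFin compContinuousLinearMapCLM)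

variable {n k : ℕ} {M : Type*} [TopologicalSpace M] [ChartedSpace (Vec n) M]

/-- The transition map from the preferred chart at `p` to the preferred chart at `q`. -/
def transMap (p q : M) (y : Vec n) : Vec n :=
  extChartAt (𝓡 n) q ((extChartAt (𝓡 n) p).symm y)

/-- The open set of points of the chart at `p` that lie in the domain of the chart at `q`. -/
def overlap (p q : M) : Set (Vec n) :=
  (extChartAt (𝓡 n) p).target ∩ (extChartAt (𝓡 n) p).symm ⁻¹' (extChartAt (𝓡 n) q).source

theorem isOpen_overlap (p q : M) : IsOpen (overlap (n := n) p q) :=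
  (continuousOn_extChartAt_symm p).isOpen_inter_preimage (isOpen_extChartAt_target p)
    (isOpen_extChartAt_source q)

theorem transMap_mem_overlap {p q : M} {y : Vec n} (hy : y ∈ overlap p q) :
    transMap p q y ∈ overlap q p := by
  refine ⟨(extChartAt (𝓡 n) q).map_source hy.2, ?_⟩
  rw [mem_preimage, transMap, (extChartAt (𝓡 n) q).left_inv hy.2]
  exact (extChartAt (𝓡 n) p).map_target hy.1

theorem symm_transMap {p q : M} {y : Vec n} (hy : y ∈ overlap p q) :
    (extChartAt (𝓡 n) q).symm (transMap p q y) = (extChartAt (𝓡 n) p).symm y :=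
  (extChartAt (𝓡 n) q).left_inv hy.2

theorem transMap_transMap {p q : M} (r : M) {y : Vec n} (hy : y ∈ overlap p q) :
    transMap q r (transMap p q y) = transMap p r y := by
  unfold transMap
  rw [(extChartAt (𝓡 n) q).left_inv hy.2]

theorem transMap_self {p : M} {y : Vec n} (hy : y ∈ (extChartAt (𝓡 n) p).target) :
    transMap p p y = y :=
  (extChartAt (𝓡 n) p).right_inv hy

theorem mem_overlap_symm {p : M} {y : Vec n} (hy : y ∈ (extChartAt (𝓡 n) p).target) :
    y ∈ overlap p ((extChartAt (𝓡 n) p).symm y) :=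
  ⟨hy, mem_extChartAt_source _⟩

theorem symm_center (p : M) : (extChartAt (𝓡 n) p).symm (extChartAt (𝓡 n) p p) = p :=
  (extChartAt (𝓡 n) p).left_inv (mem_extChartAt_source p)

theorem target_mem_nhds (p : M) : (extChartAt (𝓡 n) p).target ∈ 𝓝 (extChartAt (𝓡 n) p p) :=
  extChartAt_target_mem_nhds p

variable [IsManifold (𝓡 n) ∞ M]

theorem contDiffAt_transMap {p q : M} {y : Vec n} (hy : y ∈ overlap p q) :
    ContDiffAt ℝ ∞ (transMap p q) y := by
  have h := contDiffWithinAt_ext_coord_change (I := 𝓡 n) (n := ∞) q p (y := y)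
    (by
      rw [PartialEquiv.trans_source]
      exact hy)
  rw [ModelWithCorners.range_eq_univ, contDiffWithinAt_univ] at h
  exact h

theorem differentiableAt_transMap {p q : M} {y : Vec n} (hy : y ∈ overlap p q) :
    DifferentiableAt ℝ (transMap p q) y :=
  (contDiffAt_transMap hy).differentiableAt (by simp)

/-- The tangent space at a point is trivialised by the preferred chart of that same point, so the
derivative of an inverse chart at `y` is that of a transition map whose target chart depends on `y`.
All chart computations are reduced to derivatives of transition maps in this way. -/
theorem mfderiv_extChartAt_symm_eq {p : M} {y : Vec n} (hy : y ∈ (extChartAt (𝓡 n) p).target) :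
    (mfderiv 𝓘(ℝ, Vec n) (𝓡 n) (extChartAt (𝓡 n) p).symm y : Vec n →L[ℝ] Vec n) =
      fderiv ℝ (transMap p ((extChartAt (𝓡 n) p).symm y)) y := by
  have h : MDifferentiableAt 𝓘(ℝ, Vec n) (𝓡 n) (extChartAt (𝓡 n) p).symm y := by
    have := mdifferentiableWithinAt_extChartAt_symm (I := 𝓡 n) (x := p) hy
    simpa only [ModelWithCorners.range_eq_univ, mdifferentiableWithinAt_univ] using this
  refine h.mfderiv.trans ?_
  rw [ModelWithCorners.range_eq_univ, fderivWithin_univ]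
  rfl

theorem fderiv_transMap_comp {p q : M} (r : M) {y : Vec n} (hy : y ∈ overlap p q)
    (hr : y ∈ overlap p r) :
    fderiv ℝ (transMap p r) y =
      fderiv ℝ (transMap q r) (transMap p q y) ∘L fderiv ℝ (transMap p q) y := by
  have h1 : transMap p r =ᶠ[𝓝 y] fun z => transMap q r (transMap p q z) := by
    filter_upwards [(isOpen_overlap p q).mem_nhds hy] with z hz
    exact (transMap_transMap r hz).symm
  rw [h1.fderiv_eq]
  refine fderiv_comp y (differentiableAt_transMap ⟨(transMap_mem_overlap hy).1, ?_⟩)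
    (differentiableAt_transMap hy)
  rw [mem_preimage, symm_transMap hy]
  exact hr.2

theorem fderiv_transMap_self {p : M} {y : Vec n} (hy : y ∈ (extChartAt (𝓡 n) p).target) :
    fderiv ℝ (transMap p p) y = ContinuousLinearMap.id ℝ (Vec n) := by
  have h1 : transMap p p =ᶠ[𝓝 y] id := by
    filter_upwards [(isOpen_extChartAt_target p).mem_nhds hy] with z hz
    exact transMap_self hz
  rw [h1.fderiv_eq, fderiv_id]

/-- The derivative of a transition map as a linear automorphism. -/
def transEquiv {p q : M} {y : Vec n} (hy : y ∈ overlap p q) : Vec n ≃L[ℝ] Vec n :=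
  ContinuousLinearEquiv.equivOfInverse (fderiv ℝ (transMap p q) y)
    (fderiv ℝ (transMap q p) (transMap p q y))
    (fun v => by
      have hp : y ∈ overlap p p := ⟨hy.1, (extChartAt (𝓡 n) p).map_target hy.1⟩
      have h := fderiv_transMap_comp p hy hp
      rw [fderiv_transMap_self hy.1] at h
      exact (DFunLike.congr_fun h v).symm)
    (fun v => by
      have hy' := transMap_mem_overlap hy
      have hq : transMap p q y ∈ overlap q q := ⟨hy'.1, (extChartAt (𝓡 n) q).map_target hy'.1⟩
      have h := fderiv_transMap_comp q hy' hq
      rw [fderiv_transMap_self hy'.1, transMap_transMap p hy, transMap_self hy.1] at h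
      exact (DFunLike.congr_fun h v).symm)

theorem coe_transEquiv {p q : M} {y : Vec n} (hy : y ∈ overlap p q) :
    (transEquiv hy : Vec n →L[ℝ] Vec n) = fderiv ℝ (transMap p q) y := rfl

theorem chartRep_apply (w : Form n M k) {p : M} {y : Vec n}
    (hy : y ∈ (extChartAt (𝓡 n) p).target) :
    chartRep w p y = (w ((extChartAt (𝓡 n) p).symm y)).compContinuousLinearMap
      (fderiv ℝ (transMap p ((extChartAt (𝓡 n) p).symm y)) y) := by
  rw [chartRep, mfderiv_extChartAt_symm_eq hy]

theorem chartRep_trans (w : Form n M k) {p q : M} {y : Vec n} (hy : y ∈ overlap p q) :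
    chartRep w p y = (chartRep w q (transMap p q y)).compContinuousLinearMap
      (fderiv ℝ (transMap p q) y) := by
  rw [chartRep_apply w hy.1, chartRep_apply w (transMap_mem_overlap hy).1, symm_transMap hy,
    fderiv_transMap_comp _ hy (mem_overlap_symm hy.1)]
  rfl

theorem chartRep_self (w : Form n M k) (x : M) : chartRep w x (extChartAt (𝓡 n) x x) = w x := by
  have hx := mem_extChartAt_target (I := 𝓡 n) x
  rw [chartRep_apply w hx, symm_center, fderiv_transMap_self hx]
  rfl

theorem mfderiv_extChartAt_self (x : M) :
    (mfderiv (𝓡 n) 𝓘(ℝ, Vec n) (extChartAt (𝓡 n) x) x : Vec n →L[ℝ] Vec n) =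
      ContinuousLinearMap.id ℝ (Vec n) := by
  have hx := mem_extChartAt_target (I := 𝓡 n) x
  have h : MDifferentiableAt (𝓡 n) 𝓘(ℝ, Vec n) (extChartAt (𝓡 n) x) x :=
    mdifferentiableAt_extChartAt (mem_chart_source (Vec n) x)
  refine h.mfderiv.trans ?_
  rw [ModelWithCorners.range_eq_univ, fderivWithin_univ]
  exact fderiv_transMap_self hx

theorem extD_apply (w : Form n M k) (x : M) :
    extD w x = extDeriv (chartRep w x) (extChartAt (𝓡 n) x x) := by
  rw [extD, mfderiv_extChartAt_self]
  rfl

theorem chartRep_trans_eventually (w : Form n M k) {p q : M} {y : Vec n} (hy : y ∈ overlap p q) :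
    chartRep w p =ᶠ[𝓝 y] fun z => (chartRep w q (transMap p q z)).compContinuousLinearMap
      (fderiv ℝ (transMap p q) z) := by
  filter_upwards [(isOpen_overlap p q).mem_nhds hy] with z hz
  exact chartRep_trans w hz

theorem differentiableAt_chartRep_trans {w : Form n M k} {p q : M} {y : Vec n}
    (hy : y ∈ overlap p q) (hw : DifferentiableAt ℝ (chartRep w q) (transMap p q y)) :
    DifferentiableAt ℝ (chartRep w p) y := by
  refine DifferentiableAt.congr_of_eventuallyEq ?_ (chartRep_trans_eventually w hy)
  exact (hw.comp y (differentiableAt_transMap hy)).continuousAlternatingMapCompContinuousLinearMap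
    (((contDiffAt_transMap hy).fderiv_right (m := ∞) (by simp)).differentiableAt (by simp))

/-- The two chart expressions are related near `y` by pullback along the transition map, and `d`
commutes with pullback. Hence the chart used to define `extD` does not matter. -/
theorem extDeriv_chartRep_trans {w : Form n M k} {p q : M} {y : Vec n}
    (hy : y ∈ overlap p q) (hw : DifferentiableAt ℝ (chartRep w q) (transMap p q y)) :
    extDeriv (chartRep w p) y = (extDeriv (chartRep w q) (transMap p q y)).compContinuousLinearMap
      (fderiv ℝ (transMap p q) y) := by
  rw [(chartRep_trans_eventually w hy).extDeriv_eq]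
  exact extDeriv_pullback hw (contDiffAt_transMap hy) (by
    rw [minSmoothness_of_isRCLikeNormedField]
    exact WithTop.coe_le_coe.2 (le_top : (2 : ℕ∞) ≤ ⊤))

/-- The de Rham differential may be computed in any chart. -/
theorem chartRep_extD {w : Form n M k} {p : M} {y : Vec n}
    (hy : y ∈ (extChartAt (𝓡 n) p).target) (hw : DifferentiableAt ℝ (chartRep w p) y) :
    chartRep (extD w) p y = extDeriv (chartRep w p) y := by
  have ho := mem_overlap_symm hy
  have ho' := transMap_mem_overlap ho
  have h1 : transMap ((extChartAt (𝓡 n) p).symm y) p (transMap p ((extChartAt (𝓡 n) p).symm y) y)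
      = y := by
    rw [transMap_transMap p ho, transMap_self hy]
  rw [chartRep_apply _ hy, extD_apply, extDeriv_chartRep_trans ho]
  · rfl
  · apply differentiableAt_chartRep_trans ho'
    rwa [h1]

theorem chartRep_extD_eventually {w : Form n M k} {p : M} {y : Vec n}
    (hy : y ∈ (extChartAt (𝓡 n) p).target) (hw : ContDiffAt ℝ ∞ (chartRep w p) y) :
    chartRep (extD w) p =ᶠ[𝓝 y] extDeriv (chartRep w p) := by
  have h1 : ContDiffAt ℝ 1 (chartRep w p) y := hw.of_le (by simp)
  filter_upwards [h1.eventually (by simp), (isOpen_extChartAt_target p).mem_nhds hy] with z hz hz'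
  exact chartRep_extD hz' (hz.differentiableAt (by simp))

/-- The expression of a vector field in the preferred chart at `p`. -/
def chartVec (X : ∀ x : M, TangentSpace (𝓡 n) x) (p : M) (y : Vec n) : Vec n :=
  (mfderiv 𝓘(ℝ, Vec n) (𝓡 n) (extChartAt (𝓡 n) p).symm y).inverse
    (X ((extChartAt (𝓡 n) p).symm y))

theorem chartVec_apply (X : ∀ x : M, TangentSpace (𝓡 n) x) {p : M} {y : Vec n}
    (hy : y ∈ (extChartAt (𝓡 n) p).target) :
    (fderiv ℝ (transMap p ((extChartAt (𝓡 n) p).symm y)) y) (chartVec X p y) =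
      X ((extChartAt (𝓡 n) p).symm y) := by
  have h : chartVec X p y = (fderiv ℝ (transMap p ((extChartAt (𝓡 n) p).symm y)) y).inverse
      (X ((extChartAt (𝓡 n) p).symm y)) := by
    rw [← mfderiv_extChartAt_symm_eq hy]; rfl
  rw [h, ← coe_transEquiv (mem_overlap_symm hy), ContinuousLinearMap.inverse_equiv]
  exact (transEquiv (mem_overlap_symm hy)).apply_symm_apply _

theorem chartRep_iprod (X : ∀ x : M, TangentSpace (𝓡 n) x) (w : Form n M (k + 1)) {p : M}
    {y : Vec n} (hy : y ∈ (extChartAt (𝓡 n) p).target) :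
    chartRep (iprod X w) p y = (chartRep w p y).curryLeft (chartVec X p y) := by
  rw [chartRep_apply _ hy, chartRep_apply _ hy,
    ContinuousAlternatingMap.curryLeft_compContinuousLinearMap, chartVec_apply X hy]
  rfl

theorem chartVec_self (X : ∀ x : M, TangentSpace (𝓡 n) x) (x : M) :
    chartVec X x (extChartAt (𝓡 n) x x) = X x := by
  have hx := mem_extChartAt_target (I := 𝓡 n) x
  have h := chartVec_apply X hx
  rw [symm_center, fderiv_transMap_self hx] at h
  exact h

/-- The chart expression is the pullback of the vector field along the inverse chart, whose
derivative is invertible; such pullbacks preserve smoothness. -/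
theorem contDiffAt_chartVec (X : DiffAlg n M) {p : M} {y : Vec n}
    (hy : y ∈ (extChartAt (𝓡 n) p).target) : ContDiffAt ℝ ∞ (chartVec X.field p) y := by
  have h1 : IsManifold (𝓡 n) 1 M := IsManifold.of_le (n := ∞) (by simp)
  have h2 := (X.smooth ((extChartAt (𝓡 n) p).symm y)).contMDiffWithinAt (s := univ)
  have h3 : ContMDiffWithinAt 𝓘(ℝ, Vec n) (𝓡 n) ∞ (extChartAt (𝓡 n) p).symm univ y := by
    have := (contMDiffOn_extChartAt_symm (I := 𝓡 n) (n := ∞) p y hy).contMDiffAt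
      ((isOpen_extChartAt_target p).mem_nhds hy)
    exact this.contMDiffWithinAt
  have h4 : (mfderivWithin 𝓘(ℝ, Vec n) (𝓡 n) (extChartAt (𝓡 n) p).symm univ y).IsInvertible := by
    have := isInvertible_mfderivWithin_extChartAt_symm (I := 𝓡 n) hy
    rwa [ModelWithCorners.range_eq_univ] at this
  have h5 := h2.mpullbackWithin_vectorField h3 h4 (mem_univ _) uniqueMDiffOn_univ
    (by simp) (mapsTo_univ _ _)
  rw [contMDiffWithinAt_vectorSpace_iff_contDiffWithinAt] at h5
  have h6 : VectorField.mpullbackWithin 𝓘(ℝ, Vec n) (𝓡 n) (extChartAt (𝓡 n) p).symm X.field univ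
      = chartVec X.field p := by
    funext z
    rw [VectorField.mpullbackWithin_apply, mfderivWithin_univ]
    rfl
  have h7 : ContDiffWithinAt ℝ ∞ (chartVec X.field p) univ y := by
    rw [← h6]
    exact h5
  exact contDiffWithinAt_univ.1 h7

/-- The bracket of vector fields is computed in the preferred chart at `x`, whose derivative at `x`
is the identity. The minus sign is the convention for `𝔡𝔦𝔣𝔣(M)`; it accounts for the signs of all
commutators below. -/
theorem bracket_apply (X Y : DiffAlg n M) (x : M) :
    ⁅X, Y⁆.field x = -VectorField.lieBracket ℝ (chartVec X.field x) (chartVec Y.field x)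
      (extChartAt (𝓡 n) x x) := by
  have h : ∀ Z : DiffAlg n M, VectorField.mpullbackWithin 𝓘(ℝ, Vec n) (𝓡 n)
      (extChartAt (𝓡 n) x).symm Z.field univ = chartVec Z.field x := by
    intro Z
    funext z
    rw [VectorField.mpullbackWithin_apply, mfderivWithin_univ]
    rfl
  rw [DiffAlg.bracket_field, Pi.neg_apply, ← VectorField.mlieBracketWithin_univ,
    VectorField.mlieBracketWithin_apply, ModelWithCorners.range_eq_univ, h, h, preimage_univ,
    univ_inter, VectorField.lieBracketWithin_univ]
  congr 1
  have h2 := mfderiv_extChartAt_self (n := n) x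
  generalize VectorField.lieBracket ℝ (chartVec X.field x) (chartVec Y.field x)
      (extChartAt (𝓡 n) x x) = v
  have h3 : (ContinuousLinearMap.id ℝ (Vec n)).inverse v = v := by simp
  rw [← h2] at h3
  exact h3

end Charts

/-! ### Cartan calculus in a chart -/

section LocalCalculus

open ContinuousAlternatingMap (alternatizeUncurryFin alternatizeUncurryFinCLM curryLeftLI
  alternatizeUncurryFin_add alternatizeUncurryFinCLM_apply)

variable {n k : ℕ}

/-- The action of an endomorphism on forms by derivations,
`(lieAct T w)(v₁, …) = ∑ i, w(v₁, …, T vᵢ, …)`. -/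
def lieAct (T : Vec n →L[ℝ] Vec n) (w : Alt n k) : Alt n k :=
  w.fderivCompContinuousLinearMap (ContinuousLinearMap.id ℝ (Vec n)) T

theorem lieAct_zero_form (T : Vec n →L[ℝ] Vec n) (w : Alt n 0) : lieAct T w = 0 := by
  rw [lieAct, ContinuousAlternatingMap.fderivCompContinuousLinearMap_of_isEmpty]
  rfl

theorem lieAct_succ (T : Vec n →L[ℝ] Vec n) (w : Alt n (k + 1)) :
    lieAct T w = alternatizeUncurryFin (w.curryLeft ∘L T) := by
  rw [lieAct, ContinuousAlternatingMap.fderivCompContinuousLinearMap_eq_alternatizeUncurryFin]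
  rfl

/-- The derivative of the pullback action at the identity is `T ↦ lieAct T w`. Every identity that
is natural under pullback can thereby be differentiated into one for `lieAct`. -/
theorem hasFDerivAt_compContinuousLinearMap_id (w : Alt n k) :
    HasFDerivAt (fun g : Vec n →L[ℝ] Vec n => w.compContinuousLinearMap g)
      (w.fderivCompContinuousLinearMap (ContinuousLinearMap.id ℝ (Vec n)))
      (ContinuousLinearMap.id ℝ (Vec n)) := by
  have h := (hasFDerivAt_const w (ContinuousLinearMap.id ℝ (Vec n))
    ).continuousAlternatingMapCompContinuousLinearMap
    (hasFDerivAt_id (𝕜 := ℝ) (ContinuousLinearMap.id ℝ (Vec n)))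
  refine h.congr_fderiv ?_
  ext1 T
  change (0 : Alt n k).compContinuousLinearMap _ + _ = _
  have h0 : (0 : Alt n k).compContinuousLinearMap (id (ContinuousLinearMap.id ℝ (Vec n))) = 0 :=
    rfl
  rw [h0, zero_add]
  rfl

/-- The extra term arises when `T` acts on the slot occupied by `v`. It will supply the `DX(Y)` half
of the Lie bracket. -/
theorem curryLeft_lieAct (T : Vec n →L[ℝ] Vec n) (w : Alt n (k + 1)) (v : Vec n) :
    (lieAct T w).curryLeft v = w.curryLeft (T v) + lieAct T (w.curryLeft v) := by
  cases k with
  | zero =>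
    rw [lieAct_succ, curryLeft_alternatizeUncurryFin_zero, lieAct_zero_form, add_zero]
    rfl
  | succ k =>
    rw [lieAct_succ, curryLeft_alternatizeUncurryFin, lieAct_succ, sub_eq_add_neg]
    congr 1
    rw [← alternatizeUncurryFinCLM_apply, ← alternatizeUncurryFinCLM_apply, ← map_neg]
    congr 1
    ext1 u
    exact (curryLeft_swap w v (T u)).symm

/-- Rank-one endomorphisms turn infinitesimal frame invariance into a statement about contractions
with a single vector; see `curryLeft_toFun`. -/
theorem lieAct_smulRight (β : Alt n 1) (v : Vec n) (w : Alt n (k + 1)) :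
    lieAct ((covL β).smulRight v) w = wedge β (w.curryLeft v) := by
  rw [lieAct_succ, wedge_eq]
  congr 1
  ext1 u
  simp

/-- The Lie derivative of a form on `ℝⁿ`. -/
def locLie (X : Vec n → Vec n) (w : Vec n → Alt n k) (y : Vec n) : Alt n k :=
  fderiv ℝ w y (X y) + lieAct (fderiv ℝ X y) (w y)

theorem hasFDerivAt_curryLeft {w : Vec n → Alt n (k + 1)} {X : Vec n → Vec n} {y : Vec n}
    (hw : DifferentiableAt ℝ w y) (hX : DifferentiableAt ℝ X y) :
    HasFDerivAt (fun z => (w z).curryLeft (X z))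
      ((w y).curryLeft ∘L fderiv ℝ X y + innerL (X y) ∘L fderiv ℝ w y) y := by
  have h := (((curryLeftLI (𝕜 := ℝ) (E := Vec n) (F := ℝ) (n := k)).toContinuousLinearMap
    ).hasFDerivAt.comp y hw.hasFDerivAt).clm_apply hX.hasFDerivAt
  exact h.congr_fderiv rfl

/-- Cartan's formula. The derivative of `ι_X w` has two parts: the one containing `DX` alternates to
`lieAct`, and the one containing `Dw` cancels against the non-leading part of `ι_X dw`. -/
theorem extDeriv_curryLeft {w : Vec n → Alt n (k + 1)} {X : Vec n → Vec n} {y : Vec n}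
    (hw : DifferentiableAt ℝ w y) (hX : DifferentiableAt ℝ X y) :
    (extDeriv w y).curryLeft (X y) + extDeriv (fun z => (w z).curryLeft (X z)) y =
      locLie X w y := by
  rw [extDeriv, extDeriv, (hasFDerivAt_curryLeft hw hX).fderiv, curryLeft_alternatizeUncurryFin,
    alternatizeUncurryFin_add, ← lieAct_succ, locLie]
  abel

theorem extDeriv_curryLeft_zero (w : Vec n → Alt n 0) (X : Vec n → Vec n) (y : Vec n) :
    (extDeriv w y).curryLeft (X y) = locLie X w y := by
  rw [extDeriv, curryLeft_alternatizeUncurryFin_zero, locLie, lieAct_zero_form, add_zero]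

/-- Differentiating `Y` gives `DY(X)`, and moving the contraction through `lieAct` gives `-DX(Y)`;
together they form the bracket. -/
theorem locLie_curryLeft {w : Vec n → Alt n (k + 1)} {X Y : Vec n → Vec n} {y : Vec n}
    (hw : DifferentiableAt ℝ w y) (hY : DifferentiableAt ℝ Y y) :
    locLie X (fun z => (w z).curryLeft (Y z)) y =
      (locLie X w y).curryLeft (Y y) + (w y).curryLeft (VectorField.lieBracket ℝ X Y y) := by
  rw [locLie, (hasFDerivAt_curryLeft hw hY).fderiv, locLie, VectorField.lieBracket]
  change _ = ((fderiv ℝ w y (X y)).curryLeft (Y y) + (lieAct (fderiv ℝ X y) (w y)).curryLeft (Y y))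
    + _
  rw [curryLeft_lieAct, map_sub]
  change (w y).curryLeft (fderiv ℝ Y y (X y)) + (fderiv ℝ w y (X y)).curryLeft (Y y) + _ = _
  abel

/-- The first term is `dα ∧ π`, left as a sum of iterated wedges because `wedge` only takes
`1`-forms on the left. In this shape `wedge_wedge_piA` applies to it directly. -/
theorem extDeriv_wedge {α : Vec n → Alt n 1} {π : Vec n → Alt n k} {y : Vec n}
    (hα : DifferentiableAt ℝ α y) (hπ : DifferentiableAt ℝ π y) :
    extDeriv (fun z => wedge (α z) (π z)) y =
      ∑ i, wedge (stdCov i) (wedge (fderiv ℝ α y (stdVec i)) (π y)) -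
        wedge (α y) (extDeriv π y) := by
  have h : HasFDerivAt (fun z => wedge (α z) (π z))
      (wedgeL.flip (π y) ∘L fderiv ℝ α y + wedgeL (α y) ∘L fderiv ℝ π y) y := by
    have := (wedgeL.hasFDerivAt.comp y hα.hasFDerivAt).clm_apply hπ.hasFDerivAt
    exact (this.congr_fderiv (add_comm _ _))
  rw [extDeriv, h.fderiv, alternatizeUncurryFin_add, sub_eq_add_neg]
  congr 1
  · exact alternatizeUncurryFin_eq_sum _
  · have h2 := alternatizeUncurryFin_comp_swap
      ((ContinuousLinearMap.smulRightL ℝ (Vec n) (Vec n →L[ℝ] Alt n k)) (covL (α y))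
        (fderiv ℝ π y)).flip
    have h3 : wedgeL (α y) ∘L fderiv ℝ π y = alternatizeUncurryFinCLM ℝ (Vec n) ℝ ∘L
        ((ContinuousLinearMap.smulRightL ℝ (Vec n) (Vec n →L[ℝ] Alt n k)) (covL (α y))
        (fderiv ℝ π y)).flip := by
      ext1 v
      change wedge (α y) (fderiv ℝ π y v) = alternatizeUncurryFin _
      rw [wedge_eq]
      congr 1
    rw [h3, h2, ContinuousLinearMap.flip_flip]
    congr 1
    rw [wedge_eq]
    congr 1
    ext1 v
    change alternatizeUncurryFinCLM ℝ (Vec n) ℝ (covL (α y) v • fderiv ℝ π y) = _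
    rw [map_smul]
    rfl

theorem extDeriv_one_eq_sum (α : Vec n → Alt n 1) (y : Vec n) :
    extDeriv α y = ∑ i, wedge (stdCov i) (fderiv ℝ α y (stdVec i)) :=
  alternatizeUncurryFin_eq_sum _

theorem extDeriv_scalar_smul {f : Vec n → Alt n 0} {π : Vec n → Alt n k} {y : Vec n}
    (hf : DifferentiableAt ℝ f y) (hπ : DifferentiableAt ℝ π y) :
    extDeriv (fun z => scalar (f z) • π z) y =
      wedge (extDeriv f y) (π y) + scalar (f y) • extDeriv π y := by
  have h : HasFDerivAt (fun z => scalar (f z) • π z)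
      ((scalarL ∘L fderiv ℝ f y).smulRight (π y) + scalar (f y) • fderiv ℝ π y) y :=
    ((scalarL.hasFDerivAt.comp y hf.hasFDerivAt).smul hπ.hasFDerivAt).congr_fderiv
      (add_comm _ _)
  rw [extDeriv, h.fderiv, alternatizeUncurryFin_add]
  congr 1
  · rw [wedge_eq]
    congr 2
    ext v
    change scalar (fderiv ℝ f y v) = _
    rw [← scalar_curryLeft, extDeriv, curryLeft_alternatizeUncurryFin_zero]
  · rw [← alternatizeUncurryFinCLM_apply, map_smul]
    rfl

end LocalCalculus

/-! ### Smooth families of forms -/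

section Families

open ContinuousAlternatingMap (alternatizeUncurryFin alternatizeUncurryFinCLM
  compContinuousLinearMapCLM alternatizeUncurryFinCLM_apply)

variable {n k : ℕ} {M : Type*} [TopologicalSpace M] [ChartedSpace (Vec n) M]
  {P P' : Type*} [NormedAddCommGroup P] [NormedSpace ℝ P] [NormedAddCommGroup P']
  [NormedSpace ℝ P']

/-- Smoothness of a form near a point. -/
def SmAt (w : Form n M k) (x : M) : Prop :=
  ContDiffAt ℝ ∞ (chartRep w x) (extChartAt (𝓡 n) x x)

theorem SmoothFamilyAt.smAt {u : P → Form n M k} {s : P} {p : M} (h : SmoothFamilyAt u s p) :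
    SmAt (u s) p :=
  ContDiffAt.comp (g := fun z : P × Vec n => chartRep (u z.1) p z.2) (f := fun y => (s, y))
    (extChartAt (𝓡 n) p p) h (contDiffAt_const.prodMk contDiffAt_id)

theorem SmAt.const {w : Form n M k} {p : M} (h : SmAt w p) (s : P) :
    SmoothFamilyAt (fun _ => w) s p :=
  ContDiffAt.comp (g := chartRep w p) (f := fun z : P × Vec n => z.2)
    (s, extChartAt (𝓡 n) p p) h contDiffAt_snd

theorem SmoothFamilyAt.comp {u : P → Form n M k} {f : P' → P} {s : P'} {p : M}
    (h : SmoothFamilyAt u (f s) p) (hf : ContDiffAt ℝ ∞ f s) :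
    SmoothFamilyAt (fun r => u (f r)) s p :=
  ContDiffAt.comp (g := fun z : P × Vec n => chartRep (u z.1) p z.2)
    (f := fun z : P' × Vec n => (f z.1, z.2)) (s, extChartAt (𝓡 n) p p) h
    ((hf.comp (s, extChartAt (𝓡 n) p p) contDiffAt_fst).prodMk contDiffAt_snd)

theorem eventually_target (s : P) (p : M) : ∀ᶠ z : P × Vec n in 𝓝 (s, extChartAt (𝓡 n) p p),
    z.2 ∈ (extChartAt (𝓡 n) p).target :=
  continuousAt_snd.eventually (target_mem_nhds p)

theorem tendsto_symm (s : P) (p : M) :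
    Tendsto (fun z : P × Vec n => (z.1, (extChartAt (𝓡 n) p).symm z.2))
      (𝓝 (s, extChartAt (𝓡 n) p p)) (𝓝 (s, p)) := by
  have h : ContinuousAt (fun z : P × Vec n => (z.1, (extChartAt (𝓡 n) p).symm z.2))
      (s, extChartAt (𝓡 n) p p) :=
    continuousAt_fst.prodMk
      (ContinuousAt.comp (f := fun z : P × Vec n => z.2) (x := (s, extChartAt (𝓡 n) p p))
        (continuousAt_extChartAt_symm p) continuousAt_snd)
  have h2 := h.tendsto
  rwa [symm_center] at h2

theorem SmoothFamilyAt.congr {u v : P → Form n M k} {s : P} {p : M} (h : SmoothFamilyAt u s p)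
    (huv : ∀ᶠ z : P × M in 𝓝 (s, p), u z.1 z.2 = v z.1 z.2) : SmoothFamilyAt v s p := by
  refine ContDiffAt.congr_of_eventuallyEq h ?_
  filter_upwards [(tendsto_symm s p).eventually huv] with z hz
  have hz' : u z.1 ((extChartAt (𝓡 n) p).symm z.2) = v z.1 ((extChartAt (𝓡 n) p).symm z.2) := hz
  change (v z.1 _).compContinuousLinearMap _ = (u z.1 _).compContinuousLinearMap _
  rw [hz']

theorem SmoothFamilyAt.add {u v : P → Form n M k} {s : P} {p : M} (hu : SmoothFamilyAt u s p)
    (hv : SmoothFamilyAt v s p) : SmoothFamilyAt (fun r => u r + v r) s p :=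
  ContDiffAt.add hu hv

theorem SmoothFamilyAt.sub {u v : P → Form n M k} {s : P} {p : M} (hu : SmoothFamilyAt u s p)
    (hv : SmoothFamilyAt v s p) : SmoothFamilyAt (fun r => u r - v r) s p :=
  ContDiffAt.sub hu hv

theorem SmoothFamilyAt.neg {u : P → Form n M k} {s : P} {p : M} (hu : SmoothFamilyAt u s p) :
    SmoothFamilyAt (fun r => -u r) s p :=
  ContDiffAt.neg hu

theorem SmoothFamilyAt.smul {u : P → Form n M k} {c : P → ℝ} {s : P} {p : M}
    (hc : ContDiffAt ℝ ∞ c s) (hu : SmoothFamilyAt u s p) :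
    SmoothFamilyAt (fun r => c r • u r) s p :=
  ContDiffAt.smul (f := fun z : P × Vec n => c z.1) (g := fun z => chartRep (u z.1) p z.2)
    (ContDiffAt.comp (g := c) (f := fun z : P × Vec n => z.1) (s, extChartAt (𝓡 n) p p) hc
      contDiffAt_fst) hu

theorem SmoothFamilyAt.sum {α : Type*} {I : Finset α} {u : α → P → Form n M k} {s : P} {p : M}
    (hu : ∀ i ∈ I, SmoothFamilyAt (u i) s p) : SmoothFamilyAt (fun r => ∑ i ∈ I, u i r) s p := by
  classical
  induction I using Finset.induction_on with
  | empty => exact contDiffAt_const (c := (0 : Alt n k))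
  | insert a I ha ih =>
    simp only [Finset.sum_insert ha]
    exact (hu _ (Finset.mem_insert_self a I)).add
      (ih fun i hi => hu i (Finset.mem_insert_of_mem hi))

theorem SmoothFamilyAt.wedge {u : P → Form n M 1} {v : P → Form n M k} {s : P} {p : M}
    (hu : SmoothFamilyAt u s p) (hv : SmoothFamilyAt v s p) :
    SmoothFamilyAt (fun r x => CovPhase.wedge (u r x) (v r x)) s p := by
  have h : ContDiffAt ℝ ∞ (fun z : P × Vec n => wedgeL (chartRep (u z.1) p z.2)
      (chartRep (v z.1) p z.2)) (s, extChartAt (𝓡 n) p p) :=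
    ((wedgeL (n := n) (k := k)).contDiff.contDiffAt.comp (s, extChartAt (𝓡 n) p p) hu).clm_apply hv
  refine h.congr_of_eventuallyEq (Eventually.of_forall fun z => ?_)
  exact wedge_compContinuousLinearMap _ _ _

theorem SmoothFamilyAt.scalar_smul {u : P → Form n M 0} {v : P → Form n M k} {s : P} {p : M}
    (hu : SmoothFamilyAt u s p) (hv : SmoothFamilyAt v s p) :
    SmoothFamilyAt (fun r x => scalar (u r x) • v r x) s p := by
  have h : ContDiffAt ℝ ∞ (fun z : P × Vec n => scalarL (chartRep (u z.1) p z.2) •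
      chartRep (v z.1) p z.2) (s, extChartAt (𝓡 n) p p) :=
    ((scalarL (n := n)).contDiff.contDiffAt.comp (s, extChartAt (𝓡 n) p p) hu).smul hv
  refine h.congr_of_eventuallyEq (Eventually.of_forall fun z => ?_)
  have h2 : scalarL (chartRep (u z.1) p z.2) = scalar (u z.1 ((extChartAt (𝓡 n) p).symm z.2)) :=
    scalar_compContinuousLinearMap _ _
  exact (congrArg (fun c : ℝ => c • chartRep (v z.1) p z.2) h2).symm

variable [IsManifold (𝓡 n) ∞ M]

/-- `SmoothFamilyAt` tests smoothness only at the centre of a preferred chart; pullback along the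
smooth transition map carries it to any point of any other preferred chart. -/
theorem SmoothFamilyAt.chart {u : P → Form n M k} {s : P} {p : M} {y : Vec n}
    (hy : y ∈ (extChartAt (𝓡 n) p).target)
    (h : SmoothFamilyAt u s ((extChartAt (𝓡 n) p).symm y)) :
    ContDiffAt ℝ ∞ (fun z : P × Vec n => chartRep (u z.1) p z.2) (s, y) := by
  set q := (extChartAt (𝓡 n) p).symm y with hq
  have ho : y ∈ overlap p q := mem_overlap_symm hy
  have h1 : (fun z : P × Vec n => chartRep (u z.1) p z.2) =ᶠ[𝓝 (s, y)] fun z =>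
      (chartRep (u z.1) q (transMap p q z.2)).compContinuousLinearMap
        (fderiv ℝ (transMap p q) z.2) := by
    filter_upwards [continuousAt_snd.eventually ((isOpen_overlap p q).mem_nhds ho)] with z hz
    exact chartRep_trans _ hz
  refine ContDiffAt.congr_of_eventuallyEq ?_ h1
  refine contDiffAt_compContinuousLinearMap ?_ ?_
  · exact ContDiffAt.comp (g := fun z : P × Vec n => chartRep (u z.1) q z.2)
      (f := fun z : P × Vec n => (z.1, transMap p q z.2)) (s, y) h
      (contDiffAt_fst.prodMk (ContDiffAt.comp (g := transMap p q) (f := fun z : P × Vec n => z.2)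
        (s, y) (contDiffAt_transMap ho) contDiffAt_snd))
  · exact ContDiffAt.comp (g := fderiv ℝ (transMap p q)) (f := fun z : P × Vec n => z.2) (s, y)
      ((contDiffAt_transMap ho).fderiv_right (m := ∞) (by simp)) contDiffAt_snd

theorem SmAt.chart {w : Form n M k} {p : M} {y : Vec n} (hy : y ∈ (extChartAt (𝓡 n) p).target)
    (h : SmAt w ((extChartAt (𝓡 n) p).symm y)) : ContDiffAt ℝ ∞ (chartRep w p) y :=
  ContDiffAt.comp (g := fun z : ℝ × Vec n => chartRep w p z.2) (f := fun y => ((0 : ℝ), y)) y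
    ((h.const (0 : ℝ)).chart hy) (contDiffAt_const.prodMk contDiffAt_id)

theorem isSmooth_iff {w : Form n M k} : IsSmooth w ↔ ∀ x, SmAt w x := by
  refine ⟨fun h x => (h x).contDiffAt (target_mem_nhds x), fun h p y hy => ?_⟩
  exact ((h _).chart hy).contDiffWithinAt

theorem SmoothFamilyAt.iprod (X : DiffAlg n M) {u : P → Form n M (k + 1)} {s : P} {p : M}
    (hu : SmoothFamilyAt u s p) : SmoothFamilyAt (fun r => CovPhase.iprod X.field (u r)) s p := by
  have h : ContDiffAt ℝ ∞ (fun z : P × Vec n => (chartRep (u z.1) p z.2).curryLeft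
      (chartVec X.field p z.2)) (s, extChartAt (𝓡 n) p p) := by
    have h1 := ((ContinuousAlternatingMap.curryLeftLI (𝕜 := ℝ) (E := Vec n) (F := ℝ)
      (n := k)).toContinuousLinearMap).contDiff.contDiffAt.comp (n := ∞)
      (s, extChartAt (𝓡 n) p p) hu
    exact h1.clm_apply ((contDiffAt_chartVec X (mem_extChartAt_target p)).comp
      (s, extChartAt (𝓡 n) p p) contDiffAt_snd)
  refine h.congr_of_eventuallyEq ?_
  filter_upwards [eventually_target s p] with z hz
  exact chartRep_iprod _ _ hz

/-- Near the base point `d` is the alternation of the partial derivative, in the chart variable, of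
one jointly smooth function. Smooth dependence of `d` on the parameter follows. -/
theorem SmoothFamilyAt.chartRep_extD {u : P → Form n M k} {s : P} {p : M}
    (hu : SmoothFamilyAt u s p) : (fun z : P × Vec n => chartRep (CovPhase.extD (u z.1)) p z.2)
      =ᶠ[𝓝 (s, extChartAt (𝓡 n) p p)] fun z => alternatizeUncurryFinCLM ℝ (Vec n) ℝ
        (fderiv ℝ (fun z : P × Vec n => chartRep (u z.1) p z.2) z ∘L
          ContinuousLinearMap.inr ℝ P (Vec n)) := by
  have h1 : ContDiffAt ℝ 1 (fun z : P × Vec n => chartRep (u z.1) p z.2)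
      (s, extChartAt (𝓡 n) p p) := ContDiffAt.of_le hu (by simp)
  filter_upwards [h1.eventually (by simp), eventually_target s p] with z hz hz'
  have h2 : HasFDerivAt (chartRep (u z.1) p)
      (fderiv ℝ (fun z : P × Vec n => chartRep (u z.1) p z.2) z ∘L
        ContinuousLinearMap.inr ℝ P (Vec n)) z.2 :=
    HasFDerivAt.comp (g := fun z : P × Vec n => chartRep (u z.1) p z.2)
      (f := fun y => (z.1, y)) z.2 (hz.differentiableAt (by simp)).hasFDerivAt
      (hasFDerivAt_prodMk_right z.1 z.2)
  rw [CovPhase.chartRep_extD hz' h2.differentiableAt, extDeriv, h2.fderiv]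
  rfl

theorem SmoothFamilyAt.extD {u : P → Form n M k} {s : P} {p : M} (hu : SmoothFamilyAt u s p) :
    SmoothFamilyAt (fun r => CovPhase.extD (u r)) s p := by
  refine ContDiffAt.congr_of_eventuallyEq ?_ hu.chartRep_extD
  refine (alternatizeUncurryFinCLM ℝ (Vec n) ℝ).contDiff.contDiffAt.comp
    (s, extChartAt (𝓡 n) p p) ?_
  exact (ContDiffAt.fderiv_right (m := ∞) hu (by simp)).clm_comp contDiffAt_const

theorem SmoothFamilyAt.lieD (X : DiffAlg n M) {u : P → Form n M k} {s : P} {p : M}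
    (hu : SmoothFamilyAt u s p) : SmoothFamilyAt (fun r => CovPhase.lieD X.field (u r)) s p := by
  cases k with
  | zero => exact hu.extD.iprod X
  | succ k => exact (hu.extD.iprod X).add (hu.iprod X).extD

/-- The derivative of a family of forms with respect to the parameter. -/
def parDeriv (u : P → Form n M k) (v : P) (r : P) : Form n M k := fun x =>
  fderiv ℝ (fun r => u r x) r v

/-- Pullback by a linear automorphism. -/
def altPullEquiv (g : Vec n ≃L[ℝ] Vec n) : Alt n k ≃L[ℝ] Alt n k :=
  ContinuousLinearEquiv.equivOfInverse (altPull (g : Vec n →L[ℝ] Vec n))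
    (altPull (g.symm : Vec n →L[ℝ] Vec n))
    (fun w => by simpa using Lagrangian.pull_symm_alt g.symm w)
    (fun w => Lagrangian.pull_symm_alt g w)

/-- At a fixed point, passing to the chart is a linear automorphism independent of the parameter.
Since it is an equivalence, it commutes with `fderiv` with no differentiability assumption. -/
theorem chartRep_parDeriv (u : P → Form n M k) (v r : P) {p : M} {y : Vec n}
    (hy : y ∈ (extChartAt (𝓡 n) p).target) :
    chartRep (parDeriv u v r) p y = fderiv ℝ (fun r => chartRep (u r) p y) r v := by
  have ho := mem_overlap_symm hy
  have h : (fun r => chartRep (u r) p y) = fun r =>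
      (altPullEquiv (k := k) (transEquiv ho))
        (u r ((extChartAt (𝓡 n) p).symm y)) := by
    funext r
    exact chartRep_apply _ hy
  have h2 := ContinuousLinearEquiv.comp_fderiv
    (altPullEquiv (k := k) (transEquiv ho))
    (f := fun r => u r ((extChartAt (𝓡 n) p).symm y)) (x := r)
  rw [h]
  refine Eq.trans ?_ (DFunLike.congr_fun h2 v).symm
  exact chartRep_apply _ hy

theorem SmoothFamilyAt.chartRep_parDeriv {u : P → Form n M k} {s : P} {p : M} (v : P)
    (hu : SmoothFamilyAt u s p) :
    (fun z : P × Vec n => chartRep (CovPhase.parDeriv u v z.1) p z.2)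
      =ᶠ[𝓝 (s, extChartAt (𝓡 n) p p)] fun z =>
        fderiv ℝ (fun z : P × Vec n => chartRep (u z.1) p z.2) z (v, 0) := by
  have h1 : ContDiffAt ℝ 1 (fun z : P × Vec n => chartRep (u z.1) p z.2)
      (s, extChartAt (𝓡 n) p p) := ContDiffAt.of_le hu (by simp)
  filter_upwards [h1.eventually (by simp), eventually_target s p] with z hz hz'
  have h2 : HasFDerivAt (fun r => chartRep (u r) p z.2)
      (fderiv ℝ (fun z : P × Vec n => chartRep (u z.1) p z.2) z ∘L
        ContinuousLinearMap.inl ℝ P (Vec n)) z.1 :=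
    HasFDerivAt.comp (g := fun z : P × Vec n => chartRep (u z.1) p z.2)
      (f := fun r => (r, z.2)) z.1 (hz.differentiableAt (by simp)).hasFDerivAt
      (hasFDerivAt_prodMk_left z.1 z.2)
  rw [CovPhase.chartRep_parDeriv u v z.1 hz', h2.fderiv]
  rfl

theorem SmoothFamilyAt.parDeriv {u : P → Form n M k} {s : P} {p : M} (v : P)
    (hu : SmoothFamilyAt u s p) : SmoothFamilyAt (CovPhase.parDeriv u v) s p :=
  ContDiffAt.congr_of_eventuallyEq
    ((ContDiffAt.fderiv_right (m := ∞) hu (by simp)).clm_apply contDiffAt_const)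
    (hu.chartRep_parDeriv v)

theorem SmoothFamilyAt.differentiableAt {u : P → Form n M k} {s : P} {p : M}
    (hu : SmoothFamilyAt u s p) : DifferentiableAt ℝ (fun r => u r p) s := by
  have h : (fun r => u r p) = fun r => chartRep (u r) p (extChartAt (𝓡 n) p p) := by
    funext r
    rw [chartRep_self]
  rw [h]
  exact DifferentiableAt.comp (g := fun z : P × Vec n => chartRep (u z.1) p z.2)
    (f := fun r => (r, extChartAt (𝓡 n) p p)) s (ContDiffAt.differentiableAt hu (by simp))
    (differentiableAt_id.prodMk (differentiableAt_const _))

/-- Differentiation in the parameter commutes with the de Rham differential. -/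
theorem SmoothFamilyAt.extD_parDeriv {u : P → Form n M k} {s : P} {p : M} (v : P)
    (hu : SmoothFamilyAt u s p) :
    CovPhase.extD (CovPhase.parDeriv u v s) p =
      CovPhase.parDeriv (fun r => CovPhase.extD (u r)) v s p := by
  set G := fun z : P × Vec n => chartRep (u z.1) p z.2 with hG
  set c := extChartAt (𝓡 n) p p with hc
  have hG' : ContDiffAt ℝ ∞ G (s, c) := hu
  have hd : DifferentiableAt ℝ (fderiv ℝ G) (s, c) :=
    (hG'.fderiv_right (m := ∞) (by simp)).differentiableAt (by simp)
  -- The two orders of differentiation are mixed second derivatives of the same function `G` in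
  -- parameter and chart variable.
  have hsymm := hG'.isSymmSndFDerivAt (by
    rw [minSmoothness_of_isRCLikeNormedField]
    exact WithTop.coe_le_coe.2 (le_top : (2 : ℕ∞) ≤ ⊤))
  have e1 : chartRep (CovPhase.parDeriv u v s) p =ᶠ[𝓝 c] fun y => fderiv ℝ G (s, y) (v, 0) := by
    have hcont : Tendsto (fun y : Vec n => (s, y)) (𝓝 c) (𝓝 (s, c)) :=
      (continuousAt_const.prodMk continuousAt_id).tendsto
    exact hcont.eventually (hu.chartRep_parDeriv v)
  have e2 : (fun r => CovPhase.extD (u r) p) =ᶠ[𝓝 s] fun r =>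
      alternatizeUncurryFinCLM ℝ (Vec n) ℝ (fderiv ℝ G (r, c) ∘L
        ContinuousLinearMap.inr ℝ P (Vec n)) := by
    have hcont : Tendsto (fun r : P => (r, c)) (𝓝 s) (𝓝 (s, c)) :=
      (continuousAt_id.prodMk continuousAt_const).tendsto
    filter_upwards [hcont.eventually hu.chartRep_extD] with r hr
    rw [← hr, hc, chartRep_self]
  have d1 : HasFDerivAt (fun y => fderiv ℝ G (s, y) (v, 0))
      ((ContinuousLinearMap.apply ℝ (Alt n k) ((v, 0) : P × Vec n)) ∘L
        (fderiv ℝ (fderiv ℝ G) (s, c) ∘L ContinuousLinearMap.inr ℝ P (Vec n))) c :=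
    ((ContinuousLinearMap.apply ℝ (Alt n k) ((v, 0) : P × Vec n)).hasFDerivAt).comp c
      (HasFDerivAt.comp (g := fderiv ℝ G) (f := fun y => (s, y)) c hd.hasFDerivAt
        (hasFDerivAt_prodMk_right s c))
  have d2 : HasFDerivAt (fun r => alternatizeUncurryFinCLM ℝ (Vec n) ℝ (fderiv ℝ G (r, c) ∘L
        ContinuousLinearMap.inr ℝ P (Vec n)))
      ((alternatizeUncurryFinCLM ℝ (Vec n) ℝ) ∘L
        ((ContinuousLinearMap.compL ℝ (Vec n) (P × Vec n) (Alt n k)).flip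
          (ContinuousLinearMap.inr ℝ P (Vec n))) ∘L
        (fderiv ℝ (fderiv ℝ G) (s, c) ∘L ContinuousLinearMap.inl ℝ P (Vec n))) s :=
    (ContinuousLinearMap.hasFDerivAt _).comp s (((ContinuousLinearMap.compL ℝ (Vec n)
        (P × Vec n) (Alt n k)).flip (ContinuousLinearMap.inr ℝ P (Vec n))).hasFDerivAt.comp s
      (HasFDerivAt.comp (g := fderiv ℝ G) (f := fun r => (r, c)) s hd.hasFDerivAt
        (hasFDerivAt_prodMk_left s c)))
  rw [extD_apply, e1.extDeriv_eq, extDeriv, d1.fderiv, CovPhase.parDeriv, e2.fderiv_eq, d2.fderiv]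
  change _ = alternatizeUncurryFin _
  congr 1
  ext1 y
  exact hsymm _ _

end Families

/-! ### Cartan calculus on the manifold -/

section Cartan

open ContinuousAlternatingMap (alternatizeUncurryFin)

variable {n k : ℕ} {M : Type*} [TopologicalSpace M] [ChartedSpace (Vec n) M]

/-- Differentiate `g^*(α ∧ w) = g^*α ∧ g^*w` in `g` at the identity and compare by uniqueness of
derivatives. -/
theorem lieAct_wedge (T : Vec n →L[ℝ] Vec n) (α : Alt n 1) (w : Alt n k) :
    lieAct T (wedge α w) = wedge (lieAct T α) w + wedge α (lieAct T w) := by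
  have h := (((wedgeL (n := n) (k := k)).hasFDerivAt.comp _
    (hasFDerivAt_compContinuousLinearMap_id α)).clm_apply
      (hasFDerivAt_compContinuousLinearMap_id w)).congr_of_eventuallyEq
        (Eventually.of_forall fun g => wedge_compContinuousLinearMap α w g)
  exact (DFunLike.congr_fun ((hasFDerivAt_compContinuousLinearMap_id (wedge α w)).unique h) T).trans
    (add_comm (wedge α (lieAct T w)) (wedge (lieAct T α) w))

theorem lieAct_smul (T : Vec n →L[ℝ] Vec n) (c : ℝ) (w : Alt n k) :
    lieAct T (c • w) = c • lieAct T w := by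
  have h := (hasFDerivAt_compContinuousLinearMap_id w).const_smul c
  exact DFunLike.congr_fun ((hasFDerivAt_compContinuousLinearMap_id (c • w)).unique h) T

theorem locLie_congr {X : Vec n → Vec n} {w v : Vec n → Alt n k} {y : Vec n} (h : w =ᶠ[𝓝 y] v) :
    locLie X w y = locLie X v y := by
  rw [locLie, locLie, h.fderiv_eq, h.eq_of_nhds]

theorem locLie_wedge {X : Vec n → Vec n} {α : Vec n → Alt n 1} {w : Vec n → Alt n k} {y : Vec n}
    (hα : DifferentiableAt ℝ α y) (hw : DifferentiableAt ℝ w y) :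
    locLie X (fun z => wedge (α z) (w z)) y =
      wedge (locLie X α y) (w y) + wedge (α y) (locLie X w y) := by
  have h : HasFDerivAt (fun z => wedge (α z) (w z))
      (wedgeL (α y) ∘L fderiv ℝ w y + wedgeL.flip (w y) ∘L fderiv ℝ α y) y :=
    (((wedgeL (n := n) (k := k)).hasFDerivAt.comp y hα.hasFDerivAt).clm_apply
      hw.hasFDerivAt).congr_fderiv rfl
  rw [locLie, h.fderiv, lieAct_wedge, locLie, locLie, add_wedge, wedge_add]
  change wedge (α y) (fderiv ℝ w y (X y)) + wedge (fderiv ℝ α y (X y)) (w y) + _ = _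
  abel

theorem locLie_scalar_smul {X : Vec n → Vec n} {f : Vec n → Alt n 0} {w : Vec n → Alt n k}
    {y : Vec n} (hf : DifferentiableAt ℝ f y) (hw : DifferentiableAt ℝ w y) :
    locLie X (fun z => scalar (f z) • w z) y =
      scalar (locLie X f y) • w y + scalar (f y) • locLie X w y := by
  have h : HasFDerivAt (fun z => scalar (f z) • w z)
      (scalar (f y) • fderiv ℝ w y + (scalarL ∘L fderiv ℝ f y).smulRight (w y)) y :=
    (scalarL.hasFDerivAt.comp y hf.hasFDerivAt).smul hw.hasFDerivAt
  rw [locLie, h.fderiv, lieAct_smul, locLie, locLie, lieAct_zero_form, add_zero, smul_add]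
  change scalar (f y) • fderiv ℝ w y (X y) + scalar (fderiv ℝ f y (X y)) • w y + _ = _
  abel

theorem SmAt.differentiableAt {w : Form n M k} {x : M} (h : SmAt w x) :
    DifferentiableAt ℝ (chartRep w x) (extChartAt (𝓡 n) x x) :=
  ContDiffAt.differentiableAt h (by simp)

variable [IsManifold (𝓡 n) ∞ M]

theorem extD_add_apply {w v : Form n M k} {x : M} (hw : SmAt w x) (hv : SmAt v x) :
    extD (w + v) x = extD w x + extD v x := by
  rw [extD_apply, extD_apply, extD_apply]
  exact extDeriv_add hw.differentiableAt hv.differentiableAt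

theorem extD_smul (c : ℝ) (w : Form n M k) : extD (c • w) = c • extD w := by
  funext x
  rw [Pi.smul_apply, extD_apply, extD_apply]
  exact extDeriv_smul c (chartRep w x)

theorem lieD_apply (X : DiffAlg n M) {w : Form n M k} {x : M} (hw : SmAt w x) :
    lieD X.field w x =
      locLie (chartVec X.field x) (chartRep w x) (extChartAt (𝓡 n) x x) := by
  cases k with
  | zero =>
    rw [← extDeriv_curryLeft_zero, ← extD_apply, chartVec_self]
    rfl
  | succ k =>
    have hX := contDiffAt_chartVec X (mem_extChartAt_target (I := 𝓡 n) x)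
    rw [← extDeriv_curryLeft hw.differentiableAt (hX.differentiableAt (by simp)), ← extD_apply,
      chartVec_self]
    change (extD w x).curryLeft (X.field x) + extD (iprod X.field w) x = _
    congr 1
    rw [extD_apply]
    refine Filter.EventuallyEq.extDeriv_eq ?_
    filter_upwards [target_mem_nhds x] with z hz
    exact chartRep_iprod _ _ hz

theorem extD_extD_apply {w : Form n M k} {x : M} (hw : SmAt w x) : extD (extD w) x = 0 := by
  rw [extD_apply, (chartRep_extD_eventually (mem_extChartAt_target x) hw).extDeriv_eq]
  exact extDeriv_extDeriv_apply hw (by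
    rw [minSmoothness_of_isRCLikeNormedField]
    exact WithTop.coe_le_coe.2 (le_top : (2 : ℕ∞) ≤ ⊤))

/-- This is `[𝔏_X, ι_Y] = ι_{[X, Y]}` for the bracket of vector fields; the sign is reversed by the
bracket of `𝔡𝔦𝔣𝔣(M)`. -/
theorem lieD_iprod_apply (X Y : DiffAlg n M) {w : Form n M (k + 1)} {x : M} (hw : SmAt w x) :
    lieD X.field (iprod Y.field w) x =
      iprod Y.field (lieD X.field w) x - iprod ⁅X, Y⁆.field w x := by
  have hc := mem_extChartAt_target (I := 𝓡 n) x
  have h1 : SmAt (iprod Y.field w) x := ((hw.const (0 : ℝ)).iprod Y).smAt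
  have h2 : chartRep (iprod Y.field w) x =ᶠ[𝓝 (extChartAt (𝓡 n) x x)] fun z =>
      (chartRep w x z).curryLeft (chartVec Y.field x z) := by
    filter_upwards [target_mem_nhds x] with z hz
    exact chartRep_iprod _ _ hz
  rw [lieD_apply X h1, locLie_congr h2, locLie_curryLeft hw.differentiableAt
    ((contDiffAt_chartVec Y hc).differentiableAt (by simp)), ← lieD_apply X hw, chartVec_self,
    chartRep_self, iprod, iprod, bracket_apply, map_neg]
  exact (sub_neg_eq_add _ _).symm

theorem lieD_wedge_apply (X : DiffAlg n M) {α : Form n M 1} {w : Form n M k} {x : M}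
    (hα : SmAt α x) (hw : SmAt w x) :
    lieD X.field (fun y => wedge (α y) (w y)) x =
      wedge (lieD X.field α x) (w x) + wedge (α x) (lieD X.field w x) := by
  have h1 : SmAt (fun y => wedge (α y) (w y)) x :=
    ((hα.const (0 : ℝ)).wedge (hw.const (0 : ℝ))).smAt
  have h2 : chartRep (fun y => wedge (α y) (w y)) x = fun z =>
      wedge (chartRep α x z) (chartRep w x z) := by
    funext z
    exact wedge_compContinuousLinearMap _ _ _
  rw [lieD_apply X h1, h2, locLie_wedge hα.differentiableAt hw.differentiableAt,
    ← lieD_apply X hα, ← lieD_apply X hw, chartRep_self, chartRep_self]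

theorem chartRep_scalar_smul (f : Form n M 0) (w : Form n M k) (x : M) :
    chartRep (fun y => scalar (f y) • w y) x = fun z =>
      scalar (chartRep f x z) • chartRep w x z := by
  funext z
  have h : scalar (chartRep f x z) = scalar (f ((extChartAt (𝓡 n) x).symm z)) :=
    scalar_compContinuousLinearMap _ _
  rw [h]
  rfl

theorem lieD_scalar_smul_apply (X : DiffAlg n M) {f : Form n M 0} {w : Form n M k} {x : M}
    (hf : SmAt f x) (hw : SmAt w x) :
    lieD X.field (fun y => scalar (f y) • w y) x =
      scalar (lieD X.field f x) • w x + scalar (f x) • lieD X.field w x := by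
  have h1 : SmAt (fun y => scalar (f y) • w y) x :=
    ((hf.const (0 : ℝ)).scalar_smul (hw.const (0 : ℝ))).smAt
  rw [lieD_apply X h1, chartRep_scalar_smul, locLie_scalar_smul hf.differentiableAt
    hw.differentiableAt, ← lieD_apply X hf, ← lieD_apply X hw, chartRep_self, chartRep_self]

theorem extD_scalar_smul_apply {f : Form n M 0} {w : Form n M k} {x : M}
    (hf : SmAt f x) (hw : SmAt w x) :
    extD (fun y => scalar (f y) • w y) x = wedge (extD f x) (w x) + scalar (f x) • extD w x := by
  rw [extD_apply, chartRep_scalar_smul, extDeriv_scalar_smul hf.differentiableAt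
    hw.differentiableAt, ← extD_apply, ← extD_apply, chartRep_self, chartRep_self]

/-! Smooth forms. -/

theorem IsSmooth.const {w : Form n M k} (h : IsSmooth w) {P : Type*} [NormedAddCommGroup P]
    [NormedSpace ℝ P] (s : P) (x : M) : SmoothFamilyAt (fun _ => w) s x :=
  (isSmooth_iff.1 h x).const s

/-- Smooth forms are treated as constant families, so that their closure properties are inherited
from those of smooth families. -/
theorem IsSmooth.of_const {w : Form n M k}
    (h : ∀ x, SmoothFamilyAt (fun _ : ℝ => w) 0 x) : IsSmooth w :=
  isSmooth_iff.2 fun x => (h x).smAt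

theorem IsSmooth.smAt {w : Form n M k} (h : IsSmooth w) (x : M) : SmAt w x := isSmooth_iff.1 h x

theorem IsSmooth.add {w v : Form n M k} (hw : IsSmooth w) (hv : IsSmooth v) : IsSmooth (w + v) :=
  .of_const fun x => (hw.const _ x).add (hv.const _ x)

theorem IsSmooth.sub {w v : Form n M k} (hw : IsSmooth w) (hv : IsSmooth v) : IsSmooth (w - v) :=
  .of_const fun x => (hw.const _ x).sub (hv.const _ x)

theorem IsSmooth.neg {w : Form n M k} (hw : IsSmooth w) : IsSmooth (-w) :=
  .of_const fun x => (hw.const _ x).neg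

theorem IsSmooth.smul (c : ℝ) {w : Form n M k} (hw : IsSmooth w) : IsSmooth (c • w) :=
  .of_const fun x => .smul contDiffAt_const (hw.const _ x)

theorem IsSmooth.extD {w : Form n M k} (hw : IsSmooth w) : IsSmooth (extD w) :=
  .of_const fun x => (hw.const _ x).extD

theorem IsSmooth.iprod (X : DiffAlg n M) {w : Form n M (k + 1)} (hw : IsSmooth w) :
    IsSmooth (iprod X.field w) :=
  .of_const fun x => (hw.const _ x).iprod X

theorem IsSmooth.lieD (X : DiffAlg n M) {w : Form n M k} (hw : IsSmooth w) :
    IsSmooth (lieD X.field w) :=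
  .of_const fun x => (hw.const _ x).lieD X

theorem extD_add {w v : Form n M k} (hw : IsSmooth w) (hv : IsSmooth v) :
    extD (w + v) = extD w + extD v :=
  funext fun x => extD_add_apply (hw.smAt x) (hv.smAt x)

theorem extD_neg (w : Form n M k) : extD (-w) = -extD w := by
  simpa using extD_smul (-1) w

theorem extD_sub {w v : Form n M k} (hw : IsSmooth w) (hv : IsSmooth v) :
    extD (w - v) = extD w - extD v := by
  rw [sub_eq_add_neg, extD_add hw hv.neg, extD_neg, ← sub_eq_add_neg]

theorem extD_zero : extD (0 : Form n M k) = 0 := by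
  simpa using extD_smul 0 (0 : Form n M k)

theorem extD_extD {w : Form n M k} (hw : IsSmooth w) : extD (extD w) = 0 :=
  funext fun x => extD_extD_apply (hw.smAt x)

theorem iprod_add (X : ∀ x : M, TangentSpace (𝓡 n) x) (w v : Form n M (k + 1)) :
    iprod X (w + v) = iprod X w + iprod X v := rfl

theorem iprod_smul (X : ∀ x : M, TangentSpace (𝓡 n) x) (c : ℝ) (w : Form n M (k + 1)) :
    iprod X (c • w) = c • iprod X w := rfl

theorem iprod_zero (X : ∀ x : M, TangentSpace (𝓡 n) x) : iprod X (0 : Form n M (k + 1)) = 0 := rfl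

theorem iprod_add_field (X Y : ∀ x : M, TangentSpace (𝓡 n) x) (w : Form n M (k + 1)) :
    iprod (X + Y) w = iprod X w + iprod Y w := by
  funext x
  exact map_add (w x).curryLeft (X x) (Y x)

theorem iprod_smul_field (c : ℝ) (X : ∀ x : M, TangentSpace (𝓡 n) x) (w : Form n M (k + 1)) :
    iprod (c • X) w = c • iprod X w := by
  funext x
  exact map_smul (w x).curryLeft c (X x)

theorem iprod_swap (X Y : ∀ x : M, TangentSpace (𝓡 n) x) (w : Form n M (k + 2)) :
    iprod X (iprod Y w) = -iprod Y (iprod X w) :=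
  funext fun x => curryLeft_swap (w x) (Y x) (X x)

theorem lieD_succ (X : ∀ x : M, TangentSpace (𝓡 n) x) (w : Form n M (k + 1)) :
    lieD X w = iprod X (extD w) + extD (iprod X w) := rfl

theorem lieD_zero_form (X : ∀ x : M, TangentSpace (𝓡 n) x) (w : Form n M 0) :
    lieD X w = iprod X (extD w) := rfl

theorem lieD_add (X : DiffAlg n M) {w v : Form n M k} (hw : IsSmooth w) (hv : IsSmooth v) :
    lieD X.field (w + v) = lieD X.field w + lieD X.field v := by
  cases k with
  | zero => rw [lieD_zero_form, extD_add hw hv]; rfl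
  | succ k =>
    rw [lieD_succ, extD_add hw hv, iprod_add, iprod_add, extD_add (hw.iprod X) (hv.iprod X),
      lieD_succ, lieD_succ]
    abel

theorem lieD_smul (X : ∀ x : M, TangentSpace (𝓡 n) x) (c : ℝ) (w : Form n M k) :
    lieD X (c • w) = c • lieD X w := by
  cases k with
  | zero => rw [lieD_zero_form, extD_smul]; rfl
  | succ k =>
    rw [lieD_succ, extD_smul, iprod_smul, iprod_smul, extD_smul, lieD_succ, smul_add]

theorem lieD_neg (X : ∀ x : M, TangentSpace (𝓡 n) x) (w : Form n M k) :
    lieD X (-w) = -lieD X w := by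
  simpa using lieD_smul X (-1) w

theorem lieD_sub (X : DiffAlg n M) {w v : Form n M k} (hw : IsSmooth w) (hv : IsSmooth v) :
    lieD X.field (w - v) = lieD X.field w - lieD X.field v := by
  rw [sub_eq_add_neg, lieD_add X hw hv.neg, lieD_neg, ← sub_eq_add_neg]

theorem lieD_add_field (X Y : DiffAlg n M) {w : Form n M k} (hw : IsSmooth w) :
    lieD (X + Y).field w = lieD X.field w + lieD Y.field w := by
  cases k with
  | zero => rw [lieD_zero_form, DiffAlg.add_field, iprod_add_field]; rfl
  | succ k =>
    rw [lieD_succ, DiffAlg.add_field, iprod_add_field, iprod_add_field,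
      extD_add (hw.iprod X) (hw.iprod Y), lieD_succ, lieD_succ]
    abel

theorem lieD_smul_field (c : ℝ) (X : ∀ x : M, TangentSpace (𝓡 n) x) (w : Form n M k) :
    lieD (c • X) w = c • lieD X w := by
  cases k with
  | zero => rw [lieD_zero_form, iprod_smul_field]; rfl
  | succ k =>
    rw [lieD_succ, iprod_smul_field, iprod_smul_field, extD_smul, lieD_succ, smul_add]

theorem extD_lieD_apply (X : DiffAlg n M) {w : Form n M k} {x : M} (hw : SmAt w x) :
    extD (lieD X.field w) x = lieD X.field (extD w) x := by
  have h0 := hw.const (0 : ℝ)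
  have hd : SmAt (extD (iprod X.field (extD w))) x := ((h0.extD.iprod X).extD).smAt
  have h1 : iprod X.field (extD (extD w)) x = 0 := by
    rw [iprod, extD_extD_apply hw]
    rfl
  rw [lieD_succ, Pi.add_apply, h1, zero_add]
  cases k with
  | zero => rfl
  | succ k =>
    rw [lieD_succ, extD_add_apply (h0.extD.iprod X).smAt (h0.iprod X).extD.smAt,
      extD_extD_apply (h0.iprod X).smAt, add_zero]

theorem extD_lieD (X : DiffAlg n M) {w : Form n M k} (hw : IsSmooth w) :
    extD (lieD X.field w) = lieD X.field (extD w) :=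
  funext fun x => extD_lieD_apply X (hw.smAt x)

theorem lieD_iprod (X Y : DiffAlg n M) {w : Form n M (k + 1)} (hw : IsSmooth w) :
    lieD X.field (iprod Y.field w) = iprod Y.field (lieD X.field w) - iprod ⁅X, Y⁆.field w :=
  funext fun x => lieD_iprod_apply X Y (hw.smAt x)

theorem lieD_lieD (X Y : DiffAlg n M) {w : Form n M k} (hw : IsSmooth w) :
    lieD X.field (lieD Y.field w) = lieD Y.field (lieD X.field w) - lieD ⁅X, Y⁆.field w := by
  cases k with
  | zero =>
    rw [lieD_zero_form Y.field w, lieD_iprod X Y hw.extD, ← extD_lieD X hw]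
    rfl
  | succ k =>
    rw [lieD_succ Y.field w, lieD_add X (hw.extD.iprod Y) (hw.iprod Y).extD,
      lieD_iprod X Y hw.extD, ← extD_lieD X hw, ← extD_lieD X (hw.iprod Y), lieD_iprod X Y hw,
      extD_sub ((hw.lieD X).iprod Y) (hw.iprod _), lieD_succ Y.field (lieD X.field w),
      lieD_succ ⁅X, Y⁆.field w]
    abel

end Cartan

/-! ### Natural functions of the fields -/

section Natural

open ContinuousAlternatingMap (alternatizeUncurryFin)

variable {m k : ℕ} {ι κ : Type*} [Fintype ι] [Fintype κ]
  {M : Type*} [TopologicalSpace M] [ChartedSpace (Vec (m + 2)) M]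
  {P P' : Type*} [NormedAddCommGroup P] [NormedSpace ℝ P] [NormedAddCommGroup P']
  [NormedSpace ℝ P']

/-- Smooth form-valued functions of the field values that commute with changes of frame. -/
structure Lagrangian.IsNatural (L : Lagrangian m ι κ) (F : Jet m ι κ → Alt (m + 2) k) : Prop where
  pull : ∀ (g : Vec (m + 2) ≃L[ℝ] Vec (m + 2)), ∀ j ∈ L.dom,
    F (j.pull g) = (F j).compContinuousLinearMap (g : Vec (m + 2) →L[ℝ] Vec (m + 2))
  smooth : ∀ j ∈ L.dom, ContDiffAt ℝ ∞ F j

/-- Smoothness of a family of field configurations near a point. -/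
def FieldsAt (u : P → Fields m ι κ M) (s : P) (p : M) : Prop :=
  (∀ a, SmoothFamilyAt (fun r => (u r).1 a) s p) ∧ ∀ b, SmoothFamilyAt (fun r => (u r).2 b) s p

theorem smoothFamily_iff {u : P → Fields m ι κ M} :
    SmoothFamily u ↔ ∀ s p, FieldsAt u s p :=
  ⟨fun h s p => ⟨fun a => h.1 a s p, fun b => h.2 b s p⟩,
    fun h => ⟨fun a s p => (h s p).1 a, fun b s p => (h s p).2 b⟩⟩

/-- The field values in the chart at `p`. -/
def jetRep (φ : Fields m ι κ M) (p : M) (y : Vec (m + 2)) : Jet m ι κ :=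
  (fun a => chartRep (φ.1 a) p y, fun b => chartRep (φ.2 b) p y,
    fun a => chartRep (extD (φ.1 a)) p y, fun b => chartRep (extD (φ.2 b)) p y)

theorem FieldsAt.comp {u : P → Fields m ι κ M} {f : P' → P} {s : P'} {p : M}
    (h : FieldsAt u (f s) p) (hf : ContDiffAt ℝ ∞ f s) : FieldsAt (fun r => u (f r)) s p :=
  ⟨fun a => (h.1 a).comp hf, fun b => (h.2 b).comp hf⟩

theorem FieldsAt.add {u v : P → Fields m ι κ M} {s : P} {p : M}
    (hu : FieldsAt u s p) (hv : FieldsAt v s p) : FieldsAt (fun r => u r + v r) s p :=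
  ⟨fun a => (hu.1 a).add (hv.1 a), fun b => (hu.2 b).add (hv.2 b)⟩

theorem FieldsAt.smul {c : P → ℝ} {u : P → Fields m ι κ M} {s : P} {p : M}
    (hc : ContDiffAt ℝ ∞ c s) (hu : FieldsAt u s p) : FieldsAt (fun r => c r • u r) s p :=
  ⟨fun a => (hu.1 a).smul hc, fun b => (hu.2 b).smul hc⟩

variable [IsManifold (𝓡 (m + 2)) ∞ M]

theorem smoothFields_iff {φ : Fields m ι κ M} :
    SmoothFields φ ↔ SmoothFamily (fun _ : ℝ => φ) :=
  ⟨fun h => ⟨fun a s p => (h.1 a).const s p, fun b s p => (h.2 b).const s p⟩,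
    fun h => ⟨fun a => .of_const fun x => h.1 a 0 x, fun b => .of_const fun x => h.2 b 0 x⟩⟩

theorem SmoothFields.const {φ : Fields m ι κ M} (h : SmoothFields φ) (s : P) (p : M) :
    FieldsAt (fun _ => φ) s p :=
  ⟨fun a => (h.1 a).const s p, fun b => (h.2 b).const s p⟩

theorem SmoothFields.add {φ ψ : Fields m ι κ M} (hφ : SmoothFields φ) (hψ : SmoothFields ψ) :
    SmoothFields (φ + ψ) :=
  ⟨fun a => (hφ.1 a).add (hψ.1 a), fun b => (hφ.2 b).add (hψ.2 b)⟩

theorem SmoothFields.sub {φ ψ : Fields m ι κ M} (hφ : SmoothFields φ) (hψ : SmoothFields ψ) :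
    SmoothFields (φ - ψ) :=
  ⟨fun a => (hφ.1 a).sub (hψ.1 a), fun b => (hφ.2 b).sub (hψ.2 b)⟩

theorem SmoothFields.smul (c : ℝ) {φ : Fields m ι κ M} (hφ : SmoothFields φ) :
    SmoothFields (c • φ) :=
  ⟨fun a => (hφ.1 a).smul c, fun b => (hφ.2 b).smul c⟩

theorem SmoothFields.vert (X : DiffAlg (m + 2) M) {φ : Fields m ι κ M} (hφ : SmoothFields φ) :
    SmoothFields (vert X.field φ) :=
  ⟨fun a => (hφ.1 a).lieD X, fun b => (hφ.2 b).lieD X⟩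

theorem FieldsAt.vert (X : DiffAlg (m + 2) M) {u : P → Fields m ι κ M} {s : P} {p : M}
    (hu : FieldsAt u s p) : FieldsAt (fun r => CovPhase.vert X.field (u r)) s p :=
  ⟨fun a => (hu.1 a).lieD X, fun b => (hu.2 b).lieD X⟩

theorem vert_add (X : DiffAlg (m + 2) M) {φ ψ : Fields m ι κ M} (hφ : SmoothFields φ)
    (hψ : SmoothFields ψ) : vert X.field (φ + ψ) = vert X.field φ + vert X.field ψ :=
  Prod.ext (funext fun a => lieD_add X (hφ.1 a) (hψ.1 a))
    (funext fun b => lieD_add X (hφ.2 b) (hψ.2 b))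

theorem vert_smul (X : ∀ x : M, TangentSpace (𝓡 (m + 2)) x) (c : ℝ) (φ : Fields m ι κ M) :
    vert X (c • φ) = c • vert X φ :=
  Prod.ext (funext fun a => lieD_smul X c (φ.1 a)) (funext fun b => lieD_smul X c (φ.2 b))

theorem vert_add_field (X Y : DiffAlg (m + 2) M) {φ : Fields m ι κ M} (hφ : SmoothFields φ) :
    vert (X + Y).field φ = vert X.field φ + vert Y.field φ :=
  Prod.ext (funext fun a => lieD_add_field X Y (hφ.1 a))
    (funext fun b => lieD_add_field X Y (hφ.2 b))

theorem vert_smul_field (c : ℝ) (X : ∀ x : M, TangentSpace (𝓡 (m + 2)) x) (φ : Fields m ι κ M) :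
    vert (c • X) φ = c • vert X φ :=
  Prod.ext (funext fun a => lieD_smul_field c X (φ.1 a))
    (funext fun b => lieD_smul_field c X (φ.2 b))

theorem vert_vert (X Y : DiffAlg (m + 2) M) {φ : Fields m ι κ M} (hφ : SmoothFields φ) :
    vert X.field (vert Y.field φ) = vert Y.field (vert X.field φ) - vert ⁅X, Y⁆.field φ :=
  Prod.ext (funext fun a => lieD_lieD X Y (hφ.1 a)) (funext fun b => lieD_lieD X Y (hφ.2 b))

theorem jet_add {φ ψ : Fields m ι κ M} (hφ : SmoothFields φ) (hψ : SmoothFields ψ) (x : M) :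
    jet (φ + ψ) x = jet φ x + jet ψ x :=
  Prod.ext rfl (Prod.ext rfl (Prod.ext
    (funext fun a => congrFun (extD_add (hφ.1 a) (hψ.1 a)) x)
    (funext fun b => congrFun (extD_add (hφ.2 b) (hψ.2 b)) x)))

theorem jet_smul (c : ℝ) (φ : Fields m ι κ M) (x : M) : jet (c • φ) x = c • jet φ x :=
  Prod.ext rfl (Prod.ext rfl (Prod.ext (funext fun a => congrFun (extD_smul c (φ.1 a)) x)
    (funext fun b => congrFun (extD_smul c (φ.2 b)) x)))

theorem jetRep_eq (φ : Fields m ι κ M) {p : M} {y : Vec (m + 2)}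
    (hy : y ∈ (extChartAt (𝓡 (m + 2)) p).target) :
    jetRep φ p y = (jet φ ((extChartAt (𝓡 (m + 2)) p).symm y)).pull
      (transEquiv (mem_overlap_symm hy)) := by
  unfold jetRep
  simp only [chartRep_apply _ hy]
  rfl

theorem jetRep_self (φ : Fields m ι κ M) (p : M) :
    jetRep φ p (extChartAt (𝓡 (m + 2)) p p) = jet φ p := by
  unfold jetRep
  simp only [chartRep_self]
  rfl

theorem FieldsAt.contDiffAt_jetRep {u : P → Fields m ι κ M} {s : P} {p : M}
    (hu : FieldsAt u s p) : ContDiffAt ℝ ∞ (fun z : P × Vec (m + 2) => jetRep (u z.1) p z.2)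
      (s, extChartAt (𝓡 (m + 2)) p p) :=
  (contDiffAt_pi.2 fun a => hu.1 a).prodMk ((contDiffAt_pi.2 fun b => hu.2 b).prodMk
    ((contDiffAt_pi.2 fun a => (hu.1 a).extD).prodMk (contDiffAt_pi.2 fun b => (hu.2 b).extD)))

/-- The jet in a chart is the jet on `M` after a linear change of frame, with which `F` commutes.
Hence `F(φ)` is given in every chart by the same formula; this is where the absence of background
structure enters. -/
theorem Lagrangian.IsNatural.chartRep_eventually {L : Lagrangian m ι κ}
    {F : Jet m ι κ → Alt (m + 2) k} (hF : L.IsNatural F) {u : P → Fields m ι κ M} {s : P} {p : M}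
    (hu : FieldsAt u s p) (hj : jet (u s) p ∈ L.dom) :
    (fun z : P × Vec (m + 2) => chartRep (fun x => F (jet (u z.1) x)) p z.2)
      =ᶠ[𝓝 (s, extChartAt (𝓡 (m + 2)) p p)] fun z => F (jetRep (u z.1) p z.2) := by
  have h1 : ∀ᶠ z : P × Vec (m + 2) in 𝓝 (s, extChartAt (𝓡 (m + 2)) p p),
      jetRep (u z.1) p z.2 ∈ L.dom := by
    refine hu.contDiffAt_jetRep.continuousAt.eventually (L.isOpen_dom.mem_nhds ?_)
    simp only [jetRep_self]
    exact hj
  filter_upwards [h1, eventually_target s p] with z hz hz'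
  rw [jetRep_eq _ hz'] at hz ⊢
  rw [hF.pull _ _ ((L.pull_mem_iff _ _).1 hz), chartRep_apply _ hz']
  rfl

theorem Lagrangian.IsNatural.family {L : Lagrangian m ι κ}
    {F : Jet m ι κ → Alt (m + 2) k} (hF : L.IsNatural F) {u : P → Fields m ι κ M} {s : P} {p : M}
    (hu : FieldsAt u s p) (hj : jet (u s) p ∈ L.dom) :
    SmoothFamilyAt (fun r x => F (jet (u r) x)) s p := by
  refine ContDiffAt.congr_of_eventuallyEq ?_ (hF.chartRep_eventually hu hj)
  refine ContDiffAt.comp (g := F) (f := fun z : P × Vec (m + 2) => jetRep (u z.1) p z.2)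
    (s, extChartAt (𝓡 (m + 2)) p p) (hF.smooth _ ?_) hu.contDiffAt_jetRep
  simp only [jetRep_self]
  exact hj

/-- Infinitesimal change of frame. -/
def jetAct (T : Vec (m + 2) →L[ℝ] Vec (m + 2)) (j : Jet m ι κ) : Jet m ι κ :=
  (fun a => lieAct T (j.1 a), fun b => lieAct T (j.2.1 b), fun a => lieAct T (j.2.2.1 a),
    fun b => lieAct T (j.2.2.2 b))

/-- Differentiate `F(g^*j) = g^*F(j)` in `g` at the identity, in the direction of the endomorphism
`T`. -/
theorem Lagrangian.IsNatural.fderiv_jetAct {L : Lagrangian m ι κ}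
    {F : Jet m ι κ → Alt (m + 2) k} (hF : L.IsNatural F) {j : Jet m ι κ} (hj : j ∈ L.dom)
    (T : Vec (m + 2) →L[ℝ] Vec (m + 2)) : fderiv ℝ F j (jetAct T j) = lieAct T (F j) := by
  have h1 : HasFDerivAt (fun g : Vec (m + 2) →L[ℝ] Vec (m + 2) => j.pullL g)
      ((ContinuousLinearMap.pi fun a => (j.1 a).fderivCompContinuousLinearMap
          (ContinuousLinearMap.id ℝ (Vec (m + 2)))).prod
        ((ContinuousLinearMap.pi fun b => (j.2.1 b).fderivCompContinuousLinearMap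
          (ContinuousLinearMap.id ℝ (Vec (m + 2)))).prod
        ((ContinuousLinearMap.pi fun a => (j.2.2.1 a).fderivCompContinuousLinearMap
          (ContinuousLinearMap.id ℝ (Vec (m + 2)))).prod
        (ContinuousLinearMap.pi fun b => (j.2.2.2 b).fderivCompContinuousLinearMap
          (ContinuousLinearMap.id ℝ (Vec (m + 2))))))) (ContinuousLinearMap.id ℝ (Vec (m + 2))) :=
    (hasFDerivAt_pi.2 fun a => hasFDerivAt_compContinuousLinearMap_id _).prodMk
      ((hasFDerivAt_pi.2 fun a => hasFDerivAt_compContinuousLinearMap_id _).prodMk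
        ((hasFDerivAt_pi.2 fun a => hasFDerivAt_compContinuousLinearMap_id _).prodMk
          (hasFDerivAt_pi.2 fun a => hasFDerivAt_compContinuousLinearMap_id _)))
  have hid : j.pullL (ContinuousLinearMap.id ℝ (Vec (m + 2))) = j := rfl
  have hFj : HasFDerivAt F (fderiv ℝ F j) (j.pullL (ContinuousLinearMap.id ℝ (Vec (m + 2)))) := by
    rw [hid]
    exact ((hF.smooth j hj).differentiableAt (by simp)).hasFDerivAt
  have h2 := HasFDerivAt.comp (g := F) (f := fun g : Vec (m + 2) →L[ℝ] Vec (m + 2) => j.pullL g)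
    (ContinuousLinearMap.id ℝ (Vec (m + 2))) hFj h1
  have h3 : (fun g : Vec (m + 2) →L[ℝ] Vec (m + 2) => (F j).compContinuousLinearMap g)
      =ᶠ[𝓝 (ContinuousLinearMap.id ℝ (Vec (m + 2)))] F ∘ fun g => j.pullL g := by
    -- Naturality is known for invertible `g` only, but these form a neighbourhood of the identity
    -- among all endomorphisms.
    have h4 := ContinuousLinearEquiv.nhds (ContinuousLinearEquiv.refl ℝ (Vec (m + 2)))
    filter_upwards [h4] with g hg
    obtain ⟨e, rfl⟩ := hg
    exact (hF.pull e j hj).symm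
  exact (DFunLike.congr_fun ((hasFDerivAt_compContinuousLinearMap_id (F j)).unique
    (h2.congr_of_eventuallyEq h3)) T).symm

theorem SmoothFields.fieldsAt {φ : Fields m ι κ M} (h : SmoothFields φ) (p : M) :
    FieldsAt (fun _ : ℝ => φ) 0 p := h.const 0 p

/-- Covariance: the Lie derivative of a natural function of the fields. -/
theorem Lagrangian.IsNatural.lieD_apply {L : Lagrangian m ι κ}
    {F : Jet m ι κ → Alt (m + 2) k} (hF : L.IsNatural F) (X : DiffAlg (m + 2) M)
    {φ : Fields m ι κ M} (hφ : SmoothFields φ) {x : M} (hj : jet φ x ∈ L.dom) :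
    CovPhase.lieD X.field (fun y => F (jet φ y)) x =
      fderiv ℝ F (jet φ x) (jet (CovPhase.vert X.field φ) x) := by
  set c := extChartAt (𝓡 (m + 2)) x x with hc
  have hu := hφ.fieldsAt x
  have hcont : Tendsto (fun y : Vec (m + 2) => ((0 : ℝ), y)) (𝓝 c) (𝓝 (0, c)) :=
    (continuousAt_const.prodMk continuousAt_id).tendsto
  have h1 : chartRep (fun y => F (jet φ y)) x =ᶠ[𝓝 c] fun y => F (jetRep φ x y) :=
    hcont.eventually (hF.chartRep_eventually hu hj)
  have hA : ∀ {l : ℕ} (w : Form (m + 2) M l) (hw : SmAt w x),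
      HasFDerivAt (chartRep w x) (fderiv ℝ (chartRep w x) c) c :=
    fun w hw => hw.differentiableAt.hasFDerivAt
  have h2 : HasFDerivAt (jetRep φ x)
      ((ContinuousLinearMap.pi fun a => fderiv ℝ (chartRep (φ.1 a) x) c).prod
        ((ContinuousLinearMap.pi fun b => fderiv ℝ (chartRep (φ.2 b) x) c).prod
        ((ContinuousLinearMap.pi fun a => fderiv ℝ (chartRep (extD (φ.1 a)) x) c).prod
        (ContinuousLinearMap.pi fun b => fderiv ℝ (chartRep (extD (φ.2 b)) x) c)))) c :=
    (hasFDerivAt_pi.2 fun a => hA _ ((hφ.1 a).smAt x)).prodMk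
      ((hasFDerivAt_pi.2 fun b => hA _ ((hφ.2 b).smAt x)).prodMk
        ((hasFDerivAt_pi.2 fun a => hA _ ((hφ.1 a).extD.smAt x)).prodMk
          (hasFDerivAt_pi.2 fun b => hA _ ((hφ.2 b).extD.smAt x))))
  have hFj : HasFDerivAt F (fderiv ℝ F (jet φ x)) (jetRep φ x c) := by
    rw [hc, jetRep_self]
    exact ((hF.smooth _ hj).differentiableAt (by simp)).hasFDerivAt
  have h3 := hFj.comp c h2
  have hsm : SmAt (fun y => F (jet φ y)) x := (hF.family hu hj).smAt
  rw [CovPhase.lieD_apply X hsm, locLie, h1.fderiv_eq, h1.eq_of_nhds, ← hc]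
  have h4 : fderiv ℝ (fun y => F (jetRep φ x y)) c = _ := h3.fderiv
  -- The `lieAct` part of the Lie derivative also becomes a value of `fderiv ℝ F`. It remains to see
  -- that the two directions add up to the jet of `𝔏_X φ`.
  rw [h4, hc, jetRep_self, ← hF.fderiv_jetAct hj]
  rw [← hc]
  refine (map_add (fderiv ℝ F (jet φ x)) _ _).symm.trans ?_
  congr 1
  have hB : ∀ {l : ℕ} (w : Form (m + 2) M l) (hw : SmAt w x),
      fderiv ℝ (chartRep w x) c (chartVec X.field x c) +
        lieAct (fderiv ℝ (chartVec X.field x) c) (w x) = CovPhase.lieD X.field w x := by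
    intro l w hw
    rw [CovPhase.lieD_apply X hw, locLie, ← hc]
    congr 2
    rw [hc, chartRep_self]
  refine Prod.ext (funext fun a => hB _ ((hφ.1 a).smAt x)) (Prod.ext
    (funext fun b => hB _ ((hφ.2 b).smAt x)) (Prod.ext (funext fun a => ?_) (funext fun b => ?_)))
  -- The chart computation gives `𝔏_X dA`, while the jet of `𝔏_X φ` contains `d 𝔏_X A`.
  · exact (hB _ ((hφ.1 a).extD.smAt x)).trans (extD_lieD_apply X ((hφ.1 a).smAt x)).symm
  · exact (hB _ ((hφ.2 b).extD.smAt x)).trans (extD_lieD_apply X ((hφ.2 b).smAt x)).symm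

end Natural

/-! ### Noether currents -/

section Noether

open ContinuousAlternatingMap (alternatizeUncurryFin constOfIsEmpty)

theorem wedge_zero_form {n : ℕ} (β : Alt n 1) (f : Alt n 0) : wedge β f = scalar f • β := by
  have h : Function.Injective (covL (n := n)) :=
    (ContinuousAlternatingMap.ofSubsingletonLIE (𝕜 := ℝ) (E := Vec n) (F := ℝ)
      (0 : Fin 1)).symm.injective
  apply h
  ext1 v
  rw [← scalar_curryLeft, curryLeft_wedge_zero, map_smul]
  change covL β v * scalar f = scalar f * covL β v
  ring

section Sums

variable {n k : ℕ} {M : Type*} [TopologicalSpace M] [ChartedSpace (Vec n) M]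
  [IsManifold (𝓡 n) ∞ M] {α : Type*}

theorem IsSmooth.sum {I : Finset α} {w : α → Form n M k} (hw : ∀ i ∈ I, IsSmooth (w i)) :
    IsSmooth (∑ i ∈ I, w i) :=
  .of_const fun x => SmoothFamilyAt.sum (u := fun i _ => w i) fun i hi => (hw i hi).const _ x

theorem extD_sum {I : Finset α} {w : α → Form n M k} (hw : ∀ i ∈ I, IsSmooth (w i)) :
    extD (∑ i ∈ I, w i) = ∑ i ∈ I, extD (w i) := by
  classical
  induction I using Finset.induction_on with
  | empty => simpa using extD_zero
  | insert a I ha ih =>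
    rw [Finset.sum_insert ha, Finset.sum_insert ha,
      extD_add (hw _ (Finset.mem_insert_self a I))
        (.sum fun i hi => hw i (Finset.mem_insert_of_mem hi)),
      ih fun i hi => hw i (Finset.mem_insert_of_mem hi)]

theorem lieD_sum (X : DiffAlg n M) {I : Finset α} {w : α → Form n M k}
    (hw : ∀ i ∈ I, IsSmooth (w i)) :
    lieD X.field (∑ i ∈ I, w i) = ∑ i ∈ I, lieD X.field (w i) := by
  classical
  induction I using Finset.induction_on with
  | empty => simpa using lieD_smul X.field 0 (0 : Form n M k)
  | insert a I ha ih =>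
    rw [Finset.sum_insert ha, Finset.sum_insert ha,
      lieD_add X (hw _ (Finset.mem_insert_self a I))
        (.sum fun i hi => hw i (Finset.mem_insert_of_mem hi)),
      ih fun i hi => hw i (Finset.mem_insert_of_mem hi)]

end Sums

variable {m k : ℕ} {ι κ : Type*} [Fintype ι] [Fintype κ] [DecidableEq ι] [DecidableEq κ]
  {M : Type*} [TopologicalSpace M] [ChartedSpace (Vec (m + 2)) M]
  {P : Type*} [NormedAddCommGroup P] [NormedSpace ℝ P]

namespace Lagrangian

variable (L : Lagrangian m ι κ)

theorem isNatural_toFun : L.IsNatural L.toFun := ⟨L.natural, fun _ => L.contDiffAt⟩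

theorem isNatural_lamA (a : ι) : L.IsNatural (L.lamA a) :=
  ⟨fun g _ hj => L.lamA_pull g hj a, fun _ => L.contDiffAt_lamA a⟩

theorem isNatural_lamP (b : κ) : L.IsNatural (L.lamP b) :=
  ⟨fun g _ hj => L.lamP_pull g hj b, fun _ => L.contDiffAt_lamP b⟩

theorem isNatural_piA (a : ι) : L.IsNatural (L.piA a) :=
  ⟨fun g _ hj => L.piA_pull g hj a, fun _ => L.contDiffAt_piA a⟩

theorem isNatural_piP (b : κ) : L.IsNatural (L.piP b) :=
  ⟨fun g _ hj => L.piP_pull g hj b, fun _ => L.contDiffAt_piP b⟩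

theorem theta_eq_sum (φ δφ : Fields m ι κ M) : L.theta φ δφ =
    ∑ a, (fun x => wedge (δφ.1 a x) (L.piA a (jet φ x))) +
      ∑ b, fun x => scalar (δφ.2 b x) • L.piP b (jet φ x) := by
  funext x
  simp only [theta, Pi.add_apply, Finset.sum_apply]

theorem thetaLow_eq_sum (φ : Fields m ι κ M) (χ : ι → Form (m + 2) M 0) : L.thetaLow φ χ =
    ∑ a, fun x => scalar (χ a x) • L.piA a (jet φ x) := by
  funext x
  simp only [thetaLow, Finset.sum_apply]

theorem eulerLow_eq_sum (φ : Fields m ι κ M) (χ : ι → Form (m + 2) M 0) : L.eulerLow φ χ =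
    ∑ a, fun x => scalar (χ a x) • L.eulerA φ a x := by
  funext x
  simp only [eulerLow, Finset.sum_apply]

theorem euler_eq_sum (φ δφ : Fields m ι κ M) : L.euler φ δφ =
    ∑ a, (fun x => wedge (δφ.1 a x) (L.eulerA φ a x)) +
      ∑ b, fun x => scalar (δφ.2 b x) • L.eulerP φ b x := by
  funext x
  simp only [euler, Pi.add_apply, Finset.sum_apply]

/-- `L_v = A(v) ∂L/∂A + ι_v dA ∧ ∂L/∂(dA) + dϕ(v) ∂L/∂(dϕ)`, the pointwise consequence of
covariance. -/
theorem curryLeft_toFun {j : Jet m ι κ} (hj : j ∈ L.dom) (v : Vec (m + 2)) :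
    (L.toFun j).curryLeft v = ∑ a, scalar ((j.1 a).curryLeft v) • L.lamA a j +
      ∑ a, wedge ((j.2.2.1 a).curryLeft v) (L.piA a j) +
      ∑ b, scalar ((j.2.2.2 b).curryLeft v) • L.piP b j := by
  rw [← sub_eq_zero]
  refine eq_zero_of_wedge_eq_zero (by omega) _ fun β => ?_
  -- For the endomorphism `β ⊗ v` each field of positive degree varies by `β ∧ ι_v`, and `L` varies
  -- by `β ∧ ι_v L`. Expanding `δL` in momenta gives the claim wedged with `β`, which is arbitrary.
  have h := L.isNatural_toFun.fderiv_jetAct hj ((covL β).smulRight v)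
  rw [lieAct_smulRight, fderiv_eq_momenta] at h
  rw [wedge_sub, ← h, wedge_add, wedge_add, wedge_sum, wedge_sum, wedge_sum]
  simp only [jetAct, lieAct_smulRight, lieAct_zero_form, wedge_zero_form, smul_wedge, wedge_smul,
    wedge_wedge_piA]
  have h0 : scalar (0 : Alt (m + 2) 0) = 0 := rfl
  simp only [h0, zero_smul, Finset.sum_const_zero, add_zero, sub_self]

variable [IsManifold (𝓡 (m + 2)) ∞ M] {L}

theorem IsNatural.isSmooth {F : Jet m ι κ → Alt (m + 2) k} (hF : L.IsNatural F)
    {φ : Fields m ι κ M} (hφ : φ ∈ L.fieldSpace M) : IsSmooth (fun x => F (jet φ x)) :=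
  .of_const fun x => hF.family (hφ.1.const _ x) (hφ.2 x)

theorem IsNatural.hasDerivAt {F : Jet m ι κ → Alt (m + 2) k} (hF : L.IsNatural F)
    {φ δφ : Fields m ι κ M} (hφ : SmoothFields φ) (hδ : SmoothFields δφ) {x : M}
    (hj : jet φ x ∈ L.dom) : HasDerivAt (fun t : ℝ => F (jet (φ + t • δφ) x))
      (fderiv ℝ F (jet φ x) (jet δφ x)) 0 := by
  have h1 : (fun t : ℝ => F (jet (φ + t • δφ) x)) = fun t : ℝ => F (jet φ x + t • jet δφ x) := by
    funext t
    rw [jet_add hφ (hδ.smul t), jet_smul]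
  rw [h1]
  have h2 : HasFDerivAt F (fderiv ℝ F (jet φ x)) (jet φ x + (0 : ℝ) • jet δφ x) := by
    rw [zero_smul, add_zero]
    exact ((hF.smooth _ hj).differentiableAt (by simp)).hasFDerivAt
  have h3 : HasDerivAt (fun t : ℝ => jet φ x + t • jet δφ x) (jet δφ x) 0 := by
    simpa using ((hasDerivAt_id (0 : ℝ)).smul_const (jet δφ x)).const_add (jet φ x)
  exact h2.comp_hasDerivAt 0 h3

/-- Covariance of natural functions of the fields. -/
theorem IsNatural.lieD_eq {F : Jet m ι κ → Alt (m + 2) k} (hF : L.IsNatural F)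
    (X : DiffAlg (m + 2) M) {φ : Fields m ι κ M} (hφ : φ ∈ L.fieldSpace M) :
    lieD X.field (fun y => F (jet φ y)) =
      dFormFun (fun ψ y => F (jet ψ y)) φ (vert X.field φ) :=
  funext fun x => (hF.lieD_apply X hφ.1 (hφ.2 x)).trans
    (hF.hasDerivAt hφ.1 (hφ.1.vert X) (hφ.2 x)).deriv.symm

variable (L)

/-- The term `dα ∧ π` is the variation of `L` along `dα` in the slot of `dA^a`, so the wedge of a
`2`-form with `piA` is never needed. -/
theorem extD_wedge_piA (a : ι) {φ : Fields m ι κ M} (hφ : φ ∈ L.fieldSpace M)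
    {α : Form (m + 2) M 1} (hα : IsSmooth α) (x : M) :
    extD (fun y => wedge (α y) (L.piA a (jet φ y))) x =
      L.dF a (jet φ x) (extD α x) - wedge (α x) (extD (fun y => L.piA a (jet φ y)) x) := by
  have h2 : chartRep (fun y => wedge (α y) (L.piA a (jet φ y))) x = fun z =>
      wedge (chartRep α x z) (chartRep (fun y => L.piA a (jet φ y)) x z) := by
    funext z
    exact wedge_compContinuousLinearMap _ _ _
  rw [extD_apply, h2, extDeriv_wedge (hα.smAt x).differentiableAt
    (((L.isNatural_piA a).isSmooth hφ).smAt x).differentiableAt, ← extD_apply, chartRep_self,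
    chartRep_self]
  congr 1
  simp only [wedge_wedge_piA]
  rw [← map_sum, extD_apply, extDeriv_one_eq_sum]

theorem isSmooth_wedge_piA (a : ι) {φ : Fields m ι κ M} (hφ : φ ∈ L.fieldSpace M)
    {α : Form (m + 2) M 1} (hα : IsSmooth α) :
    IsSmooth (fun y => wedge (α y) (L.piA a (jet φ y))) :=
  .of_const fun x => (hα.const _ x).wedge (((L.isNatural_piA a).isSmooth hφ).const _ x)

theorem isSmooth_scalar_smul {f : Form (m + 2) M 0} {w : Form (m + 2) M k} (hf : IsSmooth f)
    (hw : IsSmooth w) : IsSmooth (fun y => scalar (f y) • w y) :=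
  .of_const fun x => (hf.const _ x).scalar_smul (hw.const _ x)

theorem isSmooth_theta {φ δφ : Fields m ι κ M} (hφ : φ ∈ L.fieldSpace M) (hδ : SmoothFields δφ) :
    IsSmooth (L.theta φ δφ) := by
  rw [theta_eq_sum]
  exact (IsSmooth.sum fun a _ => L.isSmooth_wedge_piA a hφ (hδ.1 a)).add
    (.sum fun b _ => isSmooth_scalar_smul (hδ.2 b) ((L.isNatural_piP b).isSmooth hφ))

theorem extD_theta_apply {φ δφ : Fields m ι κ M} (hφ : φ ∈ L.fieldSpace M)
    (hδ : SmoothFields δφ) (x : M) : extD (L.theta φ δφ) x =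
    ∑ a, (L.dF a (jet φ x) (extD (δφ.1 a) x) -
      wedge (δφ.1 a x) (extD (fun y => L.piA a (jet φ y)) x)) +
    ∑ b, (wedge (extD (δφ.2 b) x) (L.piP b (jet φ x)) +
      scalar (δφ.2 b x) • extD (fun y => L.piP b (jet φ y)) x) := by
  have h1 : ∀ a ∈ Finset.univ, IsSmooth (fun y => wedge (δφ.1 a y) (L.piA a (jet φ y))) :=
    fun a _ => L.isSmooth_wedge_piA a hφ (hδ.1 a)
  have h2 : ∀ b ∈ Finset.univ, IsSmooth (fun y => scalar (δφ.2 b y) • L.piP b (jet φ y)) :=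
    fun b _ => isSmooth_scalar_smul (hδ.2 b) ((L.isNatural_piP b).isSmooth hφ)
  rw [theta_eq_sum, extD_add (.sum h1) (.sum h2), extD_sum h1, extD_sum h2, Pi.add_apply,
    Finset.sum_apply, Finset.sum_apply]
  congr 1
  · exact Finset.sum_congr rfl fun a _ => L.extD_wedge_piA a hφ (hδ.1 a) x
  · exact Finset.sum_congr rfl fun b _ => extD_scalar_smul_apply ((hδ.2 b).smAt x)
      (((L.isNatural_piP b).isSmooth hφ).smAt x)

/-- `𝐝L = E + dθ`. -/
theorem dFormFun_form {φ δφ : Fields m ι κ M} (hφ : φ ∈ L.fieldSpace M) (hδ : SmoothFields δφ) :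
    dFormFun L.form φ δφ = L.euler φ δφ + extD (L.theta φ δφ) := by
  funext x
  have h := (L.isNatural_toFun.hasDerivAt hφ.1 hδ (hφ.2 x)).deriv
  refine h.trans ?_
  rw [Pi.add_apply, L.extD_theta_apply hφ hδ, fderiv_eq_momenta, euler]
  simp only [eulerA, eulerP, Pi.add_apply, Pi.sub_apply, wedge_add, Finset.sum_add_distrib,
    Finset.sum_sub_distrib, jet]
  have hs : ∀ (c : ℝ) (u v : Alt (m + 2) (m + 2)), c • (u - v) = c • u - c • v :=
    fun c u v => smul_sub c u v
  simp only [hs, Finset.sum_sub_distrib]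
  abel

theorem isSmooth_form {φ : Fields m ι κ M} (hφ : φ ∈ L.fieldSpace M) : IsSmooth (L.form φ) :=
  L.isNatural_toFun.isSmooth hφ

theorem isSmooth_eulerA {φ : Fields m ι κ M} (hφ : φ ∈ L.fieldSpace M) (a : ι) :
    IsSmooth (L.eulerA φ a) :=
  ((L.isNatural_lamA a).isSmooth hφ).add ((L.isNatural_piA a).isSmooth hφ).extD

theorem isSmooth_eulerP {φ : Fields m ι κ M} (hφ : φ ∈ L.fieldSpace M) (b : κ) :
    IsSmooth (L.eulerP φ b) :=
  ((L.isNatural_lamP b).isSmooth hφ).sub ((L.isNatural_piP b).isSmooth hφ).extD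

theorem isSmooth_euler {φ δφ : Fields m ι κ M} (hφ : φ ∈ L.fieldSpace M) (hδ : SmoothFields δφ) :
    IsSmooth (L.euler φ δφ) := by
  rw [euler_eq_sum]
  exact (IsSmooth.sum fun a _ => .of_const fun x =>
      ((hδ.1 a).const _ x).wedge ((L.isSmooth_eulerA hφ a).const _ x)).add
    (.sum fun b _ => isSmooth_scalar_smul (hδ.2 b) (L.isSmooth_eulerP hφ b))

theorem isSmooth_thetaLow {φ : Fields m ι κ M} (hφ : φ ∈ L.fieldSpace M) (X : DiffAlg (m + 2) M) :
    IsSmooth (L.thetaLow φ (innerField X.field φ)) := by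
  rw [thetaLow_eq_sum]
  exact IsSmooth.sum fun a _ => isSmooth_scalar_smul ((hφ.1.1 a).iprod X)
    ((L.isNatural_piA a).isSmooth hφ)

theorem isSmooth_eulerLow {φ : Fields m ι κ M} (hφ : φ ∈ L.fieldSpace M) (X : DiffAlg (m + 2) M) :
    IsSmooth (L.eulerLow φ (innerField X.field φ)) := by
  rw [eulerLow_eq_sum]
  exact IsSmooth.sum fun a _ => isSmooth_scalar_smul ((hφ.1.1 a).iprod X) (L.isSmooth_eulerA hφ a)

/-- Noether's identity `ι_{X^v}θ = dθ(ι_X φ) + ι_X L - E(ι_X φ)`. -/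
theorem theta_vert {φ : Fields m ι κ M} (hφ : φ ∈ L.fieldSpace M) (X : DiffAlg (m + 2) M) :
    L.theta φ (vert X.field φ) = extD (L.thetaLow φ (innerField X.field φ)) +
      iprod X.field (L.form φ) - L.eulerLow φ (innerField X.field φ) := by
  funext x
  have h1 : ∀ a ∈ Finset.univ, IsSmooth
      (fun y => scalar (innerField X.field φ a y) • L.piA a (jet φ y)) := fun a _ =>
    isSmooth_scalar_smul ((hφ.1.1 a).iprod X) ((L.isNatural_piA a).isSmooth hφ)
  have h2 : extD (L.thetaLow φ (innerField X.field φ)) x =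
      ∑ a, (wedge (extD (innerField X.field φ a) x) (L.piA a (jet φ x)) +
        scalar (innerField X.field φ a x) • extD (fun y => L.piA a (jet φ y)) x) := by
    rw [thetaLow_eq_sum, extD_sum h1, Finset.sum_apply]
    exact Finset.sum_congr rfl fun a _ => extD_scalar_smul_apply (((hφ.1.1 a).iprod X).smAt x)
      (((L.isNatural_piA a).isSmooth hφ).smAt x)
  have h3 : iprod X.field (L.form φ) x = _ := L.curryLeft_toFun (hφ.2 x) (X.field x)
  have h4 : L.theta φ (vert X.field φ) x =
      ∑ a, (wedge ((extD (φ.1 a) x).curryLeft (X.field x)) (L.piA a (jet φ x)) +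
        wedge (extD (innerField X.field φ a) x) (L.piA a (jet φ x))) +
      ∑ b, scalar ((extD (φ.2 b) x).curryLeft (X.field x)) • L.piP b (jet φ x) := by
    refine congrArg₂ (· + ·) (Finset.sum_congr rfl fun a _ => ?_) rfl
    exact add_wedge _ _ _
  have h5 : L.eulerLow φ (innerField X.field φ) x =
      ∑ a, (scalar ((φ.1 a x).curryLeft (X.field x)) • L.lamA a (jet φ x) +
        scalar (innerField X.field φ a x) • extD (fun y => L.piA a (jet φ y)) x) :=
    Finset.sum_congr rfl fun a _ => smul_add (scalar (innerField X.field φ a x))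
      (L.lamA a (jet φ x)) (extD (fun y => L.piA a (jet φ y)) x)
  -- Writing `𝔏_X A = ι_X dA + d ι_X A`, the curvature part and the `ϕ` part occur in `ι_X L`. The
  -- part `d ι_X A ∧ π` occurs in `dθ(ι_X φ)`. What remains on the right cancels against `E(ι_X φ)`.
  rw [Pi.sub_apply, Pi.add_apply, h2, h3, h4, h5]
  simp only [jet, Finset.sum_add_distrib]
  abel

/-- The derivative of `θ(δφ; φ)` in `φ` along `η`, for constant `δφ`. -/
def dTheta (φ η δφ : Fields m ι κ M) : Form (m + 2) M (m + 1) := fun x =>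
  ∑ a, wedge (δφ.1 a x) (fderiv ℝ (L.piA a) (jet φ x) (jet η x)) +
    ∑ b, scalar (δφ.2 b x) • fderiv ℝ (L.piP b) (jet φ x) (jet η x)

theorem hasDerivAt_theta {φ η : Fields m ι κ M} (hφ : SmoothFields φ)
    (hη : SmoothFields η) (δφ : Fields m ι κ M) {x : M} (hj : jet φ x ∈ L.dom) :
    HasDerivAt (fun t : ℝ => L.theta (φ + t • η) δφ x) (L.dTheta φ η δφ x) 0 := by
  refine HasDerivAt.add (f := fun t : ℝ => ∑ a, wedge (δφ.1 a x) (L.piA a (jet (φ + t • η) x)))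
    (g := fun t : ℝ => ∑ b, scalar (δφ.2 b x) • L.piP b (jet (φ + t • η) x)) ?_ ?_
  · refine HasDerivAt.fun_sum fun a _ => ?_
    exact (wedgeL (δφ.1 a x)).hasFDerivAt.comp_hasDerivAt 0
      ((L.isNatural_piA a).hasDerivAt hφ hη hj)
  · refine HasDerivAt.fun_sum fun b _ => ?_
    exact HasDerivAt.const_smul (scalar (δφ.2 b x)) ((L.isNatural_piP b).hasDerivAt hφ hη hj)

theorem presymp_eq {φ δ₁ δ₂ : Fields m ι κ M} (hφ : φ ∈ L.fieldSpace M) (h₁ : SmoothFields δ₁)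
    (h₂ : SmoothFields δ₂) : L.presymp φ δ₁ δ₂ = L.dTheta φ δ₁ δ₂ - L.dTheta φ δ₂ δ₁ := by
  funext x
  rw [Pi.sub_apply, ← (L.hasDerivAt_theta hφ.1 h₁ δ₂ (hφ.2 x)).deriv,
    ← (L.hasDerivAt_theta hφ.1 h₂ δ₁ (hφ.2 x)).deriv]
  rfl

/-- Leibniz: the Lie derivative falls on `δφ` or on the momenta, and on the latter it is the
field-space derivative along `X^v` by covariance. -/
theorem lieD_theta {φ δφ : Fields m ι κ M} (hφ : φ ∈ L.fieldSpace M) (hδ : SmoothFields δφ)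
    (X : DiffAlg (m + 2) M) : lieD X.field (L.theta φ δφ) =
      L.theta φ (vert X.field δφ) + L.dTheta φ (vert X.field φ) δφ := by
  have h1 : ∀ a ∈ Finset.univ, IsSmooth (fun y => wedge (δφ.1 a y) (L.piA a (jet φ y))) :=
    fun a _ => L.isSmooth_wedge_piA a hφ (hδ.1 a)
  have h2 : ∀ b ∈ Finset.univ, IsSmooth (fun y => scalar (δφ.2 b y) • L.piP b (jet φ y)) :=
    fun b _ => isSmooth_scalar_smul (hδ.2 b) ((L.isNatural_piP b).isSmooth hφ)
  rw [theta_eq_sum, lieD_add X (.sum h1) (.sum h2), lieD_sum X h1, lieD_sum X h2]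
  funext x
  have e1 : ∀ a, lieD X.field (fun y => wedge (δφ.1 a y) (L.piA a (jet φ y))) x =
      wedge (lieD X.field (δφ.1 a) x) (L.piA a (jet φ x)) + wedge (δφ.1 a x)
        (fderiv ℝ (L.piA a) (jet φ x) (jet (vert X.field φ) x)) := fun a => by
    rw [lieD_wedge_apply X ((hδ.1 a).smAt x) (((L.isNatural_piA a).isSmooth hφ).smAt x),
      (L.isNatural_piA a).lieD_apply X hφ.1 (hφ.2 x)]
  have e2 : ∀ b, lieD X.field (fun y => scalar (δφ.2 b y) • L.piP b (jet φ y)) x =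
      scalar (lieD X.field (δφ.2 b) x) • L.piP b (jet φ x) + scalar (δφ.2 b x) •
        (fderiv ℝ (L.piP b) (jet φ x) (jet (vert X.field φ) x)) := fun b => by
    rw [lieD_scalar_smul_apply X ((hδ.2 b).smAt x) (((L.isNatural_piP b).isSmooth hφ).smAt x),
      (L.isNatural_piP b).lieD_apply X hφ.1 (hφ.2 x)]
  simp only [Pi.add_apply, Finset.sum_apply, e1, e2, theta, dTheta, Finset.sum_add_distrib, vert]
  abel

theorem theta_add (φ δ₁ δ₂ : Fields m ι κ M) :
    L.theta φ (δ₁ + δ₂) = L.theta φ δ₁ + L.theta φ δ₂ := by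
  funext x
  have h1 : ∀ a, wedge ((δ₁ + δ₂).1 a x) (L.piA a (jet φ x)) =
    wedge (δ₁.1 a x) (L.piA a (jet φ x)) + wedge (δ₂.1 a x) (L.piA a (jet φ x)) :=
    fun a => add_wedge _ _ _
  have h2 : ∀ b, scalar ((δ₁ + δ₂).2 b x) • L.piP b (jet φ x) =
    scalar (δ₁.2 b x) • L.piP b (jet φ x) + scalar (δ₂.2 b x) • L.piP b (jet φ x) :=
    fun b => add_smul (scalar (δ₁.2 b x)) (scalar (δ₂.2 b x)) _
  simp only [theta, Pi.add_apply (f := L.theta φ δ₁), h1, h2, Finset.sum_add_distrib]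
  abel

theorem theta_smul (φ : Fields m ι κ M) (c : ℝ) (δ : Fields m ι κ M) :
    L.theta φ (c • δ) = c • L.theta φ δ := by
  funext x
  have h1 : ∀ a, wedge ((c • δ).1 a x) (L.piA a (jet φ x)) =
    c • wedge (δ.1 a x) (L.piA a (jet φ x)) := fun a => smul_wedge _ _ _
  have h2 : ∀ b, scalar ((c • δ).2 b x) • L.piP b (jet φ x) =
    c • scalar (δ.2 b x) • L.piP b (jet φ x) := fun b => mul_smul c (scalar (δ.2 b x)) _
  rw [Pi.smul_apply]
  simp only [theta, h1, h2]
  rw [← Finset.smul_sum, ← Finset.smul_sum]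
  exact (smul_add c _ _).symm

theorem theta_sub (φ δ₁ δ₂ : Fields m ι κ M) :
    L.theta φ (δ₁ - δ₂) = L.theta φ δ₁ - L.theta φ δ₂ := by
  have h := L.theta_add φ (δ₁ - δ₂) δ₂
  rw [sub_add_cancel] at h
  rw [h, add_sub_cancel_right]

/-- `Θ(X^v, Y^v) = 𝔏_X θ(Y^v) - 𝔏_Y θ(X^v) + θ([X, Y]^v)`. -/
theorem presymp_vert_vert {φ : Fields m ι κ M} (hφ : φ ∈ L.fieldSpace M)
    (X Y : DiffAlg (m + 2) M) : L.presymp φ (vert X.field φ) (vert Y.field φ) =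
      lieD X.field (L.theta φ (vert Y.field φ)) - lieD Y.field (L.theta φ (vert X.field φ)) +
        L.theta φ (vert ⁅X, Y⁆.field φ) := by
  rw [L.presymp_eq hφ (hφ.1.vert X) (hφ.1.vert Y), L.lieD_theta hφ (hφ.1.vert Y),
    L.lieD_theta hφ (hφ.1.vert X), vert_vert X Y hφ.1, theta_sub]
  abel

theorem lieD_form {φ : Fields m ι κ M} (hφ : φ ∈ L.fieldSpace M) (X : DiffAlg (m + 2) M) :
    lieD X.field (L.form φ) =
      L.euler φ (vert X.field φ) + extD (L.theta φ (vert X.field φ)) :=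
  (L.isNatural_toFun.lieD_eq X hφ).trans (L.dFormFun_form hφ (hφ.1.vert X))

theorem top_form_extD (w : Form (m + 2) M (m + 2)) : extD w = 0 :=
  funext fun _ => alt_eq_zero_of_lt (by omega) _

theorem lieD_form' (φ : Fields m ι κ M) (X : DiffAlg (m + 2) M) :
    lieD X.field (L.form φ) = extD (iprod X.field (L.form φ)) := by
  rw [lieD_succ, top_form_extD, iprod_zero, zero_add]

/-- `dE(ι_X φ) = E(X^v)`. -/
theorem extD_eulerLow {φ : Fields m ι κ M} (hφ : φ ∈ L.fieldSpace M) (X : DiffAlg (m + 2) M) :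
    extD (L.eulerLow φ (innerField X.field φ)) = L.euler φ (vert X.field φ) := by
  have h1 := L.lieD_form hφ X
  have hL := (L.isSmooth_form hφ).iprod X
  have ht := (L.isSmooth_thetaLow hφ X).extD
  -- Two expressions for `𝔏_X L` are compared: `d ι_X L`, because `L` has top degree, and `E(X^v) +
  -- dθ(X^v)`, by covariance. After inserting Noether's identity only the two Euler–Lagrange terms
  -- survive.
  rw [lieD_form', L.theta_vert hφ X, extD_sub (ht.add hL) (L.isSmooth_eulerLow hφ X),
    extD_add ht hL, extD_extD (L.isSmooth_thetaLow hφ X), zero_add] at h1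
  have h2 := sub_eq_zero.2 h1
  rw [← sub_eq_zero, ← h2]
  abel

/-- Noether's identity is inserted in `𝔏_X θ(Y^v) - 𝔏_Y θ(X^v)`. The `dθ(ι φ)` terms stay exact
because `d` commutes with Lie derivatives. The Lagrangian terms give `-ι_{[X, Y]} L + d ι_X ι_Y L`.
The field equations are split by Cartan's formula and `dE(ι_X φ) = E(X^v)`. The term `dγ([X, Y])` is
added and subtracted to complete the current. -/
theorem presymp_vert_vert_eq (γ : DiffAlg (m + 2) M →ₗ[ℝ] (Fields m ι κ M → Form (m + 2) M m))
    {φ : Fields m ι κ M} (hφ : φ ∈ L.fieldSpace M) (X Y : DiffAlg (m + 2) M)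
    (hγ : IsSmooth (γ ⁅X, Y⁆ φ)) :
    L.presymp φ (vert X.field φ) (vert Y.field φ) = L.current γ ⁅X, Y⁆ φ +
      extD (L.cocycleForm γ X Y φ) + (iprod Y.field (L.euler φ (vert X.field φ)) -
        iprod X.field (L.euler φ (vert Y.field φ))) := by
  have tX := L.isSmooth_thetaLow hφ X
  have tY := L.isSmooth_thetaLow hφ Y
  have eX := L.isSmooth_eulerLow hφ X
  have eY := L.isSmooth_eulerLow hφ Y
  have hL := L.isSmooth_form hφ
  rw [L.presymp_vert_vert hφ, L.theta_vert hφ X, L.theta_vert hφ Y, lieD_sub X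
    (tY.extD.add (hL.iprod Y)) eY, lieD_sub Y (tX.extD.add (hL.iprod X)) eX,
    lieD_add X tY.extD (hL.iprod Y), lieD_add Y tX.extD (hL.iprod X), lieD_succ X.field (eulerLow _ _ _),
    lieD_succ Y.field (eulerLow _ _ _), L.extD_eulerLow hφ, L.extD_eulerLow hφ,
    lieD_iprod X Y hL, lieD_form', lieD_succ Y.field (iprod _ _), ← extD_lieD X tY,
    ← extD_lieD Y tX, current, cocycleForm]
  have a1 := tY.lieD X
  have a2 := tX.lieD Y
  have a3 := (hL.iprod Y).iprod X
  have a4 := eX.iprod Y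
  have a5 := eY.iprod X
  rw [extD_sub ((((a1.sub a2).add a3).add hγ).add a4) a5, extD_add (((a1.sub a2).add a3).add hγ) a4,
    extD_add ((a1.sub a2).add a3) hγ, extD_add (a1.sub a2) a3, extD_sub a1 a2,
    iprod_swap X.field Y.field, extD_neg]
  abel

end Lagrangian

end Noether

/-! ### Closedness of the presymplectic current -/

section Closed

/-! ### Exterior derivative of a one-form on a normed space, and its closedness. -/

section Abstract

variable {V W : Type*} [NormedAddCommGroup V] [NormedSpace ℝ V] [NormedAddCommGroup W]
  [NormedSpace ℝ W]

/-- The exterior derivative of the `1`-form `f` at `j`. -/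
def dForm (f : V → V →L[ℝ] W) (j x z : V) : W := fderiv ℝ f j x z - fderiv ℝ f j z x

/-- The derivative of the coefficients of `dForm f` along `y`. -/
def ddForm (f : V → V →L[ℝ] W) (j y x z : V) : W :=
  fderiv ℝ (fderiv ℝ f) j y x z - fderiv ℝ (fderiv ℝ f) j y z x

theorem dForm_add_left (f : V → V →L[ℝ] W) (j x y z : V) :
    dForm f j (x + y) z = dForm f j x z + dForm f j y z := by
  simp only [dForm, map_add, add_apply]
  abel

theorem dForm_smul_left (f : V → V →L[ℝ] W) (c : ℝ) (j x z : V) :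
    dForm f j (c • x) z = c • dForm f j x z := by
  simp only [dForm, map_smul, smul_apply, smul_sub]

/-- This is `d² = 0` on constant vectors: the six terms cancel in pairs by symmetry of the second
derivative of `f`. -/
theorem ddForm_cyclic {f : V → V →L[ℝ] W} {j : V} (hf : ContDiffAt ℝ ∞ f j) (a b c : V) :
    ddForm f j a b c + ddForm f j b c a + ddForm f j c a b = 0 := by
  have hs := hf.isSymmSndFDerivAt (by
    rw [minSmoothness_of_isRCLikeNormedField]
    exact WithTop.coe_le_coe.2 (le_top : (2 : ℕ∞) ≤ ⊤))
  have hs' : ∀ u v, fderiv ℝ (fderiv ℝ f) j u v = fderiv ℝ (fderiv ℝ f) j v u := fun u v => hs u v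
  unfold ddForm
  rw [hs' b a, hs' c a, hs' c b]
  abel

theorem hasDerivAt_line {f : V → V →L[ℝ] W} {j : V} (hf : ContDiffAt ℝ ∞ f j) (y z : V) :
    HasDerivAt (fun t : ℝ => f (j + t • y) z) (fderiv ℝ f j y z) 0 := by
  have h2 : HasFDerivAt f (fderiv ℝ f j) (j + (0 : ℝ) • y) := by
    rw [zero_smul, add_zero]
    exact (hf.differentiableAt (by simp)).hasFDerivAt
  have h3 : HasDerivAt (fun t : ℝ => j + t • y) y 0 := by
    simpa using ((hasDerivAt_id (0 : ℝ)).smul_const y).const_add j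
  have h4 := h2.comp_hasDerivAt 0 h3
  exact ((ContinuousLinearMap.apply ℝ W z).hasFDerivAt.comp_hasDerivAt 0 h4)

theorem hasDerivAt_dForm {f : V → V →L[ℝ] W} {j : V} (hf : ContDiffAt ℝ ∞ f j)
    (y x x' z z' : V) :
    HasDerivAt (fun t : ℝ => dForm f (j + t • y) (x + t • x') (z + t • z'))
      (ddForm f j y x z + dForm f j x' z + dForm f j x z') 0 := by
  have hl : ∀ u v : V, HasDerivAt (fun t : ℝ => u + t • v) v 0 := fun u v => by
    simpa using ((hasDerivAt_id (0 : ℝ)).smul_const v).const_add u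
  have hg : HasFDerivAt (fderiv ℝ f) (fderiv ℝ (fderiv ℝ f) j) (j + (0 : ℝ) • y) := by
    rw [zero_smul, add_zero]
    exact ((hf.fderiv_right (m := ∞) (by simp)).differentiableAt (by simp)).hasFDerivAt
  have h1 : HasDerivAt (fun t : ℝ => fderiv ℝ f (j + t • y)) (fderiv ℝ (fderiv ℝ f) j y) 0 :=
    hg.comp_hasDerivAt 0 (hl j y)
  have h2 := ((h1.clm_apply (hl x x')).clm_apply (hl z z')).sub
    ((h1.clm_apply (hl z z')).clm_apply (hl x x'))
  refine h2.congr_deriv ?_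
  simp only [zero_smul, add_zero, dForm, ddForm, add_apply]
  abel

end Abstract

variable {m : ℕ} {ι κ : Type*} [Fintype ι] [Fintype κ] [DecidableEq ι] [DecidableEq κ]
  {M : Type*} [TopologicalSpace M] [ChartedSpace (Vec (m + 2)) M]

/-- `w ↦ (δ ↦ δA^a ∧ w)`. -/
def jetWedge (κ : Type*) [Fintype κ] (a : ι) :
    Alt (m + 2) m →L[ℝ] Jet m ι κ →L[ℝ] Alt (m + 2) (m + 1) :=
  ((ContinuousLinearMap.compL ℝ (Jet m ι κ) (Alt (m + 2) 1) (Alt (m + 2) (m + 1))).flip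
    (ContinuousLinearMap.proj (R := ℝ) (φ := fun _ : ι => Alt (m + 2) 1) a ∘L
      ContinuousLinearMap.fst ℝ _ _)) ∘L wedgeL.flip

/-- `w ↦ (δ ↦ δϕ^b w)`. -/
def jetScalar (ι : Type*) [Fintype ι] (b : κ) :
    Alt (m + 2) (m + 1) →L[ℝ] Jet m ι κ →L[ℝ] Alt (m + 2) (m + 1) :=
  ContinuousLinearMap.smulRightL ℝ (Jet m ι κ) (Alt (m + 2) (m + 1))
    (scalarL ∘L (ContinuousLinearMap.proj (R := ℝ) (φ := fun _ : κ => Alt (m + 2) 0) b ∘L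
      ContinuousLinearMap.fst ℝ _ _ ∘L ContinuousLinearMap.snd ℝ _ _))

namespace Lagrangian

variable (L : Lagrangian m ι κ)

/-- The presymplectic potential as a function of field values. -/
def thetaJ (j : Jet m ι κ) : Jet m ι κ →L[ℝ] Alt (m + 2) (m + 1) :=
  ∑ a, jetWedge κ a (L.piA a j) + ∑ b, jetScalar ι b (L.piP b j)

theorem thetaJ_apply (j δ : Jet m ι κ) : L.thetaJ j δ =
    ∑ a, wedge (δ.1 a) (L.piA a j) + ∑ b, scalar (δ.2.1 b) • L.piP b j := by
  have h1 : L.thetaJ j δ = (∑ a, jetWedge κ a (L.piA a j)) δ + (∑ b, jetScalar ι b (L.piP b j)) δ :=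
    rfl
  rw [h1, sum_apply, sum_apply]
  rfl

theorem contDiffAt_thetaJ {j : Jet m ι κ} (hj : j ∈ L.dom) : ContDiffAt ℝ ∞ L.thetaJ j := by
  have h1 : ∀ a, ContDiffAt ℝ ∞ (fun i : Jet m ι κ => jetWedge κ a (L.piA a i)) j := fun a =>
    (jetWedge (m := m) κ a).contDiff.contDiffAt.comp j (L.contDiffAt_piA a hj)
  have h2 : ∀ b, ContDiffAt ℝ ∞ (fun i : Jet m ι κ => jetScalar ι b (L.piP b i)) j := fun b =>
    (jetScalar (m := m) ι b).contDiff.contDiffAt.comp j (L.contDiffAt_piP b hj)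
  exact (ContDiffAt.sum fun a _ => h1 a).add (ContDiffAt.sum fun b _ => h2 b)

/-- At each point of `M`, `θ` is a `1`-form on the finite-dimensional space of jets, evaluated on
jets. Closedness of `Θ` is thereby a statement about that `1`-form. -/
theorem theta_apply (φ δφ : Fields m ι κ M) (x : M) :
    L.theta φ δφ x = L.thetaJ (jet φ x) (jet δφ x) := by
  rw [thetaJ_apply, theta]
  simp only [jet]

variable [IsManifold (𝓡 (m + 2)) ∞ M]

theorem presymp_apply {φ δ₁ δ₂ : Fields m ι κ M} {x : M} (hφ : SmoothFields φ)
    (hj : jet φ x ∈ L.dom) (h₁ : SmoothFields δ₁) (h₂ : SmoothFields δ₂) :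
    L.presymp φ δ₁ δ₂ x = dForm L.thetaJ (jet φ x) (jet δ₁ x) (jet δ₂ x) := by
  have hd : ∀ (δ δ' : Fields m ι κ M), SmoothFields δ →
      HasDerivAt (fun t : ℝ => L.theta (φ + t • δ) δ' x)
        (fderiv ℝ L.thetaJ (jet φ x) (jet δ x) (jet δ' x)) 0 := by
    intro δ δ' hδ
    have h1 : (fun t : ℝ => L.theta (φ + t • δ) δ' x) = fun t : ℝ =>
        L.thetaJ (jet φ x + t • jet δ x) (jet δ' x) := by
      funext t
      rw [theta_apply, jet_add hφ (hδ.smul t), jet_smul]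
    rw [h1]
    exact hasDerivAt_line (L.contDiffAt_thetaJ hj) _ _
  exact congrArg₂ (· - ·) (hd δ₁ δ₂ h₁).deriv (hd δ₂ δ₁ h₂).deriv

/-- The derivative of `Θ(δ₁, δ₂)` in `φ` along `η`, for constant `δ₁`, `δ₂`. -/
def dPresymp (φ η δ₁ δ₂ : Fields m ι κ M) : Form (m + 2) M (m + 1) := fun x =>
  ddForm L.thetaJ (jet φ x) (jet η x) (jet δ₁ x) (jet δ₂ x)

theorem eventually_mem_dom {φ η : Fields m ι κ M} (hφ : SmoothFields φ) (hη : SmoothFields η)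
    {x : M} (hj : jet φ x ∈ L.dom) : ∀ᶠ t : ℝ in 𝓝 0, jet (φ + t • η) x ∈ L.dom := by
  have hc : ContinuousAt (fun t : ℝ => jet φ x + t • jet η x) 0 := by fun_prop
  have h := hc.eventually (L.isOpen_dom.mem_nhds (by simpa using hj))
  filter_upwards [h] with t ht
  rwa [jet_add hφ (hη.smul t), jet_smul]

theorem hasDerivAt_presymp {φ η δ₁ δ₁' δ₂ δ₂' : Fields m ι κ M} {x : M} (hφ : SmoothFields φ)
    (hj : jet φ x ∈ L.dom) (hη : SmoothFields η) (h₁ : SmoothFields δ₁) (h₁' : SmoothFields δ₁')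
    (h₂ : SmoothFields δ₂) (h₂' : SmoothFields δ₂') :
    HasDerivAt (fun t : ℝ => L.presymp (φ + t • η) (δ₁ + t • δ₁') (δ₂ + t • δ₂') x)
      (L.dPresymp φ η δ₁ δ₂ x + L.presymp φ δ₁' δ₂ x + L.presymp φ δ₁ δ₂' x) 0 := by
  rw [L.presymp_apply hφ hj h₁' h₂, L.presymp_apply hφ hj h₁ h₂']
  refine (hasDerivAt_dForm (L.contDiffAt_thetaJ hj) (jet η x) (jet δ₁ x) (jet δ₁' x) (jet δ₂ x)
    (jet δ₂' x)).congr_of_eventuallyEq ?_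
  filter_upwards [L.eventually_mem_dom hφ hη hj] with t ht
  rw [L.presymp_apply (hφ.add (hη.smul t)) ht (h₁.add (h₁'.smul t)) (h₂.add (h₂'.smul t)),
    jet_add hφ (hη.smul t), jet_smul, jet_add h₁ (h₁'.smul t), jet_smul, jet_add h₂ (h₂'.smul t),
    jet_smul]

theorem presymp_swap (φ δ₁ δ₂ : Fields m ι κ M) : L.presymp φ δ₁ δ₂ = -L.presymp φ δ₂ δ₁ := by
  unfold presymp dOneForm
  abel

theorem presymp_sub_left {φ δ₁ δ₂ δ₃ : Fields m ι κ M} (hφ : φ ∈ L.fieldSpace M)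
    (h₁ : SmoothFields δ₁) (h₂ : SmoothFields δ₂) (h₃ : SmoothFields δ₃) :
    L.presymp φ (δ₁ - δ₂) δ₃ = L.presymp φ δ₁ δ₃ - L.presymp φ δ₂ δ₃ := by
  have h : L.presymp φ (δ₁ - δ₂ + δ₂) δ₃ = L.presymp φ (δ₁ - δ₂) δ₃ + L.presymp φ δ₂ δ₃ := by
    funext x
    rw [Pi.add_apply, L.presymp_apply hφ.1 (hφ.2 x) ((h₁.sub h₂).add h₂) h₃,
      L.presymp_apply hφ.1 (hφ.2 x) (h₁.sub h₂) h₃, L.presymp_apply hφ.1 (hφ.2 x) h₂ h₃,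
      jet_add (h₁.sub h₂) h₂, dForm_add_left]
  rw [sub_add_cancel] at h
  rw [h, add_sub_cancel_right]

/-- The fundamental field depends on the point linearly, so besides the coefficients of `Θ` its
first argument is differentiated too, with derivative `𝔏_X η`. -/
theorem dFormFun_presymp_vert {φ η δ : Fields m ι κ M} (hφ : φ ∈ L.fieldSpace M)
    (hη : SmoothFields η) (hδ : SmoothFields δ) (X : DiffAlg (m + 2) M) :
    dFormFun (fun ψ => L.presymp ψ (vert X.field ψ) δ) φ η =
      L.dPresymp φ η (vert X.field φ) δ + L.presymp φ (vert X.field η) δ := by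
  funext x
  have hz : SmoothFields (0 : Fields m ι κ M) := by simpa using hφ.1.smul 0
  have h := L.hasDerivAt_presymp hφ.1 (hφ.2 x) hη (hφ.1.vert X) (hη.vert X) hδ hz
  have h0 : L.presymp φ (vert X.field φ) 0 x = 0 := by
    rw [L.presymp_apply hφ.1 (hφ.2 x) (hφ.1.vert X) hz]
    have : jet (0 : Fields m ι κ M) x = 0 := by simpa using jet_smul 0 (0 : Fields m ι κ M) x
    simp [this, dForm]
  rw [h0, add_zero] at h
  refine Eq.trans ?_ h.deriv
  refine congrArg (fun f : ℝ → _ => deriv f 0) (funext fun t => ?_)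
  change L.presymp (φ + t • η) (vert X.field (φ + t • η)) δ x = _
  rw [vert_add X hφ.1 (hη.smul t), vert_smul, smul_zero, add_zero]

theorem dInnerPresymp_eq {φ : Fields m ι κ M} (hφ : φ ∈ L.fieldSpace M)
    (X Y Z : DiffAlg (m + 2) M) : L.dInnerPresymp X Y Z φ =
      L.dPresymp φ (vert Y.field φ) (vert X.field φ) (vert Z.field φ) +
        L.presymp φ (vert X.field (vert Y.field φ)) (vert Z.field φ) -
      (L.dPresymp φ (vert Z.field φ) (vert X.field φ) (vert Y.field φ) +
        L.presymp φ (vert X.field (vert Z.field φ)) (vert Y.field φ)) := by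
  rw [← L.dFormFun_presymp_vert hφ (hφ.1.vert Y) (hφ.1.vert Z),
    ← L.dFormFun_presymp_vert hφ (hφ.1.vert Z) (hφ.1.vert Y)]
  rfl

theorem dPresymp_swap (φ η δ₁ δ₂ : Fields m ι κ M) :
    L.dPresymp φ η δ₁ δ₂ = -L.dPresymp φ η δ₂ δ₁ := by
  funext x
  simp only [dPresymp, ddForm, Pi.neg_apply]
  abel

theorem dPresymp_cyclic {φ : Fields m ι κ M} (hφ : φ ∈ L.fieldSpace M) (a b c : Fields m ι κ M) :
    L.dPresymp φ a b c + L.dPresymp φ b c a + L.dPresymp φ c a b = 0 :=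
  funext fun x => ddForm_cyclic (L.contDiffAt_thetaJ (hφ.2 x)) _ _ _

/-- The cyclic sum of `(𝐝ι_{X^v}Θ)(Y^v, Z^v)` is that of `Θ(X^v, [Y, Z]^v)`. -/
theorem dInnerPresymp_cyclic {φ : Fields m ι κ M} (hφ : φ ∈ L.fieldSpace M)
    (X Y Z : DiffAlg (m + 2) M) :
    L.dInnerPresymp X Y Z φ + L.dInnerPresymp Y Z X φ + L.dInnerPresymp Z X Y φ =
      L.presymp φ (vert X.field φ) (vert ⁅Y, Z⁆.field φ) +
      L.presymp φ (vert Y.field φ) (vert ⁅Z, X⁆.field φ) +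
      L.presymp φ (vert Z.field φ) (vert ⁅X, Y⁆.field φ) := by
  have hs := hφ.1
  rw [L.dInnerPresymp_eq hφ, L.dInnerPresymp_eq hφ, L.dInnerPresymp_eq hφ, vert_vert X Y hs,
    vert_vert Y Z hs, vert_vert Z X hs,
    L.presymp_sub_left hφ ((hs.vert X).vert Y) (hs.vert _) (hs.vert Z),
    L.presymp_sub_left hφ ((hs.vert Y).vert Z) (hs.vert _) (hs.vert X),
    L.presymp_sub_left hφ ((hs.vert Z).vert X) (hs.vert _) (hs.vert Y),
    L.presymp_swap φ (vert X.field φ) (vert ⁅Y, Z⁆.field φ),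
    L.presymp_swap φ (vert Y.field φ) (vert ⁅Z, X⁆.field φ),
    L.presymp_swap φ (vert Z.field φ) (vert ⁅X, Y⁆.field φ)]
  -- The second Lie derivatives already combine to commutators, which are the right-hand side. The
  -- derivatives of the coefficients of `Θ` occur twice in each cyclic position and sum to zero
  -- because `Θ` is closed.
  have hc := L.dPresymp_cyclic hφ (vert X.field φ) (vert Y.field φ) (vert Z.field φ)
  rw [L.dPresymp_swap φ (vert Y.field φ) (vert X.field φ) (vert Z.field φ),
    L.dPresymp_swap φ (vert Z.field φ) (vert Y.field φ) (vert X.field φ),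
    L.dPresymp_swap φ (vert X.field φ) (vert Z.field φ) (vert Y.field φ),
    eq_neg_of_add_eq_zero_right hc]
  abel

end Lagrangian

end Closed

/-! ### Integrals depending smoothly on parameters -/

section Parametric

open MeasureTheory

variable {P E F : Type} [NormedAddCommGroup P] [NormedSpace ℝ P] [NormedAddCommGroup E]
  [NormedSpace ℝ E] [FiniteDimensional ℝ E] [MeasurableSpace E] [BorelSpace E]
  [NormedAddCommGroup F] [NormedSpace ℝ F] {μ : Measure E} [IsFiniteMeasureOnCompacts μ]
  {K : Set E}

theorem continuousOn_slice {g : P × E → F} {r : P} (h : ∀ t ∈ K, ContinuousAt g (r, t)) :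
    ContinuousOn (fun t => g (r, t)) K := fun t ht =>
  (ContinuousAt.comp (g := g) (f := fun t => (r, t)) (h t ht)
    (continuousAt_const.prodMk continuousAt_id)).continuousWithinAt

theorem eventually_norm_le (hK : IsCompact K) {g : P × E → F} {s : P}
    (hg : ∀ t ∈ K, ContinuousAt g (s, t)) : ∃ C : ℝ, ∀ᶠ r in 𝓝 s, ∀ t ∈ K, ‖g (r, t)‖ ≤ C := by
  obtain ⟨C, hC⟩ := hK.exists_bound_of_continuousOn (continuousOn_slice hg)
  -- The margin makes the bound on the slice at `s` strict, hence stable near each of its points;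
  -- compactness of `K` makes it uniform in `t`.
  refine ⟨C + 1, hK.eventually_forall_of_forall_eventually fun t ht => ?_⟩
  have hlt : ‖g (s, t)‖ < C + 1 := (hC t ht).trans_lt (lt_add_one C)
  have h := (hg t ht).norm.tendsto.eventually_lt_const hlt
  exact h.mono fun z hz => hz.le

theorem continuousAt_setIntegral (hK : IsCompact K) {g : P × E → F} {s : P}
    (hg : ∀ᶠ r in 𝓝 s, ∀ t ∈ K, ContinuousAt g (r, t)) :
    ContinuousAt (fun r => ∫ t in K, g (r, t) ∂μ) s := by
  obtain ⟨C, hC⟩ := eventually_norm_le hK hg.self_of_nhds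
  refine continuousAt_of_dominated (bound := fun _ => C) ?_ ?_ ?_ ?_
  · filter_upwards [hg] with r hr
    exact ((continuousOn_slice hr).integrableOn_compact (μ := μ) hK).aestronglyMeasurable
  · filter_upwards [hC] with r hr
    exact (ae_restrict_mem hK.measurableSet).mono fun t ht => hr t ht
  · exact (continuousOn_const (c := C)).integrableOn_compact (μ := μ) hK
  · refine (ae_restrict_mem hK.measurableSet).mono fun t ht => ?_
    exact ContinuousAt.comp (g := g) (f := fun r => (r, t)) (hg.self_of_nhds t ht)
      (continuousAt_id.prodMk continuousAt_const)

theorem hasFDerivAt_setIntegral (hK : IsCompact K) {g : P × E → F} {s : P}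
    (hg : ∀ t ∈ K, ContDiffAt ℝ 1 g (s, t)) :
    HasFDerivAt (fun r => ∫ t in K, g (r, t) ∂μ)
      (∫ t in K, fderiv ℝ g (s, t) ∘L ContinuousLinearMap.inl ℝ P E ∂μ) s := by
  have hev : ∀ᶠ r in 𝓝 s, ∀ t ∈ K, ContDiffAt ℝ 1 g (r, t) :=
    hK.eventually_forall_of_forall_eventually fun t ht => (hg t ht).eventually (by simp)
  have hc : ∀ t ∈ K, ContinuousAt (fun z => fderiv ℝ g z ∘L ContinuousLinearMap.inl ℝ P E) (s, t) :=
    fun t ht => (((hg t ht).fderiv_right (m := 0) (by simp)).clm_comp contDiffAt_const).continuousAt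
  obtain ⟨C, hC⟩ := eventually_norm_le hK hc
  refine hasFDerivAt_integral_of_dominated_of_fderiv_le
    (F' := fun r t => fderiv ℝ g (r, t) ∘L ContinuousLinearMap.inl ℝ P E)
    (s := {r | (∀ t ∈ K, ContDiffAt ℝ 1 g (r, t)) ∧
      ∀ t ∈ K, ‖fderiv ℝ g (r, t) ∘L ContinuousLinearMap.inl ℝ P E‖ ≤ C})
    (bound := fun _ => C) (hev.and hC) ?_ ?_ ?_ ?_ ?_ ?_
  · filter_upwards [hev] with r hr
    exact ((continuousOn_slice fun t ht => (hr t ht).continuousAt).integrableOn_compact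
      (μ := μ) hK).aestronglyMeasurable
  · exact (continuousOn_slice fun t ht => (hg t ht).continuousAt).integrableOn_compact hK
  · exact ((continuousOn_slice hc).integrableOn_compact (μ := μ) hK).aestronglyMeasurable
  · exact (ae_restrict_mem hK.measurableSet).mono fun t ht r hr => hr.2 t ht
  · exact (continuousOn_const (c := C)).integrableOn_compact (μ := μ) hK
  · refine (ae_restrict_mem hK.measurableSet).mono fun t ht r hr => ?_
    exact HasFDerivAt.comp (g := g) (f := fun r => (r, t)) r
      ((hr.1 t ht).differentiableAt (by simp)).hasFDerivAt (hasFDerivAt_prodMk_left r t)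

/-- Induction on the order of differentiability: the derivative is again an integral of this kind.
Its integrand takes values in `P →L[ℝ] F`, so the target space is generalised in the induction. -/
theorem contDiffAt_setIntegral_nat (hK : IsCompact K) (N : ℕ) : ∀ {F : Type}
    [NormedAddCommGroup F] [NormedSpace ℝ F] {g : P × E → F} {s : P},
    (∀ t ∈ K, ContDiffAt ℝ N g (s, t)) →
      ContDiffAt ℝ N (fun r => ∫ t in K, g (r, t) ∂μ) s := by
  induction N with
  | zero =>
    intro F _ _ g s hg
    have h1 : ∀ᶠ r in 𝓝 s, ∀ t ∈ K, ContinuousAt g (r, t) :=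
      hK.eventually_forall_of_forall_eventually fun t ht =>
        ((hg t ht).eventually (by simp)).mono fun z hz => hz.continuousAt
    refine contDiffAt_zero.2 ⟨_, h1.eventually_nhds, fun r hr => ?_⟩
    exact (continuousAt_setIntegral hK hr).continuousWithinAt
  | succ N ih =>
    intro F _ _ g s hg
    refine contDiffAt_succ_iff_hasFDerivAt.2
      ⟨fun r => ∫ t in K, fderiv ℝ g (r, t) ∘L ContinuousLinearMap.inl ℝ P E ∂μ,
        ⟨{r | ∀ t ∈ K, ContDiffAt ℝ 1 g (r, t)}, ?_, fun r hr =>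
          hasFDerivAt_setIntegral hK hr⟩, ?_⟩
    · exact hK.eventually_forall_of_forall_eventually fun t ht =>
        ((hg t ht).of_le (by exact_mod_cast Nat.le_add_left 1 N)).eventually (by simp)
    · exact ih (g := fun z => fderiv ℝ g z ∘L ContinuousLinearMap.inl ℝ P E) fun t ht =>
        ((hg t ht).fderiv_right (m := (N : WithTop ℕ∞)) (by simp)).clm_comp contDiffAt_const

theorem contDiffAt_setIntegral (hK : IsCompact K) {g : P × E → F} {s : P}
    (hg : ∀ t ∈ K, ContDiffAt ℝ ∞ g (s, t)) :
    ContDiffAt ℝ ∞ (fun r => ∫ t in K, g (r, t) ∂μ) s :=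
  contDiffAt_infty.2 fun N => contDiffAt_setIntegral_nat hK N fun t ht =>
    (contDiffAt_infty.1 (hg t ht)) N

end Parametric

/-! ### Integration over chains -/

section Chains

open MeasureTheory

variable {n k l : ℕ} {M : Type*} [TopologicalSpace M] [ChartedSpace (Vec n) M]

/-- The pullback of a form to the parameter space of a cube. -/
def Cube.pull (σ : Cube n k M) (w : Form n M l) (t : Fin k → ℝ) :
    (Fin k → ℝ) [⋀^Fin l]→L[ℝ] ℝ :=
  (w (σ.map t)).compContinuousLinearMap
    (mfderiv 𝓘(ℝ, Fin k → ℝ) (𝓡 n) σ.map t : (Fin k → ℝ) →L[ℝ] Vec n)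

theorem Cube.integral_eq (σ : Cube n k M) (w : Form n M k) : σ.integral w =
    ∫ t in Icc (0 : Fin k → ℝ) 1, σ.pull w t (fun j => Pi.single j 1) := rfl

/-- The expression of a cube in the preferred chart at `p`. -/
def Cube.chart (σ : Cube n k M) (p : M) (t : Fin k → ℝ) : Vec n := extChartAt (𝓡 n) p (σ.map t)

theorem Cube.eventually_source (σ : Cube n k M) (t₀ : Fin k → ℝ) :
    ∀ᶠ t in 𝓝 t₀, σ.map t ∈ (extChartAt (𝓡 n) (σ.map t₀)).source :=
  σ.smooth.continuous.continuousAt.eventually (extChartAt_source_mem_nhds _)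

variable [IsManifold (𝓡 n) ∞ M]

theorem Cube.contDiffAt_chart (σ : Cube n k M) {p : M} {t : Fin k → ℝ}
    (ht : σ.map t ∈ (extChartAt (𝓡 n) p).source) : ContDiffAt ℝ ∞ (σ.chart p) t := by
  rw [extChartAt_source] at ht
  exact ((contMDiffAt_extChartAt' ht).comp t (σ.smooth t)).contDiffAt

theorem Cube.mfderiv_eq (σ : Cube n k M) {p : M} {t : Fin k → ℝ}
    (ht : σ.map t ∈ (extChartAt (𝓡 n) p).source) :
    (mfderiv 𝓘(ℝ, Fin k → ℝ) (𝓡 n) σ.map t : (Fin k → ℝ) →L[ℝ] Vec n) =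
      fderiv ℝ (transMap p (σ.map t)) (σ.chart p t) ∘L fderiv ℝ (σ.chart p) t := by
  have h : MDifferentiableAt 𝓘(ℝ, Fin k → ℝ) (𝓡 n) σ.map t :=
    (σ.smooth t).mdifferentiableAt (by simp)
  have ho : σ.chart p t ∈ overlap p (σ.map t) := by
    refine ⟨(extChartAt (𝓡 n) p).map_source ht, ?_⟩
    rw [mem_preimage, Cube.chart, (extChartAt (𝓡 n) p).left_inv ht]
    exact mem_extChartAt_source _
  have h1 : (fun z => extChartAt (𝓡 n) (σ.map t) (σ.map z)) =ᶠ[𝓝 t]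
      transMap p (σ.map t) ∘ σ.chart p := by
    filter_upwards [σ.smooth.continuous.continuousAt.eventually
      ((isOpen_extChartAt_source p).mem_nhds ht)] with z hz
    rw [Function.comp, transMap, Cube.chart, (extChartAt (𝓡 n) p).left_inv hz]
  refine h.mfderiv.trans ?_
  rw [ModelWithCorners.range_eq_univ, fderivWithin_univ]
  refine Eq.trans ?_ (fderiv_comp t (differentiableAt_transMap ho)
    ((σ.contDiffAt_chart ht).differentiableAt (by simp)))
  exact h1.fderiv_eq

theorem Cube.pull_eq (σ : Cube n k M) {p : M} {t : Fin k → ℝ}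
    (ht : σ.map t ∈ (extChartAt (𝓡 n) p).source) (w : Form n M l) :
    σ.pull w t = (chartRep w p (σ.chart p t)).compContinuousLinearMap
      (fderiv ℝ (σ.chart p) t) := by
  have hy : σ.chart p t ∈ (extChartAt (𝓡 n) p).target := (extChartAt (𝓡 n) p).map_source ht
  have hs : (extChartAt (𝓡 n) p).symm (σ.chart p t) = σ.map t := (extChartAt (𝓡 n) p).left_inv ht
  rw [Cube.pull, σ.mfderiv_eq ht, chartRep_apply _ hy, hs]
  rfl

theorem Cube.contDiffAt_pull (σ : Cube n k M) {P : Type*} [NormedAddCommGroup P] [NormedSpace ℝ P]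
    {u : P → Form n M l} {s : P} {t : Fin k → ℝ} (hu : SmoothFamilyAt u s (σ.map t)) :
    ContDiffAt ℝ ∞ (fun z : P × (Fin k → ℝ) => σ.pull (u z.1) z.2) (s, t) := by
  have ht := mem_extChartAt_source (I := 𝓡 n) (σ.map t)
  have hc := σ.contDiffAt_chart ht
  have h1 : ContDiffAt ℝ ∞ (fun z : P × (Fin k → ℝ) =>
      (chartRep (u z.1) (σ.map t) (σ.chart (σ.map t) z.2)).compContinuousLinearMap
        (fderiv ℝ (σ.chart (σ.map t)) z.2)) (s, t) := by
    refine contDiffAt_compContinuousLinearMap ?_ ?_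
    · exact ContDiffAt.comp (g := fun z : P × Vec n => chartRep (u z.1) (σ.map t) z.2)
        (f := fun z : P × (Fin k → ℝ) => (z.1, σ.chart (σ.map t) z.2)) (s, t) hu
        (contDiffAt_fst.prodMk (ContDiffAt.comp (g := σ.chart (σ.map t))
          (f := fun z : P × (Fin k → ℝ) => z.2) (s, t) hc contDiffAt_snd))
    · exact ContDiffAt.comp (g := fderiv ℝ (σ.chart (σ.map t)))
        (f := fun z : P × (Fin k → ℝ) => z.2) (s, t)
        (hc.fderiv_right (m := ∞) (by simp)) contDiffAt_snd
  refine h1.congr_of_eventuallyEq ?_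
  filter_upwards [continuousAt_snd.eventually (σ.eventually_source t)] with z hz
  exact σ.pull_eq hz _

theorem Cube.contDiffAt_pull_const (σ : Cube n k M) {w : Form n M l} {t : Fin k → ℝ}
    (hw : SmAt w (σ.map t)) : ContDiffAt ℝ ∞ (σ.pull w) t :=
  ContDiffAt.comp (g := fun z : ℝ × (Fin k → ℝ) => σ.pull w z.2) (f := fun t => ((0 : ℝ), t)) t
    (σ.contDiffAt_pull (hw.const (0 : ℝ))) (contDiffAt_const.prodMk contDiffAt_id)

theorem Cube.pull_extD (σ : Cube n k M) {w : Form n M l} {t : Fin k → ℝ}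
    (hw : SmAt w (σ.map t)) : σ.pull (extD w) t = extDeriv (σ.pull w) t := by
  have ht := mem_extChartAt_source (I := 𝓡 n) (σ.map t)
  have h1 : σ.pull w =ᶠ[𝓝 t] fun z =>
      (chartRep w (σ.map t) (σ.chart (σ.map t) z)).compContinuousLinearMap
        (fderiv ℝ (σ.chart (σ.map t)) z) := by
    filter_upwards [σ.eventually_source t] with z hz
    exact σ.pull_eq hz _
  rw [h1.extDeriv_eq, σ.pull_eq ht,
    CovPhase.chartRep_extD (y := σ.chart (σ.map t) t)
      ((extChartAt (𝓡 n) (σ.map t)).map_source ht) hw.differentiableAt]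
  exact (extDeriv_pullback (f := σ.chart (σ.map t)) hw.differentiableAt (σ.contDiffAt_chart ht) (by
    rw [minSmoothness_of_isRCLikeNormedField]
    exact WithTop.coe_le_coe.2 (le_top : (2 : ℕ∞) ≤ ⊤))).symm

/-- The values of a pulled back form on constant vectors. -/
theorem Cube.contDiffAt_pull_apply (σ : Cube n k M) {P : Type*} [NormedAddCommGroup P]
    [NormedSpace ℝ P] {u : P → Form n M l} {s : P} {t : Fin k → ℝ}
    (hu : SmoothFamilyAt u s (σ.map t)) (v : Fin l → Fin k → ℝ) :
    ContDiffAt ℝ ∞ (fun z : P × (Fin k → ℝ) => σ.pull (u z.1) z.2 v) (s, t) :=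
  (ContinuousAlternatingMap.apply ℝ (Fin k → ℝ) ℝ v).contDiff.contDiffAt.comp (s, t)
    (σ.contDiffAt_pull hu)

theorem Cube.continuousAt_pull_apply (σ : Cube n k M) {w : Form n M l} {t : Fin k → ℝ}
    (hw : SmAt w (σ.map t)) (v : Fin l → Fin k → ℝ) :
    ContinuousAt (fun t => σ.pull w t v) t :=
  ((ContinuousAlternatingMap.apply ℝ (Fin k → ℝ) ℝ v).contDiff.contDiffAt.comp t
    (σ.contDiffAt_pull_const hw)).continuousAt

/-- The inclusion of the face is affine and sends the `j`-th basis vector to the one with index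
`i.succAbove j`, so the standard frame of the face is the frame of the cube with its `i`-th vector
removed. -/
theorem Cube.face_pull (σ : Cube n (k + 1) M) (i : Fin (k + 1)) (c : ℝ) (w : Form n M k)
    (t : Fin k → ℝ) : (σ.face i c).pull w t (fun j => Pi.single j 1) =
      σ.pull w (i.insertNth c t : Fin (k + 1) → ℝ)
        (i.removeNth fun j => (Pi.single j 1 : Fin (k + 1) → ℝ)) := by
  have h1 : MDifferentiableAt 𝓘(ℝ, Fin (k + 1) → ℝ) (𝓡 n) σ.map
      (i.insertNth c t : Fin (k + 1) → ℝ) := (σ.smooth _).mdifferentiableAt (by simp)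
  have h2 : DifferentiableAt ℝ (fun t : Fin k → ℝ => (i.insertNth c t : Fin (k + 1) → ℝ)) t :=
    (contDiff_insertNth i c).contDiffAt.differentiableAt (by simp)
  have h3 := mfderiv_comp t (I := 𝓘(ℝ, Fin k → ℝ)) h1 h2.mdifferentiableAt
  have h4 : HasFDerivAt (fun t : Fin k → ℝ => (i.insertNth c t : Fin (k + 1) → ℝ))
      (ContinuousLinearMap.pi fun j => (i.insertNth (0 : (Fin k → ℝ) →L[ℝ] ℝ)
        (fun l => ContinuousLinearMap.proj l) : Fin (k + 1) → (Fin k → ℝ) →L[ℝ] ℝ) j) t := by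
    refine hasFDerivAt_pi.2 fun j => ?_
    rcases Fin.eq_self_or_eq_succAbove i j with h | ⟨l, h⟩
    · subst h
      simpa using hasFDerivAt_const c t
    · subst h
      simpa using (hasFDerivAt_apply (𝕜 := ℝ) l t)
  change w (σ.map _) _ = w (σ.map _) _
  congr 1
  funext j
  have h6 : fderiv ℝ (fun t : Fin k → ℝ => (i.insertNth c t : Fin (k + 1) → ℝ)) t
      (Pi.single j 1) = Pi.single (i.succAbove j) 1 := by
    rw [h4.fderiv]
    ext a
    rcases Fin.eq_self_or_eq_succAbove i a with h | ⟨b, h⟩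
    · subst h
      simp [Fin.ne_succAbove]
    · subst h
      simp [Pi.single_apply]
  have h7 : (mfderiv 𝓘(ℝ, Fin k → ℝ) 𝓘(ℝ, Fin (k + 1) → ℝ)
      (fun t : Fin k → ℝ => (i.insertNth c t : Fin (k + 1) → ℝ)) t :
        (Fin k → ℝ) →L[ℝ] (Fin (k + 1) → ℝ)) (Pi.single j 1) = Pi.single (i.succAbove j) 1 :=
    (DFunLike.congr_fun mfderiv_eq_fderiv _).trans h6
  exact (DFunLike.congr_fun h3 (Pi.single j 1)).trans
    (congrArg (mfderiv 𝓘(ℝ, Fin (k + 1) → ℝ) (𝓡 n) σ.map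
      (i.insertNth c t : Fin (k + 1) → ℝ) : (Fin (k + 1) → ℝ) →L[ℝ] Vec n) h7)

/-- Stokes' theorem on a cube. -/
theorem Cube.stokes (σ : Cube n (k + 1) M) {w : Form n M k} (hw : IsSmooth w) :
    σ.integral (extD w) = ∑ i : Fin (k + 1), (-1 : ℝ) ^ (i : ℕ) *
      ((σ.face i 1).integral w - (σ.face i 0).integral w) := by
  set e : Fin (k + 1) → Fin (k + 1) → ℝ := fun j => Pi.single j 1 with he
  have hd : ∀ (i : Fin (k + 1)) (t : Fin (k + 1) → ℝ),
      DifferentiableAt ℝ (fun t => σ.pull w t (i.removeNth e)) t := fun i t =>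
    ((ContinuousAlternatingMap.apply ℝ (Fin (k + 1) → ℝ) ℝ
      (i.removeNth e)).contDiff.contDiffAt.comp t
      (σ.contDiffAt_pull_const (hw.smAt _))).differentiableAt (n := ∞) (by simp)
  have h1 : ∀ t, σ.pull (extD w) t e = ∑ i : Fin (k + 1),
      ((-1 : ℝ) ^ (i : ℕ) • fderiv ℝ (fun t => σ.pull w t (i.removeNth e)) t) (e i) := by
    intro t
    rw [σ.pull_extD (hw.smAt _), extDeriv_apply
      ((σ.contDiffAt_pull_const (hw.smAt _)).differentiableAt (by simp))]
    refine Finset.sum_congr rfl fun i _ => ?_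
    rcases Nat.even_or_odd (i : ℕ) with h | h <;> simp [h.neg_one_pow]
  -- The divergence theorem is applied to the vector field with components `(-1)^i w(…, ê_i, …)`. By
  -- `h1` its divergence is the coefficient of the pullback of `dw`, and its fluxes through opposite
  -- faces are the boundary integrals.
  have h2 := integral_divergence_of_hasFDerivAt_off_countable' (0 : Fin (k + 1) → ℝ) 1
    (fun _ => zero_le_one) (fun i t => (-1 : ℝ) ^ (i : ℕ) • σ.pull w t (i.removeNth e))
    (fun i t => (-1 : ℝ) ^ (i : ℕ) • fderiv ℝ (fun t => σ.pull w t (i.removeNth e)) t) ∅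
    countable_empty
    (fun i t _ => ((hd i t).continuousAt.const_smul ((-1 : ℝ) ^ (i : ℕ))).continuousWithinAt)
    (fun t _ i => (hd i t).hasFDerivAt.const_smul ((-1 : ℝ) ^ (i : ℕ)))
    (by
      have hc : ContinuousOn (fun t => σ.pull (extD w) t e) (Icc (0 : Fin (k + 1) → ℝ) 1) :=
        fun t _ => (σ.continuousAt_pull_apply (hw.extD.smAt _) e).continuousWithinAt
      exact (hc.congr fun t _ => (h1 t).symm).integrableOn_compact isCompact_Icc)
  rw [σ.integral_eq, integral_congr_ae (Eventually.of_forall h1)]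
  refine h2.trans (Finset.sum_congr rfl fun i _ => ?_)
  rw [MeasureTheory.integral_smul, MeasureTheory.integral_smul, ← smul_sub, smul_eq_mul,
    Cube.integral_eq,
    Cube.integral_eq]
  simp only [Cube.face_pull]
  rfl

theorem Chain.integral_add_chain (c d : Chain n k M) (w : Form n M k) :
    (c + d).integral w = c.integral w + d.integral w :=
  Finsupp.sum_add_index' (by simp) (by intros; push_cast; ring)

theorem Chain.integral_smul_chain (a : ℤ) (c : Chain n k M) (w : Form n M k) :
    (a • c).integral w = a * c.integral w := by
  unfold Chain.integral
  rw [Finsupp.sum_smul_index' (by simp), Finsupp.mul_sum]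
  refine Finsupp.sum_congr fun σ _ => ?_
  push_cast [smul_eq_mul]
  ring

theorem Chain.integral_sub_chain (c d : Chain n k M) (w : Form n M k) :
    (c - d).integral w = c.integral w - d.integral w := by
  have h := Chain.integral_add_chain (c - d) d w
  rw [sub_add_cancel] at h
  rw [h, add_sub_cancel_right]

theorem Chain.integral_sum_chain {α : Type*} (I : Finset α) (c : α → Chain n k M)
    (w : Form n M k) : (∑ i ∈ I, c i).integral w = ∑ i ∈ I, (c i).integral w := by
  classical
  induction I using Finset.induction_on with
  | empty => rfl
  | insert a I ha ih =>
    rw [Finset.sum_insert ha, Finset.sum_insert ha, Chain.integral_add_chain, ih]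

theorem Chain.integral_single (σ : Cube n k M) (a : ℤ) (w : Form n M k) :
    Chain.integral (Finsupp.single σ a) w = a * σ.integral w :=
  Finsupp.sum_single_index (by simp)

/-- Stokes' theorem. -/
theorem Chain.stokes (c : Chain n (k + 1) M) {w : Form n M k} (hw : IsSmooth w) :
    c.integral (extD w) = c.boundary.integral w := by
  unfold Chain.boundary
  rw [Finsupp.sum, Chain.integral_sum_chain]
  refine Finset.sum_congr rfl fun σ _ => ?_
  simp only
  rw [Chain.integral_smul_chain, σ.stokes hw, Cube.boundary, Chain.integral_sum_chain]
  congr 1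
  refine Finset.sum_congr rfl fun i _ => ?_
  rw [Chain.integral_smul_chain, Chain.integral_sub_chain, Chain.integral_single,
    Chain.integral_single]
  push_cast
  ring

theorem Cube.integrableOn (σ : Cube n k M) {w : Form n M k}
    (hw : ∀ t ∈ Icc (0 : Fin k → ℝ) 1, SmAt w (σ.map t)) :
    IntegrableOn (fun t => σ.pull w t (fun j => Pi.single j 1)) (Icc (0 : Fin k → ℝ) 1) := by
  have h : ContinuousOn (fun t => σ.pull w t (fun j => Pi.single j 1)) (Icc (0 : Fin k → ℝ) 1) :=
    fun t ht => (σ.continuousAt_pull_apply (hw t ht) _).continuousWithinAt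
  exact h.integrableOn_compact isCompact_Icc

theorem Chain.mem_carrier {c : Chain n k M} {σ : Cube n k M} (hσ : σ ∈ c.support)
    {t : Fin k → ℝ} (ht : t ∈ Icc (0 : Fin k → ℝ) 1) : σ.map t ∈ c.carrier :=
  ⟨σ, hσ, t, ht, rfl⟩

theorem Chain.integral_add (c : Chain n k M) {w v : Form n M k} (hw : ∀ x ∈ c.carrier, SmAt w x)
    (hv : ∀ x ∈ c.carrier, SmAt v x) : c.integral (w + v) = c.integral w + c.integral v := by
  unfold Chain.integral
  rw [← Finsupp.sum_add]
  refine Finsupp.sum_congr fun σ hσ => ?_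
  rw [← mul_add]
  congr 1
  exact MeasureTheory.integral_add (σ.integrableOn fun t ht => hw _ (Chain.mem_carrier hσ ht))
    (σ.integrableOn fun t ht => hv _ (Chain.mem_carrier hσ ht))

theorem Chain.integral_smul (c : Chain n k M) (r : ℝ) (w : Form n M k) :
    c.integral (r • w) = r * c.integral w := by
  unfold Chain.integral
  rw [Finsupp.mul_sum]
  refine Finsupp.sum_congr fun σ hσ => ?_
  have h : σ.integral (r • w) = r * σ.integral w := MeasureTheory.integral_const_mul r _
  rw [h]
  ring

theorem Chain.integral_neg (c : Chain n k M) (w : Form n M k) :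
    c.integral (-w) = -c.integral w := by
  simpa using c.integral_smul (-1) w

theorem Chain.integral_sub (c : Chain n k M) {w v : Form n M k} (hw : ∀ x ∈ c.carrier, SmAt w x)
    (hv : ∀ x ∈ c.carrier, SmAt v x) : c.integral (w - v) = c.integral w - c.integral v := by
  have hv' : ∀ x ∈ c.carrier, SmAt (-v) x := fun x hx => (((hv x hx).const (0 : ℝ)).neg).smAt
  rw [sub_eq_add_neg, Chain.integral_add c hw hv', Chain.integral_neg, ← sub_eq_add_neg]

theorem Chain.integral_congr (c : Chain n k M) {w v : Form n M k} (h : ∀ x ∈ c.carrier, w x = v x) :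
    c.integral w = c.integral v := by
  unfold Chain.integral
  refine Finsupp.sum_congr fun σ hσ => ?_
  congr 1
  refine setIntegral_congr_fun measurableSet_Icc fun t ht => ?_
  simp only [h _ (Chain.mem_carrier hσ ht)]

theorem Chain.contDiffAt_integral (c : Chain n k M) {P : Type} [NormedAddCommGroup P]
    [NormedSpace ℝ P] {u : P → Form n M k} {s : P} (hu : ∀ x ∈ c.carrier, SmoothFamilyAt u s x) :
    ContDiffAt ℝ ∞ (fun r => c.integral (u r)) s := by
  unfold Chain.integral Finsupp.sum
  refine ContDiffAt.sum fun σ hσ => ContDiffAt.mul contDiffAt_const ?_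
  exact contDiffAt_setIntegral (g := fun z : P × (Fin k → ℝ) => σ.pull (u z.1) z.2
    (fun j => Pi.single j 1)) isCompact_Icc
    fun t ht => σ.contDiffAt_pull_apply (hu _ (Chain.mem_carrier hσ ht)) _

/-- Differentiation under the integral sign. -/
theorem Chain.hasFDerivAt_integral (c : Chain n k M) {P : Type} [NormedAddCommGroup P]
    [NormedSpace ℝ P] {u : P → Form n M k} {s : P} (hu : ∀ x ∈ c.carrier, SmoothFamilyAt u s x)
    (v : P) : fderiv ℝ (fun r => c.integral (u r)) s v = c.integral (parDeriv u v s) := by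
  have key : ∀ σ ∈ c.support, HasFDerivAt (fun r => σ.integral (u r))
      (∫ t in Icc (0 : Fin k → ℝ) 1, fderiv ℝ (fun z : P × (Fin k → ℝ) => σ.pull (u z.1) z.2
        (fun j => Pi.single j 1)) (s, t) ∘L ContinuousLinearMap.inl ℝ P (Fin k → ℝ)) s :=
    fun σ hσ => hasFDerivAt_setIntegral (g := fun z : P × (Fin k → ℝ) => σ.pull (u z.1) z.2
      (fun j => Pi.single j 1)) isCompact_Icc fun t ht =>
        (σ.contDiffAt_pull_apply (hu _ (Chain.mem_carrier hσ ht)) _).of_le (by simp)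
  have h1 : HasFDerivAt (fun r => c.integral (u r)) (∑ σ ∈ c.support, (c σ : ℝ) •
      ∫ t in Icc (0 : Fin k → ℝ) 1, fderiv ℝ (fun z : P × (Fin k → ℝ) => σ.pull (u z.1) z.2
        (fun j => Pi.single j 1)) (s, t) ∘L ContinuousLinearMap.inl ℝ P (Fin k → ℝ)) s :=
    HasFDerivAt.fun_sum fun σ hσ => (key σ hσ).const_mul (c σ : ℝ)
  rw [h1.fderiv, sum_apply]
  refine Finset.sum_congr rfl fun σ hσ => ?_
  rw [smul_apply, smul_eq_mul]
  congr 1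
  have hc : ContinuousOn (fun t => fderiv ℝ (fun z : P × (Fin k → ℝ) => σ.pull (u z.1) z.2
        (fun j => Pi.single j 1)) (s, t) ∘L ContinuousLinearMap.inl ℝ P (Fin k → ℝ))
      (Icc (0 : Fin k → ℝ) 1) := by
    refine continuousOn_slice (g := fun z => fderiv ℝ (fun z : P × (Fin k → ℝ) =>
      σ.pull (u z.1) z.2 (fun j => Pi.single j 1)) z ∘L ContinuousLinearMap.inl ℝ P (Fin k → ℝ))
      fun t ht => ?_
    exact (((σ.contDiffAt_pull_apply (hu _ (Chain.mem_carrier hσ ht)) _).fderiv_right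
      (m := 0) (by simp)).clm_comp contDiffAt_const).continuousAt
  -- Evaluation at `v` is moved inside the integral. The integrands then agree because the pullback
  -- by a fixed cube at a fixed `t` is linear in the form.
  rw [ContinuousLinearMap.integral_apply (hc.integrableOn_compact isCompact_Icc)]
  refine setIntegral_congr_fun measurableSet_Icc fun t ht => ?_
  have hx := hu _ (Chain.mem_carrier hσ ht)
  have h2 : HasFDerivAt (fun r => σ.pull (u r) t (fun j => Pi.single j 1))
      (fderiv ℝ (fun z : P × (Fin k → ℝ) => σ.pull (u z.1) z.2
        (fun j => Pi.single j 1)) (s, t) ∘L ContinuousLinearMap.inl ℝ P (Fin k → ℝ)) s :=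
    HasFDerivAt.comp (g := fun z : P × (Fin k → ℝ) => σ.pull (u z.1) z.2
      (fun j => Pi.single j 1)) (f := fun r => (r, t)) s
      ((σ.contDiffAt_pull_apply hx _).differentiableAt (by simp)).hasFDerivAt
      (hasFDerivAt_prodMk_left s t)
  have h3 : HasFDerivAt (fun r => σ.pull (u r) t (fun j => Pi.single j 1))
      (ContinuousAlternatingMap.apply ℝ (Vec n) ℝ (fun j =>
        (mfderiv 𝓘(ℝ, Fin k → ℝ) (𝓡 n) σ.map t : (Fin k → ℝ) →L[ℝ] Vec n) (Pi.single j 1)) ∘L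
        fderiv ℝ (fun r => u r (σ.map t)) s) s :=
    (ContinuousAlternatingMap.apply ℝ (Vec n) ℝ (fun j =>
        (mfderiv 𝓘(ℝ, Fin k → ℝ) (𝓡 n) σ.map t : (Fin k → ℝ) →L[ℝ] Vec n)
          (Pi.single j 1))).hasFDerivAt.comp s hx.differentiableAt.hasFDerivAt
  exact DFunLike.congr_fun (h2.unique h3) v

end Chains

/-! ### The charges -/

section Charges

variable {n k : ℕ}

/-- At a fixed point the chart expression differs from the form by a linear automorphism independent
of the parameter. Hence parameter derivatives exist at all nearby points, where they have to be
compared with one-variable derivatives. -/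
theorem SmoothFamilyAt.eventually_differentiableAt {M : Type*} [TopologicalSpace M]
    [ChartedSpace (Vec n) M] [IsManifold (𝓡 n) ∞ M] {P : Type*} [NormedAddCommGroup P]
    [NormedSpace ℝ P] {u : P → Form n M k} {s : P} {p : M} (hu : SmoothFamilyAt u s p) :
    ∀ᶠ z : P × M in 𝓝 (s, p), DifferentiableAt ℝ (fun r => u r z.2) z.1 := by
  have h1 : ContDiffAt ℝ 1 (fun z : P × Vec n => chartRep (u z.1) p z.2)
      (s, extChartAt (𝓡 n) p p) := ContDiffAt.of_le hu (by simp)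
  have h2 : ∀ᶠ z : P × Vec n in 𝓝 (s, extChartAt (𝓡 n) p p),
      DifferentiableAt ℝ (fun r => u r ((extChartAt (𝓡 n) p).symm z.2)) z.1 := by
    filter_upwards [h1.eventually (by simp), eventually_target s p] with z hz hz'
    have h3 : DifferentiableAt ℝ (fun r => chartRep (u r) p z.2) z.1 :=
      DifferentiableAt.comp (g := fun z : P × Vec n => chartRep (u z.1) p z.2)
        (f := fun r => (r, z.2)) z.1 (hz.differentiableAt (by simp))
        (differentiableAt_id.prodMk (differentiableAt_const _))
    have h4 : (fun r => chartRep (u r) p z.2) =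
        (altPullEquiv (k := k) (transEquiv (mem_overlap_symm hz'))) ∘
          fun r => u r ((extChartAt (𝓡 n) p).symm z.2) :=
      funext fun r => chartRep_apply _ hz'
    rw [h4] at h3
    exact (ContinuousLinearEquiv.comp_differentiableAt_iff _).1 h3
  have h5 : Tendsto (fun z : P × M => (z.1, extChartAt (𝓡 n) p z.2)) (𝓝 (s, p))
      (𝓝 (s, extChartAt (𝓡 n) p p)) :=
    (continuousAt_fst.prodMk (ContinuousAt.comp (f := fun z : P × M => z.2) (x := (s, p))
      (continuousAt_extChartAt (I := 𝓡 n) p) continuousAt_snd)).tendsto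
  filter_upwards [h5.eventually h2, continuousAt_snd.eventually
    (extChartAt_source_mem_nhds (I := 𝓡 n) p)] with z hz hz'
  rwa [(extChartAt (𝓡 n) p).left_inv hz'] at hz

variable {m : ℕ} {ι κ : Type*} [Fintype ι] [Fintype κ]
  {M : Type*} [TopologicalSpace M] [ChartedSpace (Vec (m + 2)) M]
  {P : Type*} [NormedAddCommGroup P] [NormedSpace ℝ P]

theorem dFormFun_eq_parDeriv (F : Fields m ι κ M → Form (m + 2) M k) (φ δφ : Fields m ι κ M) :
    dFormFun F φ δφ = parDeriv (fun t : ℝ => F (φ + t • δφ)) 1 0 :=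
  funext fun _ => fderiv_apply_one_eq_deriv.symm

variable [IsManifold (𝓡 (m + 2)) ∞ M]

theorem SmoothFields.line {φ δφ : Fields m ι κ M} (hφ : SmoothFields φ) (hδ : SmoothFields δφ) :
    SmoothFamily (fun t : ℝ => φ + t • δφ) :=
  smoothFamily_iff.2 fun s p => (hφ.const s p).add (.smul contDiffAt_id (hδ.const s p))

/-- Locality is formulated with parameters in `Fin q → ℝ`; the line is a family with `q = 1`,
reparametrised by `t ↦ fun _ => t`. -/
theorem Lagrangian.IsLocalFunctional.line {L : Lagrangian m ι κ}
    {F : Fields m ι κ M → Form (m + 2) M k} (hF : L.IsLocalFunctional F) {φ δφ : Fields m ι κ M}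
    (hφ : SmoothFields φ) (hδ : SmoothFields δφ) {p : M} (hj : jet φ p ∈ L.dom) :
    SmoothFamilyAt (fun t : ℝ => F (φ + t • δφ)) 0 p := by
  have hu : SmoothFamily (fun r : Fin 1 → ℝ => φ + r 0 • δφ) := smoothFamily_iff.2 fun s p =>
    (hφ.const s p).add (.smul (contDiff_apply ℝ ℝ (0 : Fin 1)).contDiffAt (hδ.const s p))
  have h := hF.2 1 _ hu (fun _ => 0) p (by simpa using hj)
  exact h.comp (f := fun t : ℝ => fun _ : Fin 1 => t) (s := 0)
    (contDiff_pi.2 fun _ => contDiff_id).contDiffAt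

theorem Lagrangian.IsLocalFunctional.isSmooth {L : Lagrangian m ι κ}
    {F : Fields m ι κ M → Form (m + 2) M k} (hF : L.IsLocalFunctional F) {φ : Fields m ι κ M}
    (hφ : φ ∈ L.fieldSpace M) : IsSmooth (F φ) := by
  refine isSmooth_iff.2 fun x => ?_
  simpa using (hF.line hφ.1 hφ.1 (hφ.2 x)).smAt

variable [DecidableEq ι] [DecidableEq κ]

namespace Lagrangian

variable (L : Lagrangian m ι κ)

theorem theta_family {u v : P → Fields m ι κ M} {s : P} {p : M} (hu : FieldsAt u s p)
    (hv : FieldsAt v s p) (hj : jet (u s) p ∈ L.dom) :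
    SmoothFamilyAt (fun r => L.theta (u r) (v r)) s p := by
  simp only [theta_eq_sum]
  exact (SmoothFamilyAt.sum fun a _ => (hv.1 a).wedge ((L.isNatural_piA a).family hu hj)).add
    (.sum fun b _ => (hv.2 b).scalar_smul ((L.isNatural_piP b).family hu hj))

/-- The direction of field-space differentiation is adjoined as a further real parameter. `θ` is
jointly smooth in the enlarged parameters, and so is its derivative in the new one, restricted to
zero. -/
theorem presymp_family {u v w : P → Fields m ι κ M} {s : P} {p : M} (hu : FieldsAt u s p)
    (hv : FieldsAt v s p) (hw : FieldsAt w s p) (hj : jet (u s) p ∈ L.dom) :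
    SmoothFamilyAt (fun r => L.presymp (u r) (v r) (w r)) s p := by
  have key : ∀ {v w : P → Fields m ι κ M}, FieldsAt v s p → FieldsAt w s p →
      SmoothFamilyAt (fun r => dFormFun (fun ψ => L.theta ψ (w r)) (u r) (v r)) s p := by
    intro v w hv hw
    set U : P × ℝ → Form (m + 2) M (m + 1) := fun z => L.theta (u z.1 + z.2 • v z.1) (w z.1) with hU
    have hf : ContDiffAt ℝ ∞ (fun z : P × ℝ => z.1) (s, 0) := contDiffAt_fst
    have h1 : SmoothFamilyAt U (s, 0) p := by
      refine L.theta_family ((FieldsAt.comp (f := fun z : P × ℝ => z.1) hu hf).add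
        (.smul contDiffAt_snd (FieldsAt.comp (f := fun z : P × ℝ => z.1) hv hf)))
        (FieldsAt.comp (f := fun z : P × ℝ => z.1) hw hf) ?_
      simpa using hj
    have h2 := (h1.parDeriv ((0, 1) : P × ℝ)).comp (f := fun r : P => (r, (0 : ℝ))) (s := s)
      (contDiffAt_id.prodMk contDiffAt_const)
    refine h2.congr ?_
    have h3 : Tendsto (fun z : P × M => ((z.1, (0 : ℝ)), z.2)) (𝓝 (s, p)) (𝓝 ((s, 0), p)) :=
      ((continuousAt_fst.prodMk continuousAt_const).prodMk continuousAt_snd).tendsto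
    filter_upwards [h3.eventually h1.eventually_differentiableAt] with z hz
    have h4 : HasDerivAt (fun t : ℝ => U (z.1, t) z.2)
        (fderiv ℝ (fun r => U r z.2) (z.1, 0) (0, 1)) 0 :=
      hz.hasFDerivAt.comp_hasDerivAt 0 ((hasDerivAt_const (0 : ℝ) z.1).prodMk (hasDerivAt_id 0))
    exact h4.deriv.symm
  exact (key hv hw).sub (key hw hv)

theorem form_family {u : P → Fields m ι κ M} {s : P} {p : M} (hu : FieldsAt u s p)
    (hj : jet (u s) p ∈ L.dom) : SmoothFamilyAt (fun r => L.form (u r)) s p :=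
  L.isNatural_toFun.family hu hj

variable {γ : DiffAlg (m + 2) M →ₗ[ℝ] (Fields m ι κ M → Form (m + 2) M m)}

theorem current_family (X : DiffAlg (m + 2) M) {u : P → Fields m ι κ M} {s : P} {p : M}
    (hu : FieldsAt u s p) (hγ : SmoothFamilyAt (fun r => γ X (u r)) s p)
    (hj : jet (u s) p ∈ L.dom) : SmoothFamilyAt (fun r => L.current γ X (u r)) s p :=
  ((L.theta_family hu (hu.vert X) hj).sub ((L.form_family hu hj).iprod X)).sub hγ.extD

theorem thetaLow_family (X : DiffAlg (m + 2) M) {u : P → Fields m ι κ M} {s : P} {p : M}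
    (hu : FieldsAt u s p) (hj : jet (u s) p ∈ L.dom) :
    SmoothFamilyAt (fun r => L.thetaLow (u r) (innerField X.field (u r))) s p := by
  simp only [thetaLow_eq_sum]
  exact SmoothFamilyAt.sum fun a _ =>
    ((hu.1 a).iprod X).scalar_smul ((L.isNatural_piA a).family hu hj)

theorem eulerLow_family (X : DiffAlg (m + 2) M) {u : P → Fields m ι κ M} {s : P} {p : M}
    (hu : FieldsAt u s p) (hj : jet (u s) p ∈ L.dom) :
    SmoothFamilyAt (fun r => L.eulerLow (u r) (innerField X.field (u r))) s p := by
  simp only [eulerLow_eq_sum]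
  exact SmoothFamilyAt.sum fun a _ => ((hu.1 a).iprod X).scalar_smul
    (((L.isNatural_lamA a).family hu hj).add ((L.isNatural_piA a).family hu hj).extD)

theorem cocycleForm_family (X Y : DiffAlg (m + 2) M) {u : P → Fields m ι κ M} {s : P} {p : M}
    (hu : FieldsAt u s p) (hγ : SmoothFamilyAt (fun r => γ ⁅X, Y⁆ (u r)) s p)
    (hj : jet (u s) p ∈ L.dom) : SmoothFamilyAt (fun r => L.cocycleForm γ X Y (u r)) s p :=
  ((((((L.thetaLow_family Y hu hj).lieD X).sub ((L.thetaLow_family X hu hj).lieD Y)).add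
    (((L.form_family hu hj).iprod Y).iprod X)).add hγ).add
    ((L.eulerLow_family X hu hj).iprod Y)).sub ((L.eulerLow_family Y hu hj).iprod X)

theorem isSmooth_presymp {φ δ₁ δ₂ : Fields m ι κ M} (hφ : φ ∈ L.fieldSpace M)
    (h₁ : SmoothFields δ₁) (h₂ : SmoothFields δ₂) : IsSmooth (L.presymp φ δ₁ δ₂) :=
  .of_const fun x => L.presymp_family (hφ.1.const _ x) (h₁.const _ x) (h₂.const _ x) (hφ.2 x)

theorem isSmooth_current (hγ : ∀ X, L.IsLocalFunctional (γ X)) {φ : Fields m ι κ M}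
    (hφ : φ ∈ L.fieldSpace M) (X : DiffAlg (m + 2) M) : IsSmooth (L.current γ X φ) :=
  .of_const fun x => L.current_family X (hφ.1.const _ x) (((hγ X).isSmooth hφ).const _ x) (hφ.2 x)

theorem isSmooth_cocycleForm (hγ : ∀ X, L.IsLocalFunctional (γ X)) {φ : Fields m ι κ M}
    (hφ : φ ∈ L.fieldSpace M) (X Y : DiffAlg (m + 2) M) : IsSmooth (L.cocycleForm γ X Y φ) :=
  .of_const fun x => L.cocycleForm_family X Y (hφ.1.const _ x) (((hγ _).isSmooth hφ).const _ x)
    (hφ.2 x)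

theorem isSmooth_dFormFun_presymp {φ η δ : Fields m ι κ M} (hφ : φ ∈ L.fieldSpace M)
    (hη : SmoothFields η) (hδ : SmoothFields δ) (X : DiffAlg (m + 2) M) :
    IsSmooth (dFormFun (fun ψ => L.presymp ψ (vert X.field ψ) δ) φ η) := by
  rw [dFormFun_eq_parDeriv]
  refine isSmooth_iff.2 fun x => (SmoothFamilyAt.parDeriv 1 ?_).smAt
  have hu := smoothFamily_iff.1 (hφ.1.line hη) 0 x
  exact L.presymp_family hu (hu.vert X) (hδ.const _ x) (by simpa using hφ.2 x)

theorem isSmooth_dInnerPresymp {φ : Fields m ι κ M} (hφ : φ ∈ L.fieldSpace M)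
    (X Y Z : DiffAlg (m + 2) M) : IsSmooth (L.dInnerPresymp X Y Z φ) :=
  (L.isSmooth_dFormFun_presymp hφ (hφ.1.vert Y) (hφ.1.vert Z) X).sub
    (L.isSmooth_dFormFun_presymp hφ (hφ.1.vert Z) (hφ.1.vert Y) X)

variable (S : Chain (m + 2) (m + 1) M)

/-- The bracket of charges, off shell. -/
theorem chargeBracket_eq (hγ : ∀ X, L.IsLocalFunctional (γ X)) {φ : Fields m ι κ M}
    (hφ : φ ∈ L.fieldSpace M) (X Y : DiffAlg (m + 2) M) :
    L.chargeBracket S X Y φ = L.charge γ S ⁅X, Y⁆ φ + L.cocycle γ S X Y φ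
        + S.integral (iprod Y.field (L.euler φ (vert X.field φ))
            - iprod X.field (L.euler φ (vert Y.field φ))) := by
  have h1 := (L.isSmooth_current hγ hφ ⁅X, Y⁆)
  have h2 := (L.isSmooth_cocycleForm hγ hφ X Y)
  have h3 := ((L.isSmooth_euler hφ (hφ.1.vert X)).iprod Y).sub
    ((L.isSmooth_euler hφ (hφ.1.vert Y)).iprod X)
  rw [chargeBracket, presympInt, L.presymp_vert_vert_eq γ hφ X Y ((hγ _).isSmooth hφ),
    S.integral_add (fun x _ => (h1.add h2.extD).smAt x) (fun x _ => h3.smAt x),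
    S.integral_add (fun x _ => h1.smAt x) (fun x _ => h2.extD.smAt x), S.stokes h2]
  rfl

theorem eulerA_eq_zero {φ : Fields m ι κ M} (hφ : φ ∈ L.solutions M) (a : ι) :
    L.eulerA φ a = 0 := by
  funext x
  refine eq_zero_of_wedge_eq_zero (by omega) _ fun α => ?_
  -- The variation has the same components `α` in every preferred trivialisation and need not be
  -- smooth. It is allowed because `solutions` asks for `E = 0` on all variations.
  have h := congrFun (hφ.2 (Pi.single a fun _ => α, 0)) x
  have h1 : ∀ c, wedge ((Pi.single a fun _ => α : ι → Form (m + 2) M 1) c x) (L.eulerA φ c x) =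
      if c = a then wedge α (L.eulerA φ a x) else 0 := by
    intro c
    split_ifs with hc
    · subst hc
      rw [Pi.single_eq_same]
    · rw [Pi.single_eq_of_ne hc]
      exact zero_wedge _
  have h2 : L.euler φ (Pi.single a fun _ => α, 0) x = wedge α (L.eulerA φ a x) := by
    have h3 : ∀ b : κ, scalar ((0 : κ → Form (m + 2) M 0) b x) • L.eulerP φ b x = 0 := fun b =>
      zero_smul ℝ _
    simp only [euler, h1, h3, Finset.sum_const_zero, add_zero, Finset.sum_ite_eq',
      Finset.mem_univ, if_true]
  rw [← h2, h]
  rfl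

theorem eulerLow_eq_zero {φ : Fields m ι κ M} (hφ : φ ∈ L.solutions M)
    (χ : ι → Form (m + 2) M 0) : L.eulerLow φ χ = 0 := by
  funext x
  have h : ∀ a, scalar (χ a x) • L.eulerA φ a x = 0 := fun a => by
    rw [L.eulerA_eq_zero hφ]
    exact smul_zero (scalar (χ a x))
  simp only [eulerLow, h, Finset.sum_const_zero]
  rfl

theorem chargeBracket_eq_of_mem_solutions (hγ : ∀ X, L.IsLocalFunctional (γ X))
    {φ : Fields m ι κ M} (hφ : φ ∈ L.solutions M) (X Y : DiffAlg (m + 2) M) :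
    L.chargeBracket S X Y φ = L.charge γ S ⁅X, Y⁆ φ + L.cocycle γ S X Y φ := by
  rw [L.chargeBracket_eq S hγ hφ.1, hφ.2, hφ.2, iprod_zero, iprod_zero, sub_zero]
  have h : S.integral (0 : Form (m + 2) M (m + 1)) = 0 := by
    simpa using S.integral_smul 0 (0 : Form (m + 2) M (m + 1))
  rw [h, add_zero]

theorem cocycle_eq_of_mem_solutions {φ : Fields m ι κ M} (hφ : φ ∈ L.solutions M)
    (X Y : DiffAlg (m + 2) M) : L.cocycle γ S X Y φ = S.boundary.integral
      (lieD X.field (L.thetaLow φ (innerField Y.field φ))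
        - lieD Y.field (L.thetaLow φ (innerField X.field φ))
        + iprod X.field (iprod Y.field (L.form φ)) + γ ⁅X, Y⁆ φ) := by
  rw [cocycle, cocycleForm, L.eulerLow_eq_zero hφ, L.eulerLow_eq_zero hφ, iprod_zero, iprod_zero,
    add_zero, sub_zero]

theorem current_add (hγ : ∀ X, L.IsLocalFunctional (γ X)) {φ : Fields m ι κ M}
    (hφ : φ ∈ L.fieldSpace M) (X Y : DiffAlg (m + 2) M) :
    L.current γ (X + Y) φ = L.current γ X φ + L.current γ Y φ := by
  rw [current, vert_add_field X Y hφ.1, theta_add, DiffAlg.add_field, iprod_add_field, map_add,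
    Pi.add_apply, extD_add ((hγ X).isSmooth hφ) ((hγ Y).isSmooth hφ), current, current]
  abel

theorem current_smul (c : ℝ) (X : DiffAlg (m + 2) M) (φ : Fields m ι κ M) :
    L.current γ (c • X) φ = c • L.current γ X φ := by
  rw [current, DiffAlg.smul_field, vert_smul_field, theta_smul, iprod_smul_field, map_smul,
    Pi.smul_apply, extD_smul, current, smul_sub, smul_sub]

theorem charge_add (hγ : ∀ X, L.IsLocalFunctional (γ X)) {φ : Fields m ι κ M}
    (hφ : φ ∈ L.fieldSpace M) (X Y : DiffAlg (m + 2) M) :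
    L.charge γ S (X + Y) φ = L.charge γ S X φ + L.charge γ S Y φ := by
  rw [charge, L.current_add hγ hφ, S.integral_add (fun x _ => (L.isSmooth_current hγ hφ X).smAt x)
    (fun x _ => (L.isSmooth_current hγ hφ Y).smAt x)]
  rfl

theorem charge_smul (c : ℝ) (X : DiffAlg (m + 2) M) (φ : Fields m ι κ M) :
    L.charge γ S (c • X) φ = c * L.charge γ S X φ := by
  rw [charge, L.current_smul, S.integral_smul]
  rfl

/-- The Jacobiator of the boundary term. -/
theorem cocycle_cyclic (hγ : ∀ X, L.IsLocalFunctional (γ X)) {φ : Fields m ι κ M}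
    (hφ : φ ∈ L.solutions M) (X Y Z : DiffAlg (m + 2) M) :
    L.cocycle γ S X ⁅Y, Z⁆ φ + L.cocycle γ S Y ⁅Z, X⁆ φ + L.cocycle γ S Z ⁅X, Y⁆ φ =
      S.integral (L.dInnerPresymp X Y Z φ) + S.integral (L.dInnerPresymp Y Z X φ)
        + S.integral (L.dInnerPresymp Z X Y φ) := by
  have hf := hφ.1
  have hs : ∀ X Y Z, ∀ x ∈ S.carrier, SmAt (L.dInnerPresymp X Y Z φ) x := fun X Y Z x _ =>
    (L.isSmooth_dInnerPresymp hf X Y Z).smAt x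
  have hp : ∀ X Y : DiffAlg (m + 2) M, IsSmooth (L.presymp φ (vert X.field φ) (vert Y.field φ)) :=
    fun X Y => L.isSmooth_presymp hf (hf.1.vert X) (hf.1.vert Y)
  -- The charge is linear in the vector field, so the bulk terms of the three brackets cancel by the
  -- Jacobi identity and only the boundary terms remain.
  have hJ : L.charge γ S ⁅X, ⁅Y, Z⁆⁆ φ + L.charge γ S ⁅Y, ⁅Z, X⁆⁆ φ +
      L.charge γ S ⁅Z, ⁅X, Y⁆⁆ φ = 0 := by
    rw [← L.charge_add S hγ hf, ← L.charge_add S hγ hf, lie_jacobi]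
    simpa using L.charge_smul (γ := γ) S 0 0 φ
  have h1 : S.integral (L.dInnerPresymp X Y Z φ) + S.integral (L.dInnerPresymp Y Z X φ)
        + S.integral (L.dInnerPresymp Z X Y φ) = L.chargeBracket S X ⁅Y, Z⁆ φ +
      L.chargeBracket S Y ⁅Z, X⁆ φ + L.chargeBracket S Z ⁅X, Y⁆ φ := by
    rw [← S.integral_add (hs _ _ _) (hs _ _ _), ← S.integral_add (fun x _ =>
      ((L.isSmooth_dInnerPresymp hf X Y Z).add (L.isSmooth_dInnerPresymp hf Y Z X)).smAt x)
      (hs _ _ _), L.dInnerPresymp_cyclic hf, S.integral_add (fun x _ =>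
      ((hp X ⁅Y, Z⁆).add (hp Y ⁅Z, X⁆)).smAt x) (fun x _ => (hp Z ⁅X, Y⁆).smAt x),
      S.integral_add (fun x _ => (hp X ⁅Y, Z⁆).smAt x) (fun x _ => (hp Y ⁅Z, X⁆).smAt x)]
    rfl
  rw [h1, L.chargeBracket_eq_of_mem_solutions S hγ hφ, L.chargeBracket_eq_of_mem_solutions S hγ hφ,
    L.chargeBracket_eq_of_mem_solutions S hγ hφ]
  linear_combination -hJ

theorem hasDerivAt_theta_vert {φ δφ : Fields m ι κ M} (hφ : φ ∈ L.fieldSpace M)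
    (hδ : SmoothFields δφ) (X : DiffAlg (m + 2) M) (x : M) :
    HasDerivAt (fun t : ℝ => L.theta (φ + t • δφ) (vert X.field (φ + t • δφ)) x)
      (L.dTheta φ δφ (vert X.field φ) x + L.theta φ (vert X.field δφ) x) 0 := by
  have h1 := L.hasDerivAt_theta hφ.1 hδ (vert X.field φ) (hφ.2 x)
  have h2 := (hasDerivAt_id (0 : ℝ)).smul
    (L.hasDerivAt_theta hφ.1 hδ (vert X.field δφ) (hφ.2 x))
  have h3 : (fun t : ℝ => L.theta (φ + t • δφ) (vert X.field (φ + t • δφ)) x) =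
      fun t : ℝ => L.theta (φ + t • δφ) (vert X.field φ) x +
        id t • L.theta (φ + t • δφ) (vert X.field δφ) x := by
    funext t
    rw [vert_add X hφ.1 (hδ.smul t), vert_smul, theta_add, theta_smul]
    rfl
  rw [h3]
  refine (h1.add h2).congr_deriv ?_
  simp

/-- The varied current: `X^v` varies together with `φ`, which gives the term `θ(𝔏_X δφ)`, and
field-space differentiation commutes with `d` on `M` in the corner term. -/
theorem dFormFun_current (hγ : ∀ X, L.IsLocalFunctional (γ X)) {φ δφ : Fields m ι κ M}
    (hφ : φ ∈ L.fieldSpace M) (hδ : SmoothFields δφ) (X : DiffAlg (m + 2) M) :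
    dFormFun (L.current γ X) φ δφ = L.dTheta φ δφ (vert X.field φ) + L.theta φ (vert X.field δφ) -
      iprod X.field (dFormFun L.form φ δφ) - extD (dFormFun (γ X) φ δφ) := by
  funext x
  have hu := smoothFamily_iff.1 (hφ.1.line hδ) 0 x
  have hj : jet (φ + (0 : ℝ) • δφ) x ∈ L.dom := by simpa using hφ.2 x
  have hL := L.form_family hu hj
  have hg := (hγ X).line hφ.1 hδ (hφ.2 x)
  have h1 := L.hasDerivAt_theta_vert hφ hδ X x
  have h2 : HasDerivAt (fun t : ℝ => iprod X.field (L.form (φ + t • δφ)) x)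
      (iprod X.field (dFormFun L.form φ δφ) x) 0 :=
    (innerL (X.field x)).hasFDerivAt.comp_hasDerivAt 0 hL.differentiableAt.hasDerivAt
  have h3 : HasDerivAt (fun t : ℝ => extD (γ X (φ + t • δφ)) x)
      (extD (dFormFun (γ X) φ δφ) x) 0 := by
    rw [dFormFun_eq_parDeriv, hg.extD_parDeriv, parDeriv, fderiv_apply_one_eq_deriv]
    exact hg.extD.differentiableAt.hasDerivAt
  exact ((h1.sub h2).sub h3).deriv

theorem dFun_charge (hγ : ∀ X, L.IsLocalFunctional (γ X)) {φ δφ : Fields m ι κ M}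
    (hφ : φ ∈ L.fieldSpace M) (hδ : SmoothFields δφ) (X : DiffAlg (m + 2) M) :
    dFun (L.charge γ S X) φ δφ = S.integral (dFormFun (L.current γ X) φ δφ) := by
  have h : ∀ x ∈ S.carrier, SmoothFamilyAt (fun t : ℝ => L.current γ X (φ + t • δφ)) 0 x :=
    fun x _ => L.current_family X (smoothFamily_iff.1 (hφ.1.line hδ) 0 x)
      ((hγ X).line hφ.1 hδ (hφ.2 x)) (by simpa using hφ.2 x)
  rw [dFormFun_eq_parDeriv, ← S.hasFDerivAt_integral h, fderiv_apply_one_eq_deriv]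
  rfl

/-- The boundary flux. -/
theorem presympInt_vert_eq (hγ : ∀ X, L.IsLocalFunctional (γ X)) {φ : Fields m ι κ M}
    (hφ : φ ∈ L.solutions M) (X : DiffAlg (m + 2) M) {δφ : Fields m ι κ M} (hδ : SmoothFields δφ) :
    L.presympInt S φ (vert X.field φ) δφ = -dFun (L.charge γ S X) φ δφ
        + S.boundary.integral (iprod X.field (L.theta φ δφ) - dFormFun (γ X) φ δφ) := by
  have hf := hφ.1
  have hg : IsSmooth (dFormFun (γ X) φ δφ) := by
    rw [dFormFun_eq_parDeriv]
    exact isSmooth_iff.2 fun x => (((hγ X).line hf.1 hδ (hf.2 x)).parDeriv 1).smAt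
  have ht := L.isSmooth_theta hf hδ
  have hJ : IsSmooth (dFormFun (L.current γ X) φ δφ) := by
    rw [dFormFun_eq_parDeriv]
    exact isSmooth_iff.2 fun x => ((L.current_family X (smoothFamily_iff.1 (hf.1.line hδ) 0 x)
      ((hγ X).line hf.1 hδ (hf.2 x)) (by simpa using hf.2 x)).parDeriv 1).smAt
  have h1 : L.presymp φ (vert X.field φ) δφ = extD (iprod X.field (L.theta φ δφ) -
      dFormFun (γ X) φ δφ) - dFormFun (L.current γ X) φ δφ := by
    -- On shell `𝐝L = dθ(δφ)`, so the term `ι_X 𝐝L` in the variation of the current is exactly the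
    -- term `ι_X dθ(δφ)` of Cartan's formula for `𝔏_X θ(δφ)`. What survives their cancellation is
    -- exact.
    have h2 := L.lieD_theta hf hδ X
    rw [lieD_succ] at h2
    rw [L.presymp_eq hf (hf.1.vert X) hδ, L.dFormFun_current hγ hf hδ, L.dFormFun_form hf hδ,
      hφ.2, zero_add, extD_sub (ht.iprod X) hg, ← sub_eq_zero, ← sub_eq_zero.2 h2.symm]
    abel
  rw [presympInt, h1, S.integral_sub (fun x _ => ((ht.iprod X).sub hg).extD.smAt x)
    (fun x _ => hJ.smAt x), S.stokes ((ht.iprod X).sub hg), L.dFun_charge S hγ hf hδ]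
  ring

end Lagrangian

end Charges

/-! ### Smooth local functionals of the fields -/

section Hadamard

open MeasureTheory

/-- Hadamard's formula, from the fundamental theorem of calculus on the segment from `0` to `t`; the
value of `dslope` at `t = 0` is the one for which it stays true there. -/
theorem dslope_eq_integral {F : Type*} [NormedAddCommGroup F] [NormedSpace ℝ F] [CompleteSpace F]
    {f : ℝ → F} {t : ℝ} (hf : ∀ τ ∈ Icc (0 : ℝ) 1, ContDiffAt ℝ 1 f (τ * t)) :
    dslope f 0 t = ∫ τ in Icc (0 : ℝ) 1, deriv f (τ * t) := by
  rw [integral_Icc_eq_integral_Ioc, ← intervalIntegral.integral_of_le zero_le_one]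
  have h1 : ContinuousOn (fun τ : ℝ => deriv f (0 + τ • t)) (Icc 0 1) := by
    intro τ hτ
    have h2 : ContinuousAt (deriv f) (0 + τ * t) := by
      rw [zero_add]
      have h := ((hf τ hτ).continuousAt_fderiv (by simp)).clm_apply
        (continuousAt_const (y := (1 : ℝ)))
      simpa only [fderiv_apply_one_eq_deriv] using h
    exact (ContinuousAt.comp (f := fun τ : ℝ => 0 + τ * t) h2 (by fun_prop)).continuousWithinAt
  have h3 := intervalIntegral.integral_unitInterval_deriv_eq_sub (z₀ := (0 : ℝ)) (z₁ := t) (f := f)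
    (f' := deriv f) h1 fun τ hτ => by
      simpa using ((hf τ hτ).differentiableAt (by simp)).hasDerivAt
  simp only [zero_add, smul_eq_mul] at h3
  rcases eq_or_ne t 0 with rfl | ht
  · simp
  · have h4 := sub_smul_dslope f 0 t
    rw [sub_zero, ← h3] at h4
    exact smul_right_injective F ht h4

/-- Hadamard's lemma with a parameter: the integral formula has no singularity at zero slope time,
and integrals over `[0,1]` of smooth integrands are smooth. -/
theorem contDiffAt_dslope {V F : Type} [NormedAddCommGroup V] [NormedSpace ℝ V]
    [NormedAddCommGroup F] [NormedSpace ℝ F] [CompleteSpace F] {G : ℝ × V → F} {t : ℝ} {y : V}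
    (hG : ∀ s, ContDiffAt ℝ ∞ G (s, y)) :
    ContDiffAt ℝ ∞ (fun z : ℝ × V => dslope (fun s => G (s, z.2)) 0 z.1) (t, y) := by
  have hm : ∀ τ : ℝ, ContDiffAt ℝ ∞ (fun w : (ℝ × V) × ℝ => (w.2 * w.1.1, w.1.2)) ((t, y), τ) :=
    fun τ => ContDiff.contDiffAt (by fun_prop)
  have h1 : ContDiffAt ℝ ∞ (fun z : ℝ × V => ∫ τ in Icc (0 : ℝ) 1,
      fderiv ℝ G (τ * z.1, z.2) (1, 0)) (t, y) := by
    refine contDiffAt_setIntegral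
      (g := fun w : (ℝ × V) × ℝ => fderiv ℝ G (w.2 * w.1.1, w.1.2) (1, 0)) isCompact_Icc fun τ _ => ?_
    exact ContDiffAt.comp (g := fun q => fderiv ℝ G q (1, 0))
      (f := fun w : (ℝ × V) × ℝ => (w.2 * w.1.1, w.1.2)) ((t, y), τ)
      (((hG _).fderiv_right (m := ∞) (by simp)).clm_apply contDiffAt_const) (hm τ)
  refine h1.congr_of_eventuallyEq ?_
  have h2 : ∀ᶠ z : ℝ × V in 𝓝 (t, y), ∀ τ ∈ Icc (0 : ℝ) 1, ContDiffAt ℝ 1 G (τ * z.1, z.2) :=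
    isCompact_Icc.eventually_forall_of_forall_eventually fun τ _ =>
      (hm τ).continuousAt.eventually (((hG _).of_le (by simp) : ContDiffAt ℝ 1 G _).eventually
        (by simp))
  filter_upwards [h2] with z hz
  have h3 : ∀ τ ∈ Icc (0 : ℝ) 1, ContDiffAt ℝ 1 (fun s => G (s, z.2)) (τ * z.1) := fun τ hτ =>
    ContDiffAt.comp (g := G) (f := fun s => (s, z.2)) (τ * z.1) (hz τ hτ)
      (contDiffAt_id.prodMk contDiffAt_const)
  rw [dslope_eq_integral h3]
  refine setIntegral_congr_fun measurableSet_Icc fun τ hτ => ?_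
  have h4 : HasDerivAt (fun s => G (s, z.2)) (fderiv ℝ G (τ * z.1, z.2) (1, 0)) (τ * z.1) :=
    ((hz τ hτ).differentiableAt (by simp)).hasFDerivAt.comp_hasDerivAt _
      ((hasDerivAt_id _).prodMk (hasDerivAt_const _ z.2))
  exact h4.deriv

end Hadamard

/-! ### Smooth curves of fields and their difference quotients. -/

section FieldCurves

variable {n k m : ℕ} {ι κ : Type*} [Fintype ι] [Fintype κ]
  {M : Type*} [TopologicalSpace M]

/-- The difference quotients of a curve of forms, with the velocity at `0`. -/
def formSlope (c : ℝ → Form n M k) (t : ℝ) : Form n M k := fun x => dslope (fun s => c s x) 0 t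

theorem smul_formSlope (c : ℝ → Form n M k) (t : ℝ) : c 0 + t • formSlope c t = c t := by
  funext x
  have h := sub_smul_dslope (fun s => c s x) 0 t
  rw [sub_zero] at h
  exact (congrArg (c 0 x + ·) h).trans (add_sub_cancel _ _)

/-- Hadamard's lemma is applied to the chart expressions. Differentiability at time `0` is needed at
all nearby points, so that passing to the chart commutes with `dslope` also at the diagonal. -/
theorem smoothFamilyAt_formSlope [ChartedSpace (Vec n) M] [IsManifold (𝓡 n) ∞ M]
    {c : ℝ → Form n M k} {p : M} (hc : ∀ s, SmoothFamilyAt c s p) (t : ℝ) :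
    SmoothFamilyAt (formSlope c) t p := by
  refine ContDiffAt.congr_of_eventuallyEq
    (contDiffAt_dslope (G := fun z : ℝ × Vec n => chartRep (c z.1) p z.2) hc) ?_
  have h1 : ∀ᶠ z : ℝ × Vec n in 𝓝 (t, extChartAt (𝓡 n) p p),
      DifferentiableAt ℝ (fun s => c s ((extChartAt (𝓡 n) p).symm z.2)) 0 := by
    have h2 : Tendsto (fun z : ℝ × M => ((0 : ℝ), z.2)) (𝓝 (t, p)) (𝓝 (0, p)) :=
      (continuousAt_const.prodMk continuousAt_snd).tendsto
    exact (h2.comp (tendsto_symm t p)).eventually (hc 0).eventually_differentiableAt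
  filter_upwards [eventually_target t p, h1] with z hz hd
  have h : (fun s => chartRep (c s) p z.2) =
      (altPullEquiv (k := k) (transEquiv (mem_overlap_symm hz)) : Alt n k →L[ℝ] Alt n k) ∘
        fun s => c s ((extChartAt (𝓡 n) p).symm z.2) :=
    funext fun s => chartRep_apply _ hz
  refine (chartRep_apply _ hz).trans (Eq.trans ?_ (congrArg (dslope · 0 z.1) h).symm)
  exact (ContinuousLinearMap.dslope_comp
    (altPullEquiv (k := k) (transEquiv (mem_overlap_symm hz)) : Alt n k →L[ℝ] Alt n k)
    (fun s => c s ((extChartAt (𝓡 n) p).symm z.2)) 0 z.1 fun _ => hd).symm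

/-- The difference quotients of a curve of field configurations. -/
def fieldSlope (c : ℝ → Fields m ι κ M) (t : ℝ) : Fields m ι κ M :=
  (fun a => formSlope (fun s => (c s).1 a) t, fun b => formSlope (fun s => (c s).2 b) t)

theorem smul_fieldSlope (c : ℝ → Fields m ι κ M) (t : ℝ) : c 0 + t • fieldSlope c t = c t :=
  Prod.ext (funext fun a => smul_formSlope (fun s => (c s).1 a) t)
    (funext fun b => smul_formSlope (fun s => (c s).2 b) t)

theorem smoothFamily_fieldSlope [ChartedSpace (Vec (m + 2)) M] [IsManifold (𝓡 (m + 2)) ∞ M]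
    {c : ℝ → Fields m ι κ M} (hc : SmoothFamily c) : SmoothFamily (fieldSlope c) :=
  ⟨fun a s p => smoothFamilyAt_formSlope (fun r => hc.1 a r p) s,
    fun b s p => smoothFamilyAt_formSlope (fun r => hc.2 b r p) s⟩

end FieldCurves

/-! ### Dependence of Lie derivatives, jets and currents on the germs of the fields. -/

section Germs

variable {k m : ℕ} {ι κ : Type*} {M : Type*} [TopologicalSpace M] [ChartedSpace (Vec (m + 2)) M]

theorem extD_congr {n : ℕ} {M : Type*} [TopologicalSpace M] [ChartedSpace (Vec n) M]
    {w v : Form n M k} {x : M} (h : ∀ᶠ y in 𝓝 x, w y = v y) : extD w x = extD v x := by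
  have h1 : chartRep w x =ᶠ[𝓝 (extChartAt (𝓡 n) x x)] chartRep v x := by
    have h2 : ContinuousAt (extChartAt (𝓡 n) x).symm (extChartAt (𝓡 n) x x) :=
      continuousAt_extChartAt_symm (I := 𝓡 n) x
    rw [ContinuousAt, extChartAt_to_inv] at h2
    filter_upwards [h2.eventually h] with y hy
    unfold chartRep
    rw [hy]
  unfold extD
  rw [h1.extDeriv_eq]

theorem lieD_congr {n : ℕ} {M : Type*} [TopologicalSpace M] [ChartedSpace (Vec n) M]
    (X : ∀ x : M, TangentSpace (𝓡 n) x) {w v : Form n M k} {x : M}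
    (h : ∀ᶠ y in 𝓝 x, w y = v y) : lieD X w x = lieD X v x := by
  have h1 := extD_congr h
  cases k with
  | zero =>
    change (extD w x).curryLeft (X x) = (extD v x).curryLeft (X x)
    rw [h1]
  | succ k =>
    have h2 : ∀ᶠ y in 𝓝 x, iprod X w y = iprod X v y :=
      h.mono fun y hy => congrArg (fun a => a.curryLeft (X y)) hy
    change (extD w x).curryLeft (X x) + extD (iprod X w) x =
      (extD v x).curryLeft (X x) + extD (iprod X v) x
    rw [h1, extD_congr h2]

/-- Two field configurations have the same germ at `x`. -/
def GermEq (φ ψ : Fields m ι κ M) (x : M) : Prop :=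
  ∀ᶠ y in 𝓝 x, (∀ a, φ.1 a y = ψ.1 a y) ∧ ∀ b, φ.2 b y = ψ.2 b y

variable {φ ψ η ζ : Fields m ι κ M} {x : M}

theorem GermEq.eventually (h : GermEq φ ψ x) : ∀ᶠ y in 𝓝 x, GermEq φ ψ y :=
  eventually_eventually_nhds.2 h

theorem GermEq.refl (φ : Fields m ι κ M) (x : M) : GermEq φ φ x :=
  Eventually.of_forall fun _ => ⟨fun _ => rfl, fun _ => rfl⟩

theorem GermEq.add_smul (t : ℝ) (h : GermEq φ ψ x) (h' : GermEq η ζ x) :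
    GermEq (φ + t • η) (ψ + t • ζ) x := by
  filter_upwards [h, h'] with y hy hy'
  exact ⟨fun a => congrArg₂ (fun p q => p + t • q) (hy.1 a) (hy'.1 a),
    fun b => congrArg₂ (fun p q => p + t • q) (hy.2 b) (hy'.2 b)⟩

theorem GermEq.vert (X : ∀ x : M, TangentSpace (𝓡 (m + 2)) x) (h : GermEq φ ψ x) :
    GermEq (vert X φ) (vert X ψ) x := by
  filter_upwards [h.eventually] with y hy
  exact ⟨fun a => lieD_congr X (hy.mono fun z hz => hz.1 a),
    fun b => lieD_congr X (hy.mono fun z hz => hz.2 b)⟩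

theorem GermEq.jet_eq (h : GermEq φ ψ x) : jet φ x = jet ψ x := by
  have h0 := h.self_of_nhds
  exact Prod.ext (funext h0.1) (Prod.ext (funext h0.2) (Prod.ext
    (funext fun a => extD_congr (h.mono fun z hz => hz.1 a))
    (funext fun b => extD_congr (h.mono fun z hz => hz.2 b))))

variable [Fintype ι] [Fintype κ]

theorem GermEq.form_eq (L : Lagrangian m ι κ) (h : GermEq φ ψ x) : L.form φ x = L.form ψ x :=
  congrArg L.toFun h.jet_eq

variable [DecidableEq ι] [DecidableEq κ] (L : Lagrangian m ι κ)

theorem GermEq.theta_eq (h : GermEq φ ψ x) (h' : GermEq η ζ x) :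
    L.theta φ η x = L.theta ψ ζ x := by
  have h0 := h'.self_of_nhds
  simp only [Lagrangian.theta, h.jet_eq, h0.1, h0.2]

theorem GermEq.presymp_eq {δ ε : Fields m ι κ M} (h : GermEq φ ψ x) (h' : GermEq η ζ x)
    (h'' : GermEq δ ε x) : L.presymp φ η δ x = L.presymp ψ ζ ε x := by
  change deriv (fun t : ℝ => L.theta (φ + t • η) δ x) 0 -
      deriv (fun t : ℝ => L.theta (φ + t • δ) η x) 0 =
    deriv (fun t : ℝ => L.theta (ψ + t • ζ) ε x) 0 - deriv (fun t : ℝ => L.theta (ψ + t • ε) ζ x) 0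
  simp only [fun t => (h.add_smul t h').theta_eq L h'', fun t => (h.add_smul t h'').theta_eq L h']

theorem GermEq.current_eq [IsManifold (𝓡 (m + 2)) ∞ M]
    {γ : DiffAlg (m + 2) M →ₗ[ℝ] (Fields m ι κ M → Form (m + 2) M m)}
    (hγ : ∀ X, L.IsLocalFunctional (γ X)) (X : DiffAlg (m + 2) M) (h : GermEq φ ψ x) :
    L.current γ X φ x = L.current γ X ψ x := by
  change L.theta φ (CovPhase.vert X.field φ) x - (L.form φ x).curryLeft (X.field x) -
      extD (γ X φ) x =
    L.theta ψ (CovPhase.vert X.field ψ) x - (L.form ψ x).curryLeft (X.field x) - extD (γ X ψ) x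
  rw [h.theta_eq L (h.vert X.field), h.form_eq L,
    extD_congr (h.eventually.mono fun y hy => (hγ X).1 y φ ψ hy)]

end Germs

/-! ### Chain rule and commuting derivatives for smooth local functionals. -/

section SmoothLocal

variable {m : ℕ} {ι κ : Type*} [Fintype ι] [Fintype κ]
  {M : Type*} [TopologicalSpace M] [ChartedSpace (Vec (m + 2)) M] [IsManifold (𝓡 (m + 2)) ∞ M]

/-- Smooth real functions of the germs of the fields along `K`, defined where the fields are
admissible along `K`. -/
structure SmoothLocal (L : Lagrangian m ι κ) (K : Set M) (F : Fields m ι κ M → ℝ) : Prop where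
  congr : ∀ φ ψ : Fields m ι κ M, (∀ x ∈ K, GermEq φ ψ x) → F φ = F ψ
  contDiffAt : ∀ {P : Type} [NormedAddCommGroup P] [NormedSpace ℝ P] [FiniteDimensional ℝ P]
    (u : P → Fields m ι κ M), SmoothFamily u → ∀ s, (∀ x ∈ K, jet (u s) x ∈ L.dom) →
      ContDiffAt ℝ ∞ (fun r => F (u r)) s

variable {L : Lagrangian m ι κ} {K : Set M} {F : Fields m ι κ M → ℝ}

theorem SmoothFields.const_family {P : Type*} [NormedAddCommGroup P] [NormedSpace ℝ P]
    {φ : Fields m ι κ M} (h : SmoothFields φ) : SmoothFamily (fun _ : P => φ) :=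
  smoothFamily_iff.2 fun s p => h.const s p

theorem SmoothFamily.add {P : Type*} [NormedAddCommGroup P] [NormedSpace ℝ P]
    {u v : P → Fields m ι κ M} (hu : SmoothFamily u) (hv : SmoothFamily v) :
    SmoothFamily (fun r => u r + v r) :=
  smoothFamily_iff.2 fun s p => (smoothFamily_iff.1 hu s p).add (smoothFamily_iff.1 hv s p)

theorem SmoothFamily.smul {P : Type*} [NormedAddCommGroup P] [NormedSpace ℝ P]
    {c : P → ℝ} {u : P → Fields m ι κ M} (hc : ContDiff ℝ ∞ c) (hu : SmoothFamily u) :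
    SmoothFamily (fun r => c r • u r) :=
  smoothFamily_iff.2 fun s p => .smul hc.contDiffAt (smoothFamily_iff.1 hu s p)

theorem SmoothFamily.comp {P P' : Type*} [NormedAddCommGroup P] [NormedSpace ℝ P]
    [NormedAddCommGroup P'] [NormedSpace ℝ P'] {u : P → Fields m ι κ M} (hu : SmoothFamily u)
    {f : P' → P} (hf : ContDiff ℝ ∞ f) : SmoothFamily (fun r => u (f r)) :=
  smoothFamily_iff.2 fun s p => (smoothFamily_iff.1 hu (f s) p).comp hf.contDiffAt

theorem SmoothFamily.vert (X : DiffAlg (m + 2) M) {P : Type*} [NormedAddCommGroup P]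
    [NormedSpace ℝ P] {u : P → Fields m ι κ M} (hu : SmoothFamily u) :
    SmoothFamily (fun r => vert X.field (u r)) :=
  smoothFamily_iff.2 fun s p => (smoothFamily_iff.1 hu s p).vert X

theorem SmoothFamily.smoothFields {P : Type*} [NormedAddCommGroup P] [NormedSpace ℝ P]
    {u : P → Fields m ι κ M} (hu : SmoothFamily u) (s : P) : SmoothFields (u s) :=
  smoothFields_iff.2 (hu.comp (f := fun _ : ℝ => s) contDiff_const)

/-- Since `dFun` only sees straight lines in field space, it agrees with a directional derivative of
a finite-dimensional family in directions where that family is affine. -/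
theorem fderiv_eq_dFun {P : Type*} [NormedAddCommGroup P] [NormedSpace ℝ P]
    {u : P → Fields m ι κ M} {s v : P} {η : Fields m ι κ M}
    (hd : DifferentiableAt ℝ (fun r => F (u r)) s) (h : ∀ t : ℝ, u (s + t • v) = u s + t • η) :
    fderiv ℝ (fun r => F (u r)) s v = dFun F (u s) η := by
  rw [← hd.lineDeriv_eq_fderiv, lineDeriv, dFun]
  simp only [h]

namespace SmoothLocal

theorem dFun_congr (hF : SmoothLocal L K F) {φ ψ η ζ : Fields m ι κ M}
    (h : ∀ x ∈ K, GermEq φ ψ x) (h' : ∀ x ∈ K, GermEq η ζ x) : dFun F φ η = dFun F ψ ζ := by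
  unfold dFun
  congr 1
  exact funext fun t => hF.congr _ _ fun x hx => (h x hx).add_smul t (h' x hx)

/-- The chain rule along a curve of field configurations. -/
theorem hasDerivAt_curve (hF : SmoothLocal L K F) {c : ℝ → Fields m ι κ M} {η : Fields m ι κ M}
    (hc : SmoothFamily c) (hK : ∀ x ∈ K, jet (c 0) x ∈ L.dom)
    (hη : ∀ x ∈ K, GermEq (fieldSlope c 0) η x) :
    HasDerivAt (fun t => F (c t)) (dFun F (c 0) η) 0 := by
  -- The curve is the diagonal of a two-parameter family that is affine in its first variable. At
  -- the origin the first direction gives the required straight-line derivative, and the second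
  -- gives zero because the family is constant there.
  set u : ℝ × ℝ → Fields m ι κ M := fun z => c 0 + z.1 • fieldSlope c z.2 with hu
  have hs : SmoothFamily u := (hc.smoothFields 0).const_family.add
    (.smul contDiff_fst ((smoothFamily_fieldSlope hc).comp contDiff_snd))
  have h0 : u 0 = c 0 := by simp [hu]
  have hd := (hF.contDiffAt u hs 0 (by rwa [h0])).differentiableAt (by simp)
  have h1 := fderiv_eq_dFun (v := (1, 0)) (η := fieldSlope c 0) hd fun t => by simp [hu]
  have h2 := fderiv_eq_dFun (v := (0, 1)) (η := 0) hd fun t => by simp [hu]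
  have h3 : dFun F (u 0) 0 = 0 := by simp [dFun]
  have h4 : fderiv ℝ (fun r => F (u r)) 0 (1, 1) = dFun F (c 0) η := by
    have h5 : ((1, 1) : ℝ × ℝ) = (1, 0) + (0, 1) := by simp
    rw [h5, map_add, h1, h2, h3, add_zero, h0]
    exact hF.dFun_congr (fun x _ => GermEq.refl _ x) hη
  have h6 : HasDerivAt (fun t : ℝ => ((t, t) : ℝ × ℝ)) (1, 1) 0 :=
    (hasDerivAt_id 0).prodMk (hasDerivAt_id 0)
  have h7 := HasFDerivAt.comp_hasDerivAt (f := fun t : ℝ => ((t, t) : ℝ × ℝ)) (0 : ℝ)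
    hd.hasFDerivAt h6
  refine (h7.congr_deriv h4).congr_of_eventuallyEq (Eventually.of_forall fun t => ?_)
  exact congrArg F (smul_fieldSlope c t).symm

/-- The derivative along a fundamental vector field. -/
theorem dFun_vert (hF : SmoothLocal L K F) (Z : DiffAlg (m + 2) M) :
    SmoothLocal L K (fun φ => dFun F φ (vert Z.field φ)) where
  congr _ _ h := hF.dFun_congr h fun x hx => (h x hx).vert Z.field
  contDiffAt {P} _ _ _ u hu s hs := by
    -- The straight line in the direction `Z^v` is adjoined as an extra parameter, which is
    -- differentiated and then set to zero.
    set U : P × ℝ → Fields m ι κ M := fun z => u z.1 + z.2 • vert Z.field (u z.1) with hU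
    have hU' : SmoothFamily U := (hu.comp contDiff_fst).add
      (.smul contDiff_snd ((hu.vert Z).comp contDiff_fst))
    have h0 : ∀ r, U (r, 0) = u r := fun r => by simp [hU]
    have h1 := hF.contDiffAt U hU' (s, 0) (by rwa [h0])
    have h2 : ContDiffAt ℝ ∞ (fun r => fderiv ℝ (fun z => F (U z)) (r, 0) (0, 1)) s :=
      ContDiffAt.comp (g := fun z => fderiv ℝ (fun z => F (U z)) z (0, 1))
        (f := fun r : P => (r, (0 : ℝ))) s
        ((h1.fderiv_right (m := ∞) (by simp)).clm_apply contDiffAt_const)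
        (contDiffAt_id.prodMk contDiffAt_const)
    refine h2.congr_of_eventuallyEq ?_
    have h3 : ∀ᶠ z in 𝓝 ((s, 0) : P × ℝ), ContDiffAt ℝ 1 (fun z => F (U z)) z :=
      (h1.of_le (by simp)).eventually (by simp)
    have h4 : Tendsto (fun r : P => (r, (0 : ℝ))) (𝓝 s) (𝓝 (s, 0)) :=
      (continuousAt_id.prodMk continuousAt_const).tendsto
    filter_upwards [h4.eventually h3] with r hr
    have h5 := fderiv_eq_dFun (v := ((0, 1) : P × ℝ)) (η := vert Z.field (u r))
      (hr.differentiableAt (by simp)) fun t => by simp [hU]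
    rw [h5, h0]

/-- All quantities are read off from one four-parameter affine family through `φ`. The mixed second
derivatives along `η₁` and `η₂` agree, which leaves the first derivatives along the changes `ζ` and
`ξ` of the directions. -/
theorem deriv_dFun_comm (hF : SmoothLocal L K F) {φ η₁ η₂ ζ ξ : Fields m ι κ M}
    (hφ : SmoothFields φ) (hK : ∀ x ∈ K, jet φ x ∈ L.dom) (h₁ : SmoothFields η₁)
    (h₂ : SmoothFields η₂) (hζ : SmoothFields ζ) (hξ : SmoothFields ξ) :
    deriv (fun t : ℝ => dFun F (φ + t • η₁) (η₂ + t • ζ)) 0 -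
      deriv (fun t : ℝ => dFun F (φ + t • η₂) (η₁ + t • ξ)) 0 = dFun F φ (ζ - ξ) := by
  set u : ℝ × ℝ × ℝ × ℝ → Fields m ι κ M := fun z =>
    φ + z.1 • η₁ + z.2.1 • η₂ + z.2.2.1 • ζ + z.2.2.2 • ξ with hu
  have hs : SmoothFamily u := (((hφ.const_family.add
    (.smul (by fun_prop) h₁.const_family)).add (.smul (by fun_prop) h₂.const_family)).add
    (.smul (by fun_prop) hζ.const_family)).add (.smul (by fun_prop) hξ.const_family)
  have h0 : u 0 = φ := by simp [hu]
  set g := fun z => F (u z) with hg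
  have hd : ContDiffAt ℝ ∞ g 0 := hF.contDiffAt u hs 0 (by rwa [h0])
  have hev : ∀ᶠ z in 𝓝 (0 : ℝ × ℝ × ℝ × ℝ), DifferentiableAt ℝ g z :=
    (((hd.of_le (by simp) : ContDiffAt ℝ 1 g 0)).eventually (by simp)).mono fun z hz =>
      hz.differentiableAt (by simp)
  have hd2 : HasFDerivAt (fderiv ℝ g) (fderiv ℝ (fderiv ℝ g) 0) 0 :=
    ((hd.fderiv_right (m := ∞) (by simp)).differentiableAt (by simp)).hasFDerivAt
  -- The base point moves along `e` while the direction of differentiation moves as `v + t • w`; the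
  -- product rule gives one second and one first derivative of `g`.
  have key : ∀ (α ρ : ℝ → Fields m ι κ M) (e v w : ℝ × ℝ × ℝ × ℝ),
      (∀ t, u (t • e) = α t) → (∀ t r : ℝ, u (t • e + r • (v + t • w)) = α t + r • ρ t) →
      deriv (fun t : ℝ => dFun F (α t) (ρ t)) 0 =
        fderiv ℝ (fderiv ℝ g) 0 e v + fderiv ℝ g 0 w := by
    intro α ρ e v w h1 h2
    have h3 : HasDerivAt (fun t : ℝ => t • e) e 0 := by
      simpa using (hasDerivAt_id (0 : ℝ)).smul_const e
    have h4 : HasDerivAt (fun t : ℝ => fderiv ℝ g (t • e)) (fderiv ℝ (fderiv ℝ g) 0 e) 0 :=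
      HasFDerivAt.comp_hasDerivAt (f := fun t : ℝ => t • e) (0 : ℝ) (by simpa using hd2) h3
    have h5 : HasDerivAt (fun t : ℝ => v + t • w) w 0 := by
      simpa using ((hasDerivAt_id (0 : ℝ)).smul_const w).const_add v
    have h6 := h4.clm_apply h5
    simp only [zero_smul, add_zero] at h6
    refine Eq.trans (EventuallyEq.deriv_eq ?_) h6.deriv
    have h7 : Tendsto (fun t : ℝ => t • e) (𝓝 0) (𝓝 0) := by
      simpa using h3.continuousAt.tendsto
    filter_upwards [h7.eventually hev] with t ht
    have h8 := fderiv_eq_dFun (F := F) (v := v + t • w) (η := ρ t) ht fun r => by rw [h1, h2]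
    rw [h8, h1]
  have hsymm : IsSymmSndFDerivAt ℝ g 0 := hd.isSymmSndFDerivAt (by
    rw [minSmoothness_of_isRCLikeNormedField]
    exact WithTop.coe_le_coe.2 (le_top : (2 : ℕ∞) ≤ ⊤))
  rw [key _ _ (1, 0, 0, 0) (0, 1, 0, 0) (0, 0, 1, 0) (fun t => by simp [hu]) fun t r => by
      simp [hu, mul_smul, smul_add, add_assoc],
    key _ _ (0, 1, 0, 0) (1, 0, 0, 0) (0, 0, 0, 1) (fun t => by simp [hu]) fun t r => by
      simp only [hu, Prod.smul_mk, Prod.mk_add_mk, smul_eq_mul, mul_one, mul_zero, zero_add,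
        add_zero, zero_smul, mul_smul, smul_add]
      abel,
    hsymm.eq, add_sub_add_left_eq_sub, ← map_sub]
  have h9 := fderiv_eq_dFun (F := F) (v := (0, 0, 1, -1)) (η := ζ - ξ) hev.self_of_nhds fun t => by
    simp [hu, sub_eq_add_neg, add_assoc]
  rw [h0] at h9
  rw [← h9]
  simp [hg]

/-- The derivatives along fundamental vector fields commute up to the bracket. -/
theorem dFun_vert_comm (hF : SmoothLocal L K F) {φ : Fields m ι κ M} (hφ : SmoothFields φ)
    (hK : ∀ x ∈ K, jet φ x ∈ L.dom) (Y Z : DiffAlg (m + 2) M) :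
    dFun (fun ψ => dFun F ψ (vert Z.field ψ)) φ (vert Y.field φ) -
      dFun (fun ψ => dFun F ψ (vert Y.field ψ)) φ (vert Z.field φ) =
        dFun F φ (vert ⁅Y, Z⁆.field φ) := by
  have hv : ∀ (X : DiffAlg (m + 2) M) {η : Fields m ι κ M}, SmoothFields η → ∀ t : ℝ,
      vert X.field (φ + t • η) = vert X.field φ + t • vert X.field η := fun X η hη t => by
    rw [vert_add X hφ (hη.smul t), vert_smul]
  -- Along `Y^v` the field `Z^v` changes by `𝔏_Z 𝔏_Y φ`, and along `Z^v` the field `Y^v` changes by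
  -- `𝔏_Y 𝔏_Z φ`; their difference is `[Y, Z]^v` for the bracket of `𝔡𝔦𝔣𝔣(M)`.
  have h := hF.deriv_dFun_comm hφ hK (hφ.vert Y) (hφ.vert Z) ((hφ.vert Y).vert Z)
    ((hφ.vert Z).vert Y)
  rw [vert_vert Y Z hφ, sub_sub_cancel] at h
  rw [← h]
  simp only [← hv Z (hφ.vert Y)]
  rw [← vert_vert Y Z hφ]
  simp only [← hv Y (hφ.vert Z)]
  rfl

end SmoothLocal

end SmoothLocal

/-! ### The cocycle identity on a phase space. -/

section PhaseSpace

variable {m : ℕ} {ι κ : Type*} [Fintype ι] [Fintype κ]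
  {M : Type*} [TopologicalSpace M] [ChartedSpace (Vec (m + 2)) M] [IsManifold (𝓡 (m + 2)) ∞ M]

/-- Locality extends from the parameter spaces `Fin q → ℝ` to all finite-dimensional ones by a
linear isomorphism. -/
theorem Lagrangian.IsLocalFunctional.family {k : ℕ} {L : Lagrangian m ι κ}
    {F : Fields m ι κ M → Form (m + 2) M k} (hF : L.IsLocalFunctional F) {P : Type}
    [NormedAddCommGroup P] [NormedSpace ℝ P] [FiniteDimensional ℝ P] {u : P → Fields m ι κ M}
    (hu : SmoothFamily u) {s : P} {p : M} (hj : jet (u s) p ∈ L.dom) :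
    SmoothFamilyAt (fun r => F (u r)) s p := by
  have e : P ≃L[ℝ] (Fin (Module.finrank ℝ P) → ℝ) :=
    ContinuousLinearEquiv.ofFinrankEq (by simp)
  have h := hF.2 _ (fun r => u (e.symm r)) (hu.comp e.symm.contDiff) (e s) p (by simpa using hj)
  have h' := h.comp (f := e) e.contDiff.contDiffAt
  simpa using h'

theorem germEq_fieldSlope {K : Set M} {δφ : Fields m ι κ M} {U : Set M}
    {c : ℝ → Fields m ι κ M} (hU : IsOpen U) (hK : K ⊆ U)
    (h : ∀ x ∈ U, (∀ a, HasDerivAt (fun t => (c t).1 a x) (δφ.1 a x) 0) ∧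
      ∀ b, HasDerivAt (fun t => (c t).2 b x) (δφ.2 b x) 0) :
    ∀ x ∈ K, GermEq (fieldSlope c 0) δφ x := by
  intro x hx
  filter_upwards [hU.mem_nhds (hK hx)] with y hy
  exact ⟨fun a => (dslope_same _ _).trans ((h y hy).1 a).deriv,
    fun b => (dslope_same _ _).trans ((h y hy).2 b).deriv⟩

variable [DecidableEq ι] [DecidableEq κ]

namespace Lagrangian

variable (L : Lagrangian m ι κ) {γ : DiffAlg (m + 2) M →ₗ[ℝ] (Fields m ι κ M → Form (m + 2) M m)}
  (S : Chain (m + 2) (m + 1) M)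

theorem smoothLocal_charge (hγ : ∀ X, L.IsLocalFunctional (γ X)) (X : DiffAlg (m + 2) M) :
    SmoothLocal L S.carrier (L.charge γ S X) where
  congr _ _ h := S.integral_congr fun x hx => (h x hx).current_eq L hγ X
  contDiffAt _ hu s hs := S.contDiffAt_integral fun x hx =>
    L.current_family X (smoothFamily_iff.1 hu s x) ((hγ X).family hu (hs x hx)) (hs x hx)

theorem smoothLocal_chargeBracket (X Y : DiffAlg (m + 2) M) :
    SmoothLocal L S.carrier (L.chargeBracket S X Y) where
  congr _ _ h := S.integral_congr fun x hx =>
    (h x hx).presymp_eq L ((h x hx).vert X.field) ((h x hx).vert Y.field)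
  contDiffAt _ hu s hs := S.contDiffAt_integral fun x hx =>
    L.presymp_family (smoothFamily_iff.1 hu s x) ((smoothFamily_iff.1 hu s x).vert X)
      ((smoothFamily_iff.1 hu s x).vert Y) (hs x hx)

theorem dFun_chargeBracket {φ η : Fields m ι κ M} (hφ : φ ∈ L.fieldSpace M) (hη : SmoothFields η)
    (X Z : DiffAlg (m + 2) M) : dFun (L.chargeBracket S X Z) φ η =
      S.integral (L.dPresymp φ η (vert X.field φ) (vert Z.field φ) +
        L.presymp φ (vert X.field η) (vert Z.field φ) +
        L.presymp φ (vert X.field φ) (vert Z.field η)) := by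
  have hu : SmoothFamily (fun t : ℝ => φ + t • η) := hφ.1.line hη
  have h : ∀ x ∈ S.carrier, SmoothFamilyAt (fun t : ℝ =>
      L.presymp (φ + t • η) (vert X.field (φ + t • η)) (vert Z.field (φ + t • η))) 0 x :=
    fun x _ => L.presymp_family (smoothFamily_iff.1 hu 0 x) ((smoothFamily_iff.1 hu 0 x).vert X)
      ((smoothFamily_iff.1 hu 0 x).vert Z) (by simpa using hφ.2 x)
  have h1 : dFun (L.chargeBracket S X Z) φ η = S.integral (parDeriv (fun t : ℝ =>
      L.presymp (φ + t • η) (vert X.field (φ + t • η)) (vert Z.field (φ + t • η))) 1 0) := by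
    rw [← S.hasFDerivAt_integral h, fderiv_apply_one_eq_deriv]
    rfl
  rw [h1]
  congr 1
  funext x
  have h2 := L.hasDerivAt_presymp hφ.1 (hφ.2 x) hη (hφ.1.vert X) (hη.vert X) (hφ.1.vert Z)
    (hη.vert Z)
  refine Eq.trans (b := deriv (fun t : ℝ => L.presymp (φ + t • η) (vert X.field (φ + t • η))
    (vert Z.field (φ + t • η)) x) 0) fderiv_apply_one_eq_deriv ?_
  refine Eq.trans (congrArg (deriv · 0) (funext fun t => ?_)) h2.deriv
  rw [vert_add X hφ.1 (hη.smul t), vert_smul, vert_add Z hφ.1 (hη.smul t), vert_smul]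

/-- The invariant formula `dα(Y, Z) = Y(α(Z)) - Z(α(Y)) - α([Y, Z])` for `α = ι_{X^v} Θ_Σ` on the
fundamental fields. It only involves values of `Θ_Σ` on fundamental fields, about which the moment
map condition says something. -/
theorem integral_dInnerPresymp {φ : Fields m ι κ M} (hφ : φ ∈ L.fieldSpace M)
    (X Y Z : DiffAlg (m + 2) M) : S.integral (L.dInnerPresymp X Y Z φ) =
      dFun (L.chargeBracket S X Z) φ (vert Y.field φ) -
        dFun (L.chargeBracket S X Y) φ (vert Z.field φ) -
          L.presympInt S φ (vert X.field φ) (vert ⁅Y, Z⁆.field φ) := by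
  have hv := fun W : DiffAlg (m + 2) M => hφ.1.vert W
  have hs : ∀ Y Z : DiffAlg (m + 2) M, IsSmooth
      (L.dPresymp φ (vert Y.field φ) (vert X.field φ) (vert Z.field φ) +
        L.presymp φ (vert X.field (vert Y.field φ)) (vert Z.field φ) +
        L.presymp φ (vert X.field φ) (vert Z.field (vert Y.field φ))) := fun Y Z => by
    rw [← L.dFormFun_presymp_vert hφ (hv Y) (hv Z)]
    exact (L.isSmooth_dFormFun_presymp hφ (hv Y) (hv Z) X).add
      (L.isSmooth_presymp hφ (hv X) ((hv Y).vert Z))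
  rw [L.dFun_chargeBracket S hφ (hv Y), L.dFun_chargeBracket S hφ (hv Z), presympInt,
    ← S.integral_sub (fun x _ => (hs Y Z).smAt x) (fun x _ => (hs Z Y).smAt x),
    ← S.integral_sub (fun x _ => ((hs Y Z).sub (hs Z Y)).smAt x)
      (fun x _ => (L.isSmooth_presymp hφ (hv X) (hv ⁅Y, Z⁆)).smAt x), L.dInnerPresymp_eq hφ]
  have h1 : L.presymp φ (vert X.field φ) (vert Y.field (vert Z.field φ)) =
      L.presymp φ (vert X.field φ) (vert Z.field (vert Y.field φ)) -
        L.presymp φ (vert X.field φ) (vert ⁅Y, Z⁆.field φ) := by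
    rw [vert_vert Y Z hφ.1, L.presymp_swap _ (vert X.field φ),
      L.presymp_sub_left hφ ((hv Y).vert Z) (hv ⁅Y, Z⁆) (hv X), L.presymp_swap φ (vert X.field φ),
      L.presymp_swap φ (vert X.field φ)]
    abel
  rw [h1]
  congr 1
  abel

variable {P : Set (Fields m ι κ M)}

/-- The identity is assumed only on `P`, which straight lines leave. It is differentiated along a
curve in `P` whose velocity is `Y^v` near `Σ`; the chain rule returns the straight-line derivatives
because the functionals only see germs along `Σ`. -/
theorem dFun_eq_neg_of_eqOn (hP : L.IsPhaseSpace S P) {F G : Fields m ι κ M → ℝ}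
    (hF : SmoothLocal L S.carrier F) (hG : SmoothLocal L S.carrier G)
    (h : ∀ ψ ∈ P, F ψ = -G ψ) {φ : Fields m ι κ M} (hφ : φ ∈ P) (Y : DiffAlg (m + 2) M) :
    dFun F φ (vert Y.field φ) = -dFun G φ (vert Y.field φ) := by
  obtain ⟨U, c, hU, hK, hc, hcP, h0, hv⟩ := hP.2 φ hφ Y
  have hg := germEq_fieldSlope hU hK hv
  have hj : ∀ x ∈ S.carrier, jet (c 0) x ∈ L.dom := fun x _ => (hP.1 (hcP 0)).1.2 x
  have h1 := hF.hasDerivAt_curve hc hj hg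
  have h2 := (hG.hasDerivAt_curve hc hj hg).neg
  rw [h0] at h1 h2
  exact h1.unique (h2.congr_of_eventuallyEq (Eventually.of_forall fun t => h _ (hcP t)))

/-- For moment maps, `Θ_Σ(X^v, W^v) = -W^v(Q_X)` on `P` for every `W`. The invariant formula then
becomes `-𝐝²Q_X(Y^v, Z^v)`, which vanishes since derivatives along fundamental fields commute up to
the bracket. For a symplectic action the claim is the hypothesis on tangent fundamental fields. -/
theorem integral_dInnerPresymp_eq_zero (hγ : ∀ X, L.IsLocalFunctional (γ X))
    (hP : L.IsPhaseSpace S P) (h : L.IsMomentMap γ S P ∨ L.IsSymplecticAction S P)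
    {φ : Fields m ι κ M} (hφ : φ ∈ P) (X Y Z : DiffAlg (m + 2) M) :
    S.integral (L.dInnerPresymp X Y Z φ) = 0 := by
  rcases h with h | h
  · have hf := (hP.1 hφ).1
    have hQ := L.smoothLocal_charge S hγ X
    have h1 : ∀ W : DiffAlg (m + 2) M, ∀ ψ ∈ P,
        L.chargeBracket S X W ψ = -dFun (L.charge γ S X) ψ (vert W.field ψ) :=
      fun W ψ hψ => h ψ hψ X _ (hP.2 ψ hψ W)
    rw [L.integral_dInnerPresymp S hf,
      L.dFun_eq_neg_of_eqOn S hP (L.smoothLocal_chargeBracket S X Z) (hQ.dFun_vert Z) (h1 Z) hφ Y,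
      L.dFun_eq_neg_of_eqOn S hP (L.smoothLocal_chargeBracket S X Y) (hQ.dFun_vert Y) (h1 Y) hφ Z]
    have h2 := hQ.dFun_vert_comm hf.1 (fun x _ => hf.2 x) Y Z
    have h3 := h1 ⁅Y, Z⁆ φ hφ
    rw [chargeBracket] at h3
    rw [h3]
    linear_combination -h2
  · exact h φ hφ X _ _ (hP.2 φ hφ Y) (hP.2 φ hφ Z)

theorem cocycle_identity (hγ : ∀ X, L.IsLocalFunctional (γ X))
    (hP : L.IsPhaseSpace S P) (h : L.IsMomentMap γ S P ∨ L.IsSymplecticAction S P)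
    {φ : Fields m ι κ M} (hφ : φ ∈ P) (X Y Z : DiffAlg (m + 2) M) :
    L.cocycle γ S X ⁅Y, Z⁆ φ + L.cocycle γ S Y ⁅Z, X⁆ φ + L.cocycle γ S Z ⁅X, Y⁆ φ = 0 := by
  rw [L.cocycle_cyclic S hγ (hP.1 hφ)]
  simp only [L.integral_dInnerPresymp_eq_zero S hγ hP h hφ, add_zero]

end Lagrangian

end PhaseSpace

/-! ### The central extension -/

section CentralExtension

variable {L N : Type*} [LieRing L] [LieAlgebra ℝ L] [LieRing N] [LieAlgebra ℝ N]

variable (L N) in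
/-- Real `2`-cocycles with values in the trivial module `N`. -/
structure CentralCocycle where
  /-- the underlying bilinear map -/
  map : L →ₗ[ℝ] L →ₗ[ℝ] N
  map_self : ∀ x, map x x = 0
  map_cyclic : ∀ x y z, map x ⁅y, z⁆ + map y ⁅z, x⁆ + map z ⁅x, y⁆ = 0

namespace CentralCocycle

variable (c : CentralCocycle L N)

theorem map_swap (x y : L) : c.map x y = -c.map y x := by
  have h := c.map_self (x + y)
  simp only [map_add, LinearMap.add_apply, c.map_self, zero_add, add_zero] at h
  exact eq_neg_of_add_eq_zero_right h

/-- The total space `N × L` of the central extension. -/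
def Total (_ : CentralCocycle L N) : Type _ := N × L

instance : AddCommGroup c.Total := inferInstanceAs (AddCommGroup (N × L))

instance : Module ℝ c.Total := inferInstanceAs (Module ℝ (N × L))

instance : Bracket c.Total c.Total where
  bracket x y := ((c.map x.2 y.2, ⁅x.2, y.2⁆) : N × L)

/-- The bracket ignores the `N`-components, so antisymmetry and the Leibniz identity in the first
component are exactly the two cocycle conditions. -/
instance : LieRing c.Total where
  add_lie x y z := Prod.ext
    (show c.map (x.2 + y.2) z.2 = c.map x.2 z.2 + c.map y.2 z.2 by
      rw [map_add, LinearMap.add_apply]) (add_lie x.2 y.2 z.2)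
  lie_add x y z := Prod.ext (map_add (c.map x.2) y.2 z.2) (lie_add x.2 y.2 z.2)
  lie_self x := Prod.ext (c.map_self x.2) (lie_self x.2)
  leibniz_lie x y z := Prod.ext
    (show c.map x.2 ⁅y.2, z.2⁆ = c.map ⁅x.2, y.2⁆ z.2 + c.map y.2 ⁅x.2, z.2⁆ by
      have h := c.map_cyclic x.2 y.2 z.2
      rw [← lie_skew x.2 z.2, map_neg, c.map_swap ⁅x.2, y.2⁆ z.2, ← sub_eq_zero, ← h]
      abel) (leibniz_lie x.2 y.2 z.2)

instance : LieAlgebra ℝ c.Total where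
  lie_smul r x y := Prod.ext (map_smul (c.map x.2) r y.2) (lie_smul r x.2 y.2)

variable [IsLieAbelian N]

/-- The inclusion of the centre. -/
def incl : N →ₗ⁅ℝ⁆ c.Total where
  toFun f := ((f, 0) : N × L)
  map_add' f g := Prod.ext rfl (add_zero (0 : L)).symm
  map_smul' r f := Prod.ext rfl (smul_zero r).symm
  map_lie' {f g} := Prod.ext
    -- The image of `N` brackets to zero, so the inclusion is a homomorphism because `N` is abelian.
    (show ⁅f, g⁆ = c.map 0 0 by rw [map_zero, trivial_lie_zero]) (lie_self (0 : L)).symm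

/-- The projection to the base. -/
def proj : c.Total →ₗ⁅ℝ⁆ L where
  toFun x := x.2
  map_add' _ _ := rfl
  map_smul' _ _ := rfl
  map_lie' := rfl

/-- The central extension. -/
def extension : LieAlgebra.Extension ℝ N L where
  L := c.Total
  instLieRing := inferInstance
  instLieAlgebra := inferInstance
  incl := c.incl
  proj := c.proj
  IsExtension :=
    { ker_eq_bot := (LieHom.ker_eq_bot _).2 fun _ _ h => congrArg Prod.fst h
      range_eq_top := (LieHom.range_eq_top _).2 fun x => ⟨((0, x) : N × L), rfl⟩
      exact := by
        ext x
        refine ⟨fun ⟨f, hf⟩ => hf ▸ rfl, fun hx => ⟨x.1, Prod.ext rfl ?_⟩⟩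
        exact (show x.2 = 0 from hx).symm }

end CentralCocycle

end CentralExtension

/-! ### The boundary term as a two-cocycle with values in smooth functions. -/

section ChargeAlgebra

variable {m : ℕ} {ι κ : Type*} [Fintype ι] [Fintype κ] [DecidableEq ι] [DecidableEq κ]
  {M : Type*} [TopologicalSpace M] [ChartedSpace (Vec (m + 2)) M] [IsManifold (𝓡 (m + 2)) ∞ M]
  (L : Lagrangian m ι κ) {γ : DiffAlg (m + 2) M →ₗ[ℝ] (Fields m ι κ M → Form (m + 2) M m)}
  (S : Chain (m + 2) (m + 1) M) {P : Set (Fields m ι κ M)}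

instance : IsLieAbelian (smoothFunctions P) := ⟨fun _ _ => rfl⟩

namespace Lagrangian

theorem chargeBracket_swap (X Y : DiffAlg (m + 2) M) (φ : Fields m ι κ M) :
    L.chargeBracket S X Y φ = -L.chargeBracket S Y X φ := by
  rw [chargeBracket, chargeBracket, presympInt, presympInt, L.presymp_swap, S.integral_neg]

theorem presymp_add_left {φ δ₁ δ₂ δ₃ : Fields m ι κ M} (hφ : φ ∈ L.fieldSpace M)
    (h₁ : SmoothFields δ₁) (h₂ : SmoothFields δ₂) (h₃ : SmoothFields δ₃) :
    L.presymp φ (δ₁ + δ₂) δ₃ = L.presymp φ δ₁ δ₃ + L.presymp φ δ₂ δ₃ := by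
  have h := L.presymp_sub_left hφ (h₁.add h₂) h₂ h₃
  rw [add_sub_cancel_right] at h
  rw [h, sub_add_cancel]

theorem presymp_smul_left (c : ℝ) {φ δ₁ δ₂ : Fields m ι κ M} (hφ : φ ∈ L.fieldSpace M)
    (h₁ : SmoothFields δ₁) (h₂ : SmoothFields δ₂) :
    L.presymp φ (c • δ₁) δ₂ = c • L.presymp φ δ₁ δ₂ := by
  funext x
  rw [Pi.smul_apply, L.presymp_apply hφ.1 (hφ.2 x) (h₁.smul c) h₂,
    L.presymp_apply hφ.1 (hφ.2 x) h₁ h₂, jet_smul, dForm_smul_left]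

theorem chargeBracket_add_left {φ : Fields m ι κ M} (hφ : φ ∈ L.fieldSpace M)
    (X Y Z : DiffAlg (m + 2) M) :
    L.chargeBracket S (X + Y) Z φ = L.chargeBracket S X Z φ + L.chargeBracket S Y Z φ := by
  have hv := fun W : DiffAlg (m + 2) M => hφ.1.vert W
  have h : vert (X + Y).field φ = vert X.field φ + vert Y.field φ := vert_add_field X Y hφ.1
  rw [chargeBracket, h, presympInt, L.presymp_add_left hφ (hv X) (hv Y) (hv Z)]
  exact S.integral_add (fun x _ => (L.isSmooth_presymp hφ (hv X) (hv Z)).smAt x)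
    fun x _ => (L.isSmooth_presymp hφ (hv Y) (hv Z)).smAt x

theorem chargeBracket_smul_left {φ : Fields m ι κ M} (hφ : φ ∈ L.fieldSpace M) (c : ℝ)
    (X Z : DiffAlg (m + 2) M) :
    L.chargeBracket S (c • X) Z φ = c * L.chargeBracket S X Z φ := by
  have h : vert (c • X).field φ = c • vert X.field φ := vert_smul_field c X.field φ
  rw [chargeBracket, h, presympInt, L.presymp_smul_left c hφ (hφ.1.vert X) (hφ.1.vert Z)]
  exact S.integral_smul _ _

/-- On shell, antisymmetry and bilinearity of `𝒞` are inherited from `Θ_Σ` and from linearity of the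
charge, without inspecting the boundary form. -/
theorem cocycle_eq_sub (hγ : ∀ X, L.IsLocalFunctional (γ X)) {φ : Fields m ι κ M}
    (hφ : φ ∈ L.solutions M) (X Y : DiffAlg (m + 2) M) :
    L.cocycle γ S X Y φ = L.chargeBracket S X Y φ - L.charge γ S ⁅X, Y⁆ φ := by
  rw [L.chargeBracket_eq_of_mem_solutions S hγ hφ]
  ring

theorem cocycle_swap (hγ : ∀ X, L.IsLocalFunctional (γ X)) {φ : Fields m ι κ M}
    (hφ : φ ∈ L.solutions M) (X Y : DiffAlg (m + 2) M) :
    L.cocycle γ S X Y φ = -L.cocycle γ S Y X φ := by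
  have h := L.charge_smul (γ := γ) S (-1) ⁅Y, X⁆ φ
  rw [neg_one_smul, lie_skew] at h
  rw [L.cocycle_eq_sub S hγ hφ, L.cocycle_eq_sub S hγ hφ, L.chargeBracket_swap S X Y, h]
  ring

theorem cocycle_add_left (hγ : ∀ X, L.IsLocalFunctional (γ X)) {φ : Fields m ι κ M}
    (hφ : φ ∈ L.solutions M) (X Y Z : DiffAlg (m + 2) M) :
    L.cocycle γ S (X + Y) Z φ = L.cocycle γ S X Z φ + L.cocycle γ S Y Z φ := by
  rw [L.cocycle_eq_sub S hγ hφ, L.cocycle_eq_sub S hγ hφ, L.cocycle_eq_sub S hγ hφ, add_lie,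
    L.chargeBracket_add_left S hφ.1, L.charge_add S hγ hφ.1]
  ring

theorem cocycle_smul_left (hγ : ∀ X, L.IsLocalFunctional (γ X)) {φ : Fields m ι κ M}
    (hφ : φ ∈ L.solutions M) (c : ℝ) (X Z : DiffAlg (m + 2) M) :
    L.cocycle γ S (c • X) Z φ = c * L.cocycle γ S X Z φ := by
  rw [L.cocycle_eq_sub S hγ hφ, L.cocycle_eq_sub S hγ hφ, smul_lie,
    L.chargeBracket_smul_left S hφ.1, L.charge_smul S]
  ring

/-- The charge as a smooth function on `P`. -/
def chargeMap (hγ : ∀ X, L.IsLocalFunctional (γ X)) (hP : P ⊆ L.solutions M) :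
    DiffAlg (m + 2) M →ₗ[ℝ] smoothFunctions P where
  toFun X := ⟨fun φ => L.charge γ S X φ, fun _ u hu hs => contDiff_iff_contDiffAt.2 fun s =>
    (L.smoothLocal_charge S hγ X).contDiffAt u hs s fun x _ => (hP (hu s)).1.2 x⟩
  map_add' X Y := Subtype.ext <| funext fun φ => L.charge_add S hγ (hP φ.2).1 X Y
  map_smul' c X := Subtype.ext <| funext fun φ => L.charge_smul S c X φ

/-- The boundary term as a bilinear map with values in the smooth functions on `P`. -/
def cocycleMap (hγ : ∀ X, L.IsLocalFunctional (γ X)) (hP : P ⊆ L.solutions M) :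
    DiffAlg (m + 2) M →ₗ[ℝ] DiffAlg (m + 2) M →ₗ[ℝ] smoothFunctions P :=
  LinearMap.mk₂ ℝ
    (fun X Y => ⟨fun φ => L.cocycle γ S X Y φ, fun _ u hu hs => contDiff_iff_contDiffAt.2 fun s =>
      S.boundary.contDiffAt_integral fun x _ => L.cocycleForm_family X Y (smoothFamily_iff.1 hs s x)
        ((hγ ⁅X, Y⁆).family hs ((hP (hu s)).1.2 x)) ((hP (hu s)).1.2 x)⟩)
    (fun X Y Z => Subtype.ext <| funext fun φ => L.cocycle_add_left S hγ (hP φ.2) X Y Z)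
    (fun c X Y => Subtype.ext <| funext fun φ => L.cocycle_smul_left S hγ (hP φ.2) c X Y)
    (fun X Y Z => Subtype.ext <| funext fun φ => by
      change L.cocycle γ S X (Y + Z) φ = L.cocycle γ S X Y φ + L.cocycle γ S X Z φ
      rw [L.cocycle_swap S hγ (hP φ.2), L.cocycle_add_left S hγ (hP φ.2), neg_add,
        ← L.cocycle_swap S hγ (hP φ.2), ← L.cocycle_swap S hγ (hP φ.2)])
    (fun c X Y => Subtype.ext <| funext fun φ => by
      change L.cocycle γ S X (c • Y) φ = c * L.cocycle γ S X Y φ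
      rw [L.cocycle_swap S hγ (hP φ.2), L.cocycle_smul_left S hγ (hP φ.2),
        L.cocycle_swap S hγ (hP φ.2) X]
      ring)

/-- The central `2`-cocycle of the charges. -/
def chargeCocycle (hγ : ∀ X, L.IsLocalFunctional (γ X)) (hP : L.IsPhaseSpace S P)
    (h : L.IsMomentMap γ S P ∨ L.IsSymplecticAction S P) :
    CentralCocycle (DiffAlg (m + 2) M) (smoothFunctions P) where
  map := L.cocycleMap S hγ hP.1
  map_self X := Subtype.ext <| funext fun φ =>
    self_eq_neg.1 (L.cocycle_swap S hγ (hP.1 φ.2) X X)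
  map_cyclic X Y Z := Subtype.ext <| funext fun φ => L.cocycle_identity S hγ hP h φ.2 X Y Z

end Lagrangian

end ChargeAlgebra

end CovPhase

end

/-! ### The charge algebra and its central extension. -/

theorem mainTheorem10 (m : ℕ)
    {ι : Type u} {κ : Type v} [Fintype ι] [Fintype κ] [DecidableEq ι] [DecidableEq κ]
    {M : Type w} [TopologicalSpace M] [ChartedSpace (Vec (m + 2)) M]
    [IsManifold (𝓡 (m + 2)) ∞ M]
    (L : Lagrangian m ι κ)
    (γ : DiffAlg (m + 2) M →ₗ[ℝ] (Fields m ι κ M → Form (m + 2) M m))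
    (hγ : ∀ X, L.IsLocalFunctional (γ X))
    (S : Chain (m + 2) (m + 1) M) :
    -- the field equations and the presymplectic potential: `𝐝L = E + dθ`
    (∀ φ ∈ L.fieldSpace M, ∀ δφ, SmoothFields δφ →
      dFormFun L.form φ δφ = L.euler φ δφ + extD (L.theta φ δφ)) ∧
    -- the bracket of charges, off shell
    (∀ φ ∈ L.fieldSpace M, ∀ X Y : DiffAlg (m + 2) M,
      L.chargeBracket S X Y φ = L.charge γ S ⁅X, Y⁆ φ + L.cocycle γ S X Y φ
        + S.integral (iprod Y.field (L.euler φ (vert X.field φ))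
            - iprod X.field (L.euler φ (vert Y.field φ)))) ∧
    -- the bracket of charges and the boundary term, on shell
    (∀ φ ∈ L.solutions M, ∀ X Y : DiffAlg (m + 2) M,
      L.chargeBracket S X Y φ = L.charge γ S ⁅X, Y⁆ φ + L.cocycle γ S X Y φ ∧
      L.cocycle γ S X Y φ = S.boundary.integral
        (lieD X.field (L.thetaLow φ (innerField Y.field φ))
          - lieD Y.field (L.thetaLow φ (innerField X.field φ))
          + iprod X.field (iprod Y.field (L.form φ)) + γ ⁅X, Y⁆ φ)) ∧
    -- the Jacobiator
    (∀ φ ∈ L.solutions M, ∀ X Y Z : DiffAlg (m + 2) M,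
      L.cocycle γ S X ⁅Y, Z⁆ φ + L.cocycle γ S Y ⁅Z, X⁆ φ + L.cocycle γ S Z ⁅X, Y⁆ φ =
        S.integral (L.dInnerPresymp X Y Z φ) + S.integral (L.dInnerPresymp Y Z X φ)
          + S.integral (L.dInnerPresymp Z X Y φ)) ∧
    -- the boundary flux that obstructs the charges from being moment maps
    (∀ φ ∈ L.solutions M, ∀ X : DiffAlg (m + 2) M, ∀ δφ, SmoothFields δφ →
      L.presympInt S φ (vert X.field φ) δφ = -dFun (L.charge γ S X) φ δφ
        + S.boundary.integral (iprod X.field (L.theta φ δφ) - dFormFun (γ X) φ δφ)) ∧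
    -- the central extension
    (∀ P : Set (Fields m ι κ M), L.IsPhaseSpace S P →
      L.IsMomentMap γ S P ∨ L.IsSymplecticAction S P →
      (∀ φ ∈ P, ∀ X Y Z : DiffAlg (m + 2) M,
        L.cocycle γ S X ⁅Y, Z⁆ φ + L.cocycle γ S Y ⁅Z, X⁆ φ + L.cocycle γ S Z ⁅X, Y⁆ φ = 0) ∧
      ∃ (c : DiffAlg (m + 2) M →ₗ[ℝ] DiffAlg (m + 2) M →ₗ[ℝ] smoothFunctions P)
        (A : LieAlgebra.Extension.{0, max u v w, w, max u v w} ℝ (smoothFunctions P)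
          (DiffAlg (m + 2) M))
        (q : DiffAlg (m + 2) M →ₗ[ℝ] A.L) (ev : A.L →ₗ[ℝ] smoothFunctions P),
        (∀ X Y, ∀ φ : P, (c X Y : P → ℝ) φ = L.cocycle γ S X Y φ) ∧
        (∀ f, ∀ z : A.L, ⁅A.incl f, z⁆ = 0) ∧
        (∀ X, A.proj (q X) = X) ∧
        (∀ f, ev (A.incl f) = f) ∧
        (∀ X, ∀ φ : P, (ev (q X) : P → ℝ) φ = L.charge γ S X φ) ∧
        (∀ X Y, ⁅q X, q Y⁆ = q ⁅X, Y⁆ + A.incl (c X Y)) ∧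
        (∀ X Y, ∀ φ : P, (ev ⁅q X, q Y⁆ : P → ℝ) φ = L.chargeBracket S X Y φ)) := by
  refine ⟨fun φ hφ δφ hδ => L.dFormFun_form hφ hδ,
    fun φ hφ X Y => L.chargeBracket_eq S hγ hφ X Y,
    fun φ hφ X Y => ⟨L.chargeBracket_eq_of_mem_solutions S hγ hφ X Y,
      L.cocycle_eq_of_mem_solutions S hφ X Y⟩,
    fun φ hφ X Y Z => L.cocycle_cyclic S hγ hφ X Y Z,
    fun φ hφ X δφ hδ => L.presympInt_vert_eq S hγ hφ X hδ, fun P hP h => ?_⟩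
  refine ⟨fun φ hφ X Y Z => L.cocycle_identity S hγ hP h hφ X Y Z, ?_⟩
  set c := L.chargeCocycle S hγ hP h with hc
  -- The left-hand side is what the evaluation map gives on the bracket of two lifted vector fields;
  -- the equality is the on-shell bracket of charges.
  have hb : ∀ X Y : DiffAlg (m + 2) M, (c.map X Y + L.chargeMap S hγ hP.1 ⁅X, Y⁆ : P → ℝ) =
      fun φ : P => L.chargeBracket S X Y φ := fun X Y => funext fun φ => by
    rw [L.chargeBracket_eq_of_mem_solutions S hγ (hP.1 φ.2), add_comm]
    rfl
  -- On the total space `C^∞(P) × 𝔡𝔦𝔣𝔣(M)` the section is `X ↦ (0, X)` and the evaluation is `(f, X)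
  -- ↦ f + Q_Σ(X)`.
  refine ⟨c.map, c.extension, LinearMap.inr ℝ (smoothFunctions P) (DiffAlg (m + 2) M),
    (LinearMap.id : smoothFunctions P →ₗ[ℝ] smoothFunctions P).coprod (L.chargeMap S hγ hP.1),
    fun X Y φ => rfl, fun f z => ?_, fun X => rfl, fun f => ?_, fun X φ => ?_, fun X Y => ?_,
    fun X Y φ => congrFun (hb X Y) φ⟩
  · exact Prod.ext (LinearMap.congr_fun (map_zero c.map) z.2) (zero_lie z.2)
  · exact (congrArg (f + ·) (map_zero (L.chargeMap S hγ hP.1))).trans (add_zero f)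
  · exact zero_add (L.charge γ S X φ)
  · exact Prod.ext (zero_add (c.map X Y)).symm (add_zero ⁅X, Y⁆).symm
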